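/- Let $I_0=(-\pi/2,\pi/2)$ and $\mathcal H=L^2(\mathbb R^3)$. Let $\mathbf a_0:\mathbb R^3\to\mathbb R^3$ and $\mathbf e:I_0\times\mathbb R^3\to\mathbb R^3$ be measurable with $\mathbf a_0,\ \nabla\cdot\mathbf a_0\in L^\infty(\mathbb R^3)$ and $\mathbf e,\ \nabla\cdot\mathbf e\in L^\infty(I\times\mathbb R^3)$ for each compact interval $I\subset I_0$ (weak divergences in $\mathbf x$), and let $$\mathbf a(\tau,\mathbf x)=\mathbf a_0(\mathbf x)-\int_0^\tau\mathbf e(\rho,\mathbf x)\,d\rho\qquad(\mathbf a\text{-gauge, vanishing scalar potential}).$$ Let $h(\tau)=\tfrac12\big[(-i\nabla-\mathbf a(\tau))^2+\mathbf x^2\big]$ be the operator in $\mathcal H$ determined by the quadratic form $\tfrac12\|(-i\nabla-\mathbf a(\tau))\psi\|^2+\tfrac12\|\mathbf x\psi\|^2$ on $\{\psi\in\mathcal H:\nabla\psi,\ \mathbf x\psi\in\mathcal H\}$, and $h_0=\tfrac12(-\Delta+\mathbf x^2)$. Suppose that $$\int_{-\pi/2}^{\pi/2}\big(\tfrac\pi2-|\tau|\big)^2\,\|\mathbf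 e(\tau,\cdot)^2\|_\infty\,d\tau<\infty ,$$ and that for each closed $K\subset\mathbb R^3\setminus\{\mathbf x:\mathbf x^2=1\}$ $$\int_{-\pi/2}^{\pi/2}\big(\tfrac\pi2-|\tau|\big)\,\|\nabla\cdot\mathbf e(\tau,\cdot)\|_{L^\infty(K)}\,d\tau<\infty .$$ Then there is a unique unitary propagator $u(\tau,\sigma)$, $\tau,\sigma\in I_0$, for the family $h(\tau)$: it is a family of unitary operators with $u(\tau,\tau)=1$ and $u(\tau,\sigma)u(\sigma,\rho)=u(\tau,\rho)$, strongly continuous in $(\tau,\sigma)$, with $u(\tau,\sigma)\mathcal D(h_0)=\mathcal D(h_0)$, and for $\psi\in\mathcal D(h_0)$ the map $(\tau,\sigma)\mapsto u(\tau,\sigma)\psi$ is of class $C^1$ with $i\partial_\tau u(\tau,\sigma)\psi=h(\tau)u(\tau,\sigma)\psi$ and $i\partial_\sigma u(\tau,\sigma)\psi=-u(\tau,\sigma)h(\sigma)\psi$. Moreover, for each of the signs $\pm$ the following hold. 1. There are asymptotic position operators $\tilde{\mathbf x}_\pm$ (a triple of strongly commuting self-adjoint operators, given by their joint spectral measure)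 such that $e^{i\mathbf q\cdot\tilde{\mathbf x}_\pm}=\operatorname{s-lim}_{\tau\to\pm\pi/2}u(0,\tau)\,e^{i\mathbf q\cdot\mathbf x}\,u(\tau,0)$ for all $\mathbf q\in\mathbb R^3$. 2. The wave operators $\Omega_\pm=\operatorname{s-lim}_{\tau\to\pm\pi/2}u(0,\tau)$ exist and are isometric. 3. $f(\tilde{\mathbf x}_\pm)=\Omega_\pm f(\mathbf x)\Omega_\pm^*$ for each bounded continuous $f:\mathbb R^3\to\mathbb C$ whose support does not intersect $\{\mathbf x^2=1\}$. 4. $\Omega_\pm\Omega_\pm^*=E_\pm$, where $E_\pm=1-\mathbf 1_{\{1\}}(\tilde{\mathbf x}_\pm^2)$. 5. $\operatorname{s-lim}_{\tau\to\pm\pi/2}u(\tau,0)E_\pm=\Omega_\pm^*$. 6. In the Schrödinger picture $\Omega_\pm=\operatorname{s-lim}_{t\to\pm\infty}U(0,t)N(t)$, where, with $\langle t\rangle=\sqrt{1+t^2}$, $[N(t)\chi](\mathbf x)=\langle t\rangle^{-3/2}\exp\big[\tfrac{it}{2}(|\mathbf x|/\langle t\rangle)^2\big]\chi(\mathbf x/\langle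 t\rangle)$ is unitary and $U(t,s)=N(t)\,u(\arctan t,\arctan s)\,N(s)^*$. -/

import Mathlib

open MeasureTheory Filter Topology Set
open scoped ENNReal ContDiff BoundedContinuousFunction ComplexConjugate

/-- Three-dimensional Euclidean space. -/
abbrev E3 : Type := EuclideanSpace ℝ (Fin 3)

/-- The Hilbert space `L²(ℝ³)` of complex wave functions. -/
abbrev WaveSpace : Type := Lp ℂ 2 (volume : Measure E3)

/-! ### Test functions, weak derivatives -/

/-- Complex test functions: smooth with compact support. -/
def IsTestFn (φ : E3 → ℂ) : Prop := ContDiff ℝ ∞ φ ∧ HasCompactSupport φ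

/-- The classical partial derivative `∂_j φ`. -/
noncomputable def pderiv3 (j : Fin 3) (φ : E3 → ℂ) (x : E3) : ℂ :=
  fderiv ℝ φ x (EuclideanSpace.single j 1)

/-- `g` is the weak partial derivative `∂_j ψ` (both in `L²`). -/
def HasWeakPDeriv (j : Fin 3) (ψ g : WaveSpace) : Prop :=
  ∀ φ : E3 → ℂ, IsTestFn φ → ∫ x, pderiv3 j φ x * ψ x = -∫ x, φ x * g x

/-- `d` is the weak divergence of the vector field `b`:
`∫ b · ∇φ = - ∫ d φ` for all real test functions `φ`. -/
def HasWeakDiv (b : E3 → E3) (d : E3 → ℝ) : Prop :=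
  ∀ φ : E3 → ℝ, ContDiff ℝ ∞ φ → HasCompactSupport φ →
    ∫ x, fderiv ℝ φ x (b x) = -∫ x, d x * φ x

/-! ### The oscillator Hamiltonian and its propagator -/

/-- For a (bounded) vector potential `b` on `ℝ³`: `IsHamiltonian b ψ χ` says that `ψ` lies in the
domain of the operator `h = ½(π² + x²)`, `π = -i∇ - b`, and that `h ψ = χ`. The operator is the one
determined by the quadratic form `q(φ,ψ) = ½ (π φ, π ψ) + ½ (x φ, x ψ)` with form domain
`{ψ | ∇ψ ∈ L², x ψ ∈ L²}`: `q(φ,ψ) = (φ,χ)` for all `φ` in the form core of test functions. -/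
def IsHamiltonian (b : E3 → E3) (ψ χ : WaveSpace) : Prop :=
  ∃ g : Fin 3 → WaveSpace,
    (∀ j, HasWeakPDeriv j ψ (g j)) ∧
    (∀ j, MemLp (fun x : E3 => (x j : ℂ) * ψ x) 2 volume) ∧
    ∀ φ : E3 → ℂ, IsTestFn φ →
      (1 / 2 : ℂ) * (∑ j, ∫ x, conj (-Complex.I * pderiv3 j φ x - (b x j : ℂ) * φ x) *
          (-Complex.I * g j x - (b x j : ℂ) * ψ x)) +
      (1 / 2 : ℂ) * (∑ j, ∫ x : E3, conj ((x j : ℂ) * φ x) * ((x j : ℂ) * ψ x)) =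
      ∫ x, conj (φ x) * χ x

/-- The domain `D(h₀)` of the unperturbed oscillator Hamiltonian `h₀ = ½(-Δ + x²)`. -/
def oscDomain : Set WaveSpace := {ψ | ∃ χ, IsHamiltonian 0 ψ χ}

/-- The time interval `(-π/2, π/2)` of the oscillator picture. -/
noncomputable def oscTimes : Set ℝ := Ioo (-(Real.pi / 2)) (Real.pi / 2)

/-- The vector potential in an `a`-gauge (in which the scalar potential vanishes):
`a(τ,x) = a(0,x) - ∫_0^τ e(ρ,x) dρ`. -/
noncomputable def aGauge (a₀ : E3 → E3) (e : ℝ → E3 → E3) (τ : ℝ) (x : E3) : E3 :=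
  a₀ x - ∫ ρ in (0 : ℝ)..τ, e ρ x

/-- `u` is the unitary propagator of the family `h(τ) = ½((-i∇ - a(τ))² + x²)`,
for times in `(-π/2, π/2)`. -/
structure IsUnitaryPropagator (a : ℝ → E3 → E3) (u : ℝ → ℝ → (WaveSpace →L[ℂ] WaveSpace)) :
    Prop where
  unitary : ∀ τ ∈ oscTimes, ∀ σ ∈ oscTimes, u τ σ ∈ unitary (WaveSpace →L[ℂ] WaveSpace)
  refl : ∀ τ ∈ oscTimes, u τ τ = 1
  comp : ∀ τ ∈ oscTimes, ∀ σ ∈ oscTimes, ∀ ρ ∈ oscTimes, u τ σ * u σ ρ = u τ ρ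
  continuous : ∀ ψ, ContinuousOn (fun p : ℝ × ℝ => u p.1 p.2 ψ) (oscTimes ×ˢ oscTimes)
  domain : ∀ τ ∈ oscTimes, ∀ σ ∈ oscTimes, u τ σ '' oscDomain = oscDomain
  contDiff : ∀ ψ ∈ oscDomain,
    ContDiffOn ℝ 1 (fun p : ℝ × ℝ => u p.1 p.2 ψ) (oscTimes ×ˢ oscTimes)
  /-- `i ∂_τ u(τ,σ)ψ = h(τ) u(τ,σ)ψ` -/
  deriv_left : ∀ ψ ∈ oscDomain, ∀ τ ∈ oscTimes, ∀ σ ∈ oscTimes,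
    ∃ χ, IsHamiltonian (a τ) (u τ σ ψ) χ ∧
      HasDerivAt (fun t : ℝ => u t σ ψ) (-Complex.I • χ) τ
  /-- `i ∂_σ u(τ,σ)ψ = - u(τ,σ) h(σ)ψ` -/
  deriv_right : ∀ ψ ∈ oscDomain, ∀ τ ∈ oscTimes, ∀ σ ∈ oscTimes,
    ∃ χ, IsHamiltonian (a σ) ψ χ ∧
      HasDerivAt (fun s : ℝ => u τ s ψ) (Complex.I • u τ σ χ) σ

/-! ### Multiplication operators and functions of the asymptotic position -/

theorem memLp_top_bcf (f : E3 →ᵇ ℂ) : MemLp f ∞ (volume : Measure E3) :=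
  memLp_top_of_bound f.continuous.aestronglyMeasurable ‖f‖
    (Eventually.of_forall fun x => f.norm_coe_le_norm x)

/-- The operator `f(x)` on `L²(ℝ³)` of multiplication by the bounded continuous function `f`. -/
noncomputable def mulOp (f : E3 →ᵇ ℂ) : WaveSpace →L[ℂ] WaveSpace :=
  (ContinuousLinearMap.mul ℂ ℂ).holderL (volume : Measure E3) ∞ 2 2 ((memLp_top_bcf f).toLp f)

theorem mulOp_apply_ae (f : E3 →ᵇ ℂ) (ψ : WaveSpace) :
    mulOp f ψ =ᵐ[volume] fun x => f x * ψ x := by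
  have h := (ContinuousLinearMap.mul ℂ ℂ).coeFn_holder (r := 2)
    ((memLp_top_bcf f).toLp f) ψ
  filter_upwards [h, (memLp_top_bcf f).coeFn_toLp] with x hx hf
  simp only [ContinuousLinearMap.mul_apply'] at hx
  rw [hf] at hx
  exact hx

/-- The function `x ↦ exp(i q·x)`. -/
noncomputable def planeWave (q : E3) : E3 →ᵇ ℂ :=
  BoundedContinuousFunction.ofNormedAddCommGroup
    (fun x => Complex.exp (((inner ℝ q x : ℝ) : ℂ) * Complex.I)) (by fun_prop) 1
    (fun x => (Complex.norm_exp_ofReal_mul_I _).le)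

/-- A spectral (projection-valued) measure on `ℝ³`, i.e. the joint spectral resolution of a triple
of strongly commuting self-adjoint operators. -/
structure SpectralMeasure3 where
  proj : Set E3 → (WaveSpace →L[ℂ] WaveSpace)
  isStarProjection : ∀ s, MeasurableSet s → IsStarProjection (proj s)
  proj_univ : proj univ = 1
  proj_inter : ∀ s t, MeasurableSet s → MeasurableSet t → proj (s ∩ t) = proj s * proj t
  hasSum : ∀ s : ℕ → Set E3, (∀ n, MeasurableSet (s n)) → Pairwise (fun m n => Disjoint (s m) (s n)) →
    ∀ ψ, HasSum (fun n => proj (s n) ψ) (proj (⋃ n, s n) ψ)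

namespace SpectralMeasure3

theorem re_inner_nonneg (P : SpectralMeasure3) (ψ : WaveSpace) {s : Set E3}
    (hs : MeasurableSet s) : 0 ≤ (inner ℂ ψ (P.proj s ψ)).re := by
  have h := P.isStarProjection s hs
  have h1 : P.proj s ψ = P.proj s (P.proj s ψ) := by
    conv_lhs => rw [← h.isIdempotentElem.eq]
    rfl
  rw [h1, ← ContinuousLinearMap.adjoint_inner_left, ← ContinuousLinearMap.star_eq_adjoint,
    h.isSelfAdjoint.star_eq]
  exact inner_self_nonneg (𝕜 := ℂ)

/-- The scalar spectral measure `s ↦ (ψ, P(s) ψ)`. -/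
noncomputable def measure (P : SpectralMeasure3) (ψ : WaveSpace) : Measure E3 :=
  Measure.ofMeasurable (fun s _ => ENNReal.ofReal (inner ℂ ψ (P.proj s ψ)).re)
    (by
      have h := P.hasSum (fun _ => ∅) (fun _ => MeasurableSet.empty)
        (fun _ _ _ => disjoint_bot_left) ψ
      have h0 : P.proj ∅ ψ = 0 := by
        by_contra hne
        exact hne ((tendsto_const_nhds_iff).mp h.summable.tendsto_atTop_zero)
      simp [h0])
    (by
      intro f hf hd
      have h := P.hasSum f hf hd ψ
      have h2 : HasSum (fun n => (inner ℂ ψ (P.proj (f n) ψ)).re)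
          (inner ℂ ψ (P.proj (⋃ n, f n) ψ)).re :=
        Complex.hasSum_re ((innerSL ℂ ψ).hasSum h)
      rw [← h2.tsum_eq, ENNReal.ofReal_tsum_of_nonneg
        (fun n => P.re_inner_nonneg ψ (hf n)) h2.summable])

/-- For a bounded Borel function `f`: `T` is the operator `∫ f dP`, that is,
`(ψ, T ψ) = ∫ f d(ψ, P ψ)` for all `ψ`. -/
def HasIntegral (P : SpectralMeasure3) (f : E3 → ℂ) (T : WaveSpace →L[ℂ] WaveSpace) : Prop :=
  ∀ ψ, inner ℂ ψ (T ψ) = ∫ x, f x ∂(P.measure ψ)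

/-- `P` is the joint spectral measure of the asymptotic position operators `x̃_±`, where the
filter `l` expresses `τ → ±π/2`:
`exp(i q·x̃_±) = s-lim u(0,τ) exp(i q·x) u(τ,0)` for all vectors `q`. -/
def IsAsymptoticPosition (P : SpectralMeasure3) (u : ℝ → ℝ → (WaveSpace →L[ℂ] WaveSpace))
    (l : Filter ℝ) : Prop :=
  ∀ q : E3, ∃ W : WaveSpace →L[ℂ] WaveSpace, P.HasIntegral (planeWave q) W ∧
    ∀ ψ, Tendsto (fun τ => u 0 τ (mulOp (planeWave q) (u τ 0 ψ))) l (𝓝 (W ψ))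

end SpectralMeasure3

/-! ### The Schrödinger picture -/

/-- `⟨t⟩ = √(1 + t²)`. -/
noncomputable def jap (t : ℝ) : ℝ := √(1 + t ^ 2)

theorem jap_pos (t : ℝ) : 0 < jap t := Real.sqrt_pos.mpr (by positivity)

/-- `⟨t⟩^{-3/2} exp[(i t/2) (|x|/⟨t⟩)²] χ(x/⟨t⟩)`. -/
noncomputable def niedererFun (t : ℝ) (χ : E3 → ℂ) (x : E3) : ℂ :=
  ((jap t ^ (-(3 / 2) : ℝ) : ℝ) : ℂ) *
    Complex.exp (((t / 2 * (‖x‖ / jap t) ^ 2 : ℝ) : ℂ) * Complex.I) * χ ((jap t)⁻¹ • x)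

theorem quasi_jap (t : ℝ) :
    Measure.QuasiMeasurePreserving (fun x : E3 => (jap t)⁻¹ • x) volume volume := by
  refine ⟨by fun_prop, ?_⟩
  rw [Measure.map_addHaar_smul _ (inv_ne_zero (jap_pos t).ne')]
  exact Measure.smul_absolutelyContinuous

theorem eLpNorm_niedererFun (t : ℝ) (χ : E3 → ℂ) (hχ : AEStronglyMeasurable χ volume) :
    eLpNorm (niedererFun t χ) 2 volume = eLpNorm χ 2 volume := by
  have hp := jap_pos t
  have h1 : eLpNorm (niedererFun t χ) 2 volume =
      eLpNorm ((jap t ^ (-(3 / 2) : ℝ)) • (fun x : E3 => χ ((jap t)⁻¹ • x))) 2 volume := by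
    refine eLpNorm_congr_norm_ae (Eventually.of_forall fun x => ?_)
    simp only [niedererFun, norm_mul, Complex.norm_exp_ofReal_mul_I, mul_one, Pi.smul_apply,
      norm_smul, Complex.norm_real]
  have hmap := Measure.map_addHaar_smul (volume : Measure E3) (inv_ne_zero hp.ne')
  have h2 : eLpNorm (fun x : E3 => χ ((jap t)⁻¹ • x)) 2 volume =
      eLpNorm χ 2 (Measure.map (fun x : E3 => (jap t)⁻¹ • x) volume) := by
    rw [eLpNorm_map_measure]
    · rfl
    · rw [hmap]; exact hχ.smul_measure _
    · fun_prop
  rw [h1, eLpNorm_const_smul, h2, hmap, eLpNorm_smul_measure_of_ne_zero]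
  · have e3 : Module.finrank ℝ E3 = 3 := by simp
    rw [e3, smul_eq_mul, ← mul_assoc]
    conv_rhs => rw [← one_mul (eLpNorm χ 2 volume)]
    congr 1
    rw [Real.enorm_eq_ofReal (by positivity), abs_of_pos (by positivity), inv_pow, inv_inv,
      ENNReal.ofReal_rpow_of_pos (by positivity), ← ENNReal.ofReal_mul (by positivity),
      ← Real.rpow_natCast, ← Real.rpow_mul hp.le, ← Real.rpow_add hp]
    norm_num
  · have : (0 : ℝ) < |((jap t)⁻¹ ^ Module.finrank ℝ E3)⁻¹| := by positivity
    simpa using this.ne'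

theorem memLp_niedererFun (t : ℝ) (χ : WaveSpace) : MemLp (niedererFun t χ) 2 volume := by
  refine ⟨?_, ?_⟩
  · refine AEStronglyMeasurable.mul ?_
      ((Lp.aestronglyMeasurable χ).comp_quasiMeasurePreserving (quasi_jap t))
    exact Continuous.aestronglyMeasurable (by fun_prop)
  · rw [eLpNorm_niedererFun t χ (Lp.aestronglyMeasurable χ)]
    exact Lp.eLpNorm_lt_top χ

/-- The Niederer transformation `N(t)` from the oscillator to the Schrödinger picture. -/
noncomputable def niederer (t : ℝ) : WaveSpace →ₗᵢ[ℂ] WaveSpace where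
  toFun χ := (memLp_niedererFun t χ).toLp _
  map_add' χ₁ χ₂ := by
    rw [← MemLp.toLp_add]
    refine MemLp.toLp_congr _ _ ?_
    filter_upwards [(quasi_jap t).ae (Lp.coeFn_add χ₁ χ₂)] with x hx
    simp only [niedererFun, Pi.add_apply] at hx ⊢
    rw [hx]; ring
  map_smul' c χ := by
    rw [RingHom.id_apply, ← MemLp.toLp_const_smul]
    refine MemLp.toLp_congr _ _ ?_
    filter_upwards [(quasi_jap t).ae (Lp.coeFn_smul c χ)] with x hx
    simp only [niedererFun, Pi.smul_apply, smul_eq_mul] at hx ⊢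
    rw [hx]; ring
  norm_map' χ := by
    change ‖(memLp_niedererFun t χ).toLp _‖ = ‖χ‖
    rw [Lp.norm_toLp, eLpNorm_niedererFun t χ (Lp.aestronglyMeasurable χ), Lp.norm_def]

/-- `N(t)` as a bounded operator; `N(t)⁻¹ = N(t)*` is its adjoint. -/
noncomputable def niedererOp (t : ℝ) : WaveSpace →L[ℂ] WaveSpace :=
  (niederer t).toContinuousLinearMap

/-- The Schrödinger picture evolution `U(t,s) = N(t) u(arctan t, arctan s) N(s)*`. -/
noncomputable def schrodingerEvol (u : ℝ → ℝ → (WaveSpace →L[ℂ] WaveSpace)) (t s : ℝ) :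
    WaveSpace →L[ℂ] WaveSpace :=
  niedererOp t * u (Real.arctan t) (Real.arctan s) * ContinuousLinearMap.adjoint (niedererOp s)

/-! Write `A t = 2 h(t) + 1`, let `S t` be its bounded positive injective inverse and let `T t` be
the map `χ ↦ (ψ, π ψ, x ψ)` with `ψ = S t χ`, so that `S t = (T t)* (T t)`. Two facts about the
dependence on `t` carry everything.

Operator level: replacing `b` by `b + c` changes `2h` by `∑ (c_j² - 2 c_j π_j) + i ∇·c`, which is
bounded relative to `A`. Since `c` and `∇·c` are `O(|t - s|)` on compact time intervals, the `A t`
share the domain `D(h₀)` and satisfy `A t (S s) = 1 + B t s` with `‖B t s‖ ≤ L |t - s|`. This gives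
the propagator. The bounded operators `(S t + ε)⁻¹` replace `A t`, the corresponding equation is
solved by a Dyson series, the graph norm is bounded uniformly in `ε` by a Gronwall argument, and `ε
→ 0`. Uniqueness is conservation of the norm of a difference of solutions.

Form level: the triple `(ψ, π ψ, x ψ)` changes only by `c ψ` in its momentum slots. Hence the form
norm of a solution grows at most by `|M t - M s| ‖ψ‖`, where `M t = 3 ∫_0^t ‖e(r,·)‖_∞ dr`.
Cauchy-Schwarz in the form bounds the derivative of `⟨ψ, u(r,s) ψ⟩` by a multiple of `(1 + |M r|)²`,
and since `u` is isometric, `‖u(t,s) ψ - ψ‖²` is bounded by the integral of this function from `s`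
to `t`. Hardy's inequality `∫ M² ≤ C ∫ (π/2 - |r|)² ‖e(r,·)‖²_∞ dr` makes that integral converge up
to `±π/2`.

The same estimate applies to `u(τ,0)` and to `u(0,τ)`, so both converge strongly and `Ω` is unitary.
The asymptotic position is then `Ω x Ω*`; its spectral measure vanishes on Lebesgue null sets, in
particular on the unit sphere, so `E = 1`. The remaining assertions follow from this.

Main lemmas: `IsLipschitzResolventFamily.exists_resolventPropagator`, `formMap_add_relOp`,
`IsResolventPropagator.norm_form_le`, `IsResolventPropagator.norm_sub_sq_le`, `hardy_integral_le`,
`exists_unitary_limit`. -/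

open scoped Interval

/-! ### Linear differential equations with bounded continuous generator -/

section LinearODE

variable {𝔸 : Type*} [NormedRing 𝔸] [NormedAlgebra ℝ 𝔸]

/-- The terms of the Dyson series of `U' = K U`. -/
noncomputable def dysonTerm (K : ℝ → 𝔸) : ℕ → ℝ → 𝔸
  | 0, _ => 1
  | n + 1, t => ∫ s in (0 : ℝ)..t, K s * dysonTerm K n s

theorem continuous_dysonTerm {K : ℝ → 𝔸} (hK : Continuous K) (n : ℕ) :
    Continuous (dysonTerm K n) := by
  induction n with
  | zero => exact continuous_const
  | succ n ih =>
    exact intervalIntegral.continuous_primitive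
      (fun a b => (hK.mul ih).intervalIntegrable a b) 0

theorem hasDerivAt_dysonTerm_succ [CompleteSpace 𝔸] {K : ℝ → 𝔸} (hK : Continuous K) (n : ℕ) (t : ℝ) :
    HasDerivAt (dysonTerm K (n + 1)) (K t * dysonTerm K n t) t :=
  ((hK.mul (continuous_dysonTerm hK n)).integral_hasStrictDerivAt 0 t).hasDerivAt

theorem norm_dysonTerm_le [NormOneClass 𝔸] {K : ℝ → 𝔸} {C : ℝ} (hK : Continuous K)
    (hC : ∀ t, ‖K t‖ ≤ C) (n : ℕ) (t : ℝ) :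
    ‖dysonTerm K n t‖ ≤ (C * |t|) ^ n / n.factorial := by
  have hC0 : 0 ≤ C := (norm_nonneg _).trans (hC 0)
  induction n generalizing t with
  | zero => simp [dysonTerm]
  | succ n ih =>
    have h1 : ‖dysonTerm K (n + 1) t‖ ≤
        ∫ s in Ι 0 t, ‖K s * dysonTerm K n s‖ :=
      intervalIntegral.norm_integral_le_integral_norm_uIoc
    have h2 : ∫ s in Ι 0 t, ‖K s * dysonTerm K n s‖ ≤
        ∫ s in Ι 0 t, C ^ (n + 1) / n.factorial * |s - 0| ^ n := by
      refine setIntegral_mono_on ?_ ?_ measurableSet_uIoc ?_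
      · exact ((hK.mul (continuous_dysonTerm hK n)).norm.intervalIntegrable 0 t).def'
      · exact (Continuous.intervalIntegrable (by fun_prop) 0 t).def'
      · intro s _
        calc ‖K s * dysonTerm K n s‖ ≤ C * ((C * |s|) ^ n / n.factorial) :=
              (norm_mul_le _ _).trans (mul_le_mul (hC s) (ih s) (norm_nonneg _) hC0)
          _ = _ := by rw [sub_zero, mul_pow]; ring
    refine (h1.trans h2).trans (le_of_eq ?_)
    rw [integral_const_mul, integral_pow_abs_sub_uIoc, sub_zero, Nat.factorial_succ]
    push_cast
    rw [mul_pow]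
    field_simp

theorem exists_linearODE_solution [CompleteSpace 𝔸] [NormOneClass 𝔸] {K : ℝ → 𝔸} {C : ℝ} (hK : Continuous K)
    (hC : ∀ t, ‖K t‖ ≤ C) :
    ∃ U : ℝ → 𝔸, U 0 = 1 ∧ ∀ t, HasDerivAt U (K t * U t) t := by
  have hC0 : 0 ≤ C := (norm_nonneg _).trans (hC 0)
  have hsum : ∀ t, Summable fun n => dysonTerm K n t := fun t =>
    Summable.of_norm_bounded (Real.summable_pow_div_factorial (C * |t|))
      fun n => norm_dysonTerm_le hK hC n t
  refine ⟨fun t => ∑' n, dysonTerm K n t, ?_, fun t => ?_⟩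
  · change ∑' n, dysonTerm K n 0 = 1
    rw [tsum_eq_single 0]
    · rfl
    · intro n hn
      obtain ⟨m, rfl⟩ := Nat.exists_eq_succ_of_ne_zero hn
      simp [dysonTerm]
  · set T : ℝ := |t| + 1
    let g' : ℕ → ℝ → 𝔸 := fun n s => Nat.casesOn n 0 fun m => K s * dysonTerm K m s
    let b : ℕ → ℝ := fun n => Nat.casesOn n 0 fun m => C * ((C * T) ^ m / m.factorial)
    have hb : Summable b := by
      rw [← summable_nat_add_iff 1]
      exact (Real.summable_pow_div_factorial (C * T)).mul_left C
    have hmem : t ∈ Metric.ball (0 : ℝ) T := by simp [T]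
    have h := hasDerivAt_tsum_of_isPreconnected (g := dysonTerm K) (g' := g') hb
      (Metric.isOpen_ball (x := (0 : ℝ)) (ε := T)) (convex_ball (0 : ℝ) T).isPreconnected
      (fun n s _ => ?_) (fun n s hs => ?_) hmem (hsum t) hmem
    · refine h.congr_deriv ?_
      have hg : Summable fun n => g' n t := by
        rw [← summable_nat_add_iff 1]
        exact (hsum t).mul_left (K t)
      rw [hg.tsum_eq_zero_add]
      exact (zero_add _).trans ((hsum t).tsum_mul_left (K t))
    · cases n with
      | zero => exact hasDerivAt_const s 1
      | succ m => exact hasDerivAt_dysonTerm_succ hK m s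
    · cases n with
      | zero => simp [g', b]
      | succ m =>
        have hs' : |s| ≤ T := by simpa using (Metric.mem_ball.mp hs).le
        calc ‖K s * dysonTerm K m s‖ ≤ C * ((C * |s|) ^ m / m.factorial) :=
              (norm_mul_le _ _).trans
                (mul_le_mul (hC s) (norm_dysonTerm_le hK hC m s) (norm_nonneg _) hC0)
          _ ≤ C * ((C * T) ^ m / m.factorial) := by gcongr

end LinearODE

/-! ### Norm-preserving evolution equations in a Hilbert space. -/

section HilbertODE

variable {H : Type*} [NormedAddCommGroup H] [InnerProductSpace ℂ H]

theorem hasDerivAt_norm_sq_complex {v : ℝ → H} {v' : H} {t : ℝ} (h : HasDerivAt v v' t) :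
    HasDerivAt (fun s => ‖v s‖ ^ 2) (2 * (inner ℂ (v t) v').re) t := by
  have h1 := h.inner ℂ h
  have h2 := Complex.reCLM.hasFDerivAt.comp_hasDerivAt t h1
  refine (h2.congr_deriv ?_).congr_of_eventuallyEq (Eventually.of_forall fun s => ?_)
  swap
  · exact (inner_self_eq_norm_sq (𝕜 := ℂ) (v s)).symm
  · rw [Complex.reCLM_apply, Complex.add_re, ← inner_conj_symm v' (v t), Complex.conj_re]
    ring

/-- Source of both isometry and uniqueness: applied to a difference of two solutions that vanishes
at one time, it shows that the difference vanishes identically. -/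
theorem norm_eq_of_re_inner_deriv_eq_zero {v v' : ℝ → H} {J : Set ℝ} (hJ : IsOpen J)
    (hJc : IsPreconnected J) (hv : ∀ t ∈ J, HasDerivAt v (v' t) t)
    (h0 : ∀ t ∈ J, (inner ℂ (v t) (v' t)).re = 0) {s t : ℝ} (hs : s ∈ J) (ht : t ∈ J) :
    ‖v s‖ = ‖v t‖ := by
  have h := fun t ht => hasDerivAt_norm_sq_complex (hv t ht)
  have h1 : ‖v s‖ ^ 2 = ‖v t‖ ^ 2 :=
    hJ.is_const_of_deriv_eq_zero (f := fun t => ‖v t‖ ^ 2) hJc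
      (fun t ht => (h t ht).differentiableAt.differentiableWithinAt)
      (fun t ht => by simp [(h t ht).deriv, h0 t ht]) hs ht
  exact (pow_left_inj₀ (norm_nonneg _) (norm_nonneg _) two_ne_zero).mp h1

variable [CompleteSpace H]

/-- The propagator of `v' = K v` for a bounded, norm continuous, skew-adjoint generator `K`. -/
theorem exists_bounded_propagator {K : ℝ → H →L[ℂ] H} {C : ℝ} (hK : Continuous K)
    (hC : ∀ t, ‖K t‖ ≤ C) (hskew : ∀ t ψ, (inner ℂ ψ (K t ψ)).re = 0) :
    ∃ u : ℝ → ℝ → H →L[ℂ] H, (∀ t ψ, u t t ψ = ψ) ∧ (∀ t s ψ, ‖u t s ψ‖ = ‖ψ‖) ∧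
      (∀ t s r ψ, u t s (u s r ψ) = u t r ψ) ∧
      ∀ t s ψ, HasDerivAt (fun r => u r s ψ) (K t (u t s ψ)) t := by
  -- The Dyson series needs `‖1‖ = 1` in the operator algebra, which fails on the zero space.
  rcases subsingleton_or_nontrivial H with hH | hH
  · exact ⟨fun _ _ => 0, fun _ _ => Subsingleton.elim _ _, fun _ _ ψ => by
      rw [Subsingleton.elim ψ 0]; simp, fun _ _ _ _ => Subsingleton.elim _ _,
      fun t s ψ => (hasDerivAt_const t (0 : H)).congr_deriv (Subsingleton.elim _ _)⟩
  have hnorm : ∀ v : ℝ → H, (∀ t, HasDerivAt v (K t (v t)) t) → ∀ s t, ‖v s‖ = ‖v t‖ :=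
    fun v hv s t => norm_eq_of_re_inner_deriv_eq_zero isOpen_univ isPreconnected_univ
      (fun t _ => hv t) (fun t _ => hskew t (v t)) (mem_univ s) (mem_univ t)
  have hex : ∀ s : ℝ, ∃ U : ℝ → H →L[ℂ] H, U s = 1 ∧ ∀ t, HasDerivAt U (K t * U t) t := by
    intro s
    obtain ⟨U, hU0, hU⟩ := exists_linearODE_solution (K := fun t => K (t + s))
      (hK.comp (continuous_id.add continuous_const)) (fun t => hC _)
    refine ⟨fun t => U (t - s), by simp [hU0], fun t => ?_⟩
    have h := (hU (t - s)).comp_sub_const t s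
    simpa using h
  choose U hU0 hU using hex
  have hder : ∀ t s ψ, HasDerivAt (fun r => U s r ψ) (K t (U s t ψ)) t := by
    intro t s ψ
    have h := ((ContinuousLinearMap.apply ℂ H ψ).restrictScalars ℝ).hasFDerivAt.comp_hasDerivAt t
      (hU s t)
    exact h
  refine ⟨fun t s => U s t, fun t ψ => by simp [hU0], fun t s ψ => ?_, fun t s r ψ => ?_, hder⟩
  · rw [hnorm _ (fun t => hder t s ψ) t s, hU0]; rfl
  · have h := hnorm (fun t => U s t (U r s ψ) - U r t ψ)
      (fun t => ((hder t s (U r s ψ)).sub (hder t r ψ)).congr_deriv (map_sub _ _ _).symm) t s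
    simp only [hU0, one_apply_eq_self, sub_self, norm_zero] at h
    exact sub_eq_zero.mp (norm_eq_zero.mp h)

end HilbertODE

/-! ### Growth estimates from one-sided comparison functions -/

/-- A Gronwall lemma for `f` that need not be differentiable. At each point `x` a function touches
`f` from above; its derivative at `x` is `2 L f(x)`, because `k` is stationary there, and this
bounds the Dini derivative of `f`. In the application `f(t) = ‖A(t) v(t)‖²`, up to regularisation,
and `k` is the same quantity with the operator frozen at time `x`. -/
theorem le_mul_exp_of_forall_le_comparison_aux {f : ℝ → ℝ} {L s t : ℝ}
    (hf : ContinuousOn f (Icc s t)) (hst : s ≤ t)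
    (hk : ∀ x ∈ Icc s t, ∃ k : ℝ → ℝ, HasDerivAt k 0 x ∧ k x = f x ∧
      ∀ᶠ z in 𝓝 x, f z ≤ (1 + L * |z - x|) ^ 2 * k z) :
    f t ≤ f s * Real.exp (2 * L * (t - s)) := by
  have h := le_gronwallBound_of_liminf_deriv_right_le (f := f) (f' := fun x => 2 * L * f x)
    (δ := f s) (K := 2 * L) (ε := 0) hf (fun x hx r hr => ?_) le_rfl (fun x _ => by simp) t
    (right_mem_Icc.mpr hst)
  · rwa [gronwallBound_ε0] at h
  · obtain ⟨k, hk0, hkx, hle⟩ := hk x (Ico_subset_Icc_self hx)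
    have h1 : HasDerivAt (fun z => (1 + L * (z - x)) ^ 2 * k z) (2 * L * f x) x := by
      have h2 : HasDerivAt (fun z => (1 + L * (z - x)) ^ 2) (2 * L) x := by
        have h3 : HasDerivAt (fun z => 1 + L * (z - x)) L x := by
          simpa using (((hasDerivAt_id x).sub_const x).const_mul L).const_add 1
        refine (h3.pow 2).congr_deriv ?_
        simp
      refine (h2.mul hk0).congr_deriv ?_
      simp [hkx]
    have h2 := (hasDerivAt_iff_tendsto_slope.mp h1).mono_left
      (nhdsWithin_mono x (fun z hz => ne_of_gt hz : Ioi x ⊆ {x}ᶜ))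
    refine Eventually.frequently ?_
    filter_upwards [h2.eventually_lt_const hr, self_mem_nhdsWithin,
      nhdsWithin_le_nhds hle] with z hz hzx hfz
    refine lt_of_le_of_lt ?_ hz
    have hzx' : 0 < z - x := sub_pos.mpr hzx
    rw [abs_of_pos hzx'] at hfz
    rw [slope_def_field, div_eq_inv_mul]
    have : k x = f x := hkx
    simp only [sub_self, mul_zero, add_zero, one_pow, one_mul, this]
    gcongr

theorem le_mul_exp_of_forall_le_comparison {f : ℝ → ℝ} {L : ℝ} (s t : ℝ)
    (hf : ContinuousOn f (uIcc s t))
    (hk : ∀ x ∈ uIcc s t, ∃ k : ℝ → ℝ, HasDerivAt k 0 x ∧ k x = f x ∧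
      ∀ᶠ z in 𝓝 x, f z ≤ (1 + L * |z - x|) ^ 2 * k z) :
    f t ≤ f s * Real.exp (2 * L * |t - s|) := by
  rcases le_total s t with hst | hst
  · rw [abs_of_nonneg (sub_nonneg.mpr hst)]
    rw [uIcc_of_le hst] at hf hk
    exact le_mul_exp_of_forall_le_comparison_aux hf hst hk
  · rw [abs_of_nonpos (sub_nonpos.mpr hst)]
    rw [uIcc_of_ge hst] at hf hk
    have hmem : ∀ x ∈ Icc (-s) (-t), -x ∈ Icc t s := fun x hx =>
      ⟨by linarith [hx.2], by linarith [hx.1]⟩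
    -- The hypothesis is two-sided in `z`, so reflecting time reduces the backward case to the
    -- forward one.
    have h := le_mul_exp_of_forall_le_comparison_aux (f := fun x => f (-x)) (L := L)
      (hf.comp continuous_neg.continuousOn hmem) (neg_le_neg hst) (fun x hx => ?_)
    · simp only [neg_neg] at h
      refine h.trans (le_of_eq ?_)
      ring_nf
    · obtain ⟨k, hk0, hkx, hle⟩ := hk (-x) (hmem x hx)
      refine ⟨fun z => k (-z), ?_, hkx, ?_⟩
      · exact (hk0.comp x (hasDerivAt_neg x)).congr_deriv (zero_mul _)
      · have h2 : Tendsto (fun z : ℝ => -z) (𝓝 x) (𝓝 (-x)) := continuous_neg.tendsto x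
        filter_upwards [h2.eventually hle] with z hz
        refine hz.trans (le_of_eq ?_)
        rw [show -z - -x = -(z - x) by ring, abs_neg]

/-- Additive counterpart, for form norms. Since `M` need not be differentiable, it is subtracted
first: `f - M` has a nonpositive Dini derivative and is compared with a constant. -/
theorem le_add_sub_of_forall_le_comparison {f M : ℝ → ℝ} {s t : ℝ}
    (hf : ContinuousOn f (Icc s t)) (hM : ContinuousOn M (Icc s t)) (hst : s ≤ t)
    (hk : ∀ x ∈ Icc s t, ∃ k : ℝ → ℝ, HasDerivAt k 0 x ∧ k x = f x ∧
      ∀ z ∈ Icc s t, x ≤ z → f z ≤ k z + (M z - M x)) :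
    f t ≤ f s + (M t - M s) := by
  have h := image_le_of_liminf_slope_right_le_deriv_boundary (f := fun x => f x - M x)
    (a := s) (b := t) (B := fun _ => f s - M s) (B' := fun _ => 0) (hf.sub hM) le_rfl
    continuousOn_const (fun x _ => hasDerivWithinAt_const _ _ _) (fun x hx r hr => ?_)
    (right_mem_Icc.mpr hst)
  · linarith
  · obtain ⟨k, hk0, hkx, hle⟩ := hk x (Ico_subset_Icc_self hx)
    have h2 := (hasDerivAt_iff_tendsto_slope.mp hk0).mono_left
      (nhdsWithin_mono x (fun z hz => ne_of_gt hz : Ioi x ⊆ {x}ᶜ))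
    refine Eventually.frequently ?_
    filter_upwards [h2.eventually_lt_const hr, Ioc_mem_nhdsGT hx.2] with z hz hzx
    refine lt_of_le_of_lt ?_ hz
    have hzx' : 0 < z - x := sub_pos.mpr hzx.1
    have hfz := hle z ⟨hx.1.trans hzx.1.le, hzx.2⟩ hzx.1.le
    rw [slope_def_field, slope_def_field]
    gcongr ?_ / _
    linarith

theorem le_add_abs_sub_of_forall_le_comparison {f M : ℝ → ℝ} {s t : ℝ}
    (hf : ContinuousOn f (uIcc s t)) (hM : ContinuousOn M (uIcc s t))
    (hmono : MonotoneOn M (uIcc s t))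
    (hk : ∀ x ∈ uIcc s t, ∃ k : ℝ → ℝ, HasDerivAt k 0 x ∧ k x = f x ∧
      ∀ z ∈ uIcc s t, f z ≤ k z + |M z - M x|) :
    f t ≤ f s + |M t - M s| := by
  rcases le_total s t with hst | hst
  · rw [uIcc_of_le hst] at hf hM hmono hk
    refine (le_add_sub_of_forall_le_comparison (M := M) hf hM hst fun x hx => ?_).trans
      (by gcongr; exact le_abs_self _)
    obtain ⟨k, hk0, hkx, hle⟩ := hk x hx
    refine ⟨k, hk0, hkx, fun z hz hxz => (hle z hz).trans_eq ?_⟩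
    rw [abs_of_nonneg (sub_nonneg.mpr (hmono hx hz hxz))]
  · rw [uIcc_of_ge hst] at hf hM hmono hk
    have hmem : ∀ x ∈ Icc (-s) (-t), -x ∈ Icc t s := fun x hx =>
      ⟨by linarith [hx.2], by linarith [hx.1]⟩
    -- Under reflection of time the increasing weight becomes `-M(-x)`, which is again increasing.
    have h := le_add_sub_of_forall_le_comparison (f := fun x => f (-x)) (M := fun x => -M (-x))
      (hf.comp continuous_neg.continuousOn hmem)
      (hM.comp continuous_neg.continuousOn hmem).neg (neg_le_neg hst) (fun x hx => ?_)
    · simp only [neg_neg] at h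
      refine h.trans ?_
      gcongr
      linarith [neg_le_abs (M t - M s)]
    · obtain ⟨k, hk0, hkx, hle⟩ := hk (-x) (hmem x hx)
      refine ⟨fun z => k (-z), (hk0.comp x (hasDerivAt_neg x)).congr_deriv (zero_mul _), hkx,
        fun z hz hxz => (hle (-z) (hmem z hz)).trans_eq ?_⟩
      rw [abs_of_nonpos (sub_nonpos.mpr (hmono (hmem z hz) (hmem x hx) (neg_le_neg hxz)))]
      ring

/-! ### Regularised inverses of positive operators -/

section Regularised

variable {H : Type*} [NormedAddCommGroup H] [InnerProductSpace ℂ H]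

/-- In the expansion of the square, both the cross term and the last term increase with the
parameter because `⟨S w, w⟩ ≥ 0`. Every bound on `(S + ε)⁻¹` below is a substitution into this or
the next inequality. -/
theorem norm_add_smul_le_norm_add_smul {S : H →L[ℂ] H} (hS : S.IsPositive) {ε δ : ℝ}
    (hε : 0 ≤ ε) (hεδ : ε ≤ δ) (w : H) : ‖S w + (ε : ℂ) • w‖ ≤ ‖S w + (δ : ℂ) • w‖ := by
  have h0 : 0 ≤ (inner ℂ (S w) w).re := hS.2 w
  have key : ∀ r : ℝ, 0 ≤ r → ‖S w + (r : ℂ) • w‖ ^ 2 =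
      ‖S w‖ ^ 2 + 2 * (r * (inner ℂ (S w) w).re) + r ^ 2 * ‖w‖ ^ 2 := by
    intro r hr
    rw [norm_add_sq (𝕜 := ℂ), inner_smul_right, norm_smul, Complex.norm_real,
      Real.norm_of_nonneg hr, mul_pow]
    simp
  refine le_of_sq_le_sq ?_ (norm_nonneg _)
  rw [key ε hε, key δ (hε.trans hεδ)]
  gcongr

theorem mul_norm_le_norm_add_smul {S : H →L[ℂ] H} (hS : S.IsPositive) {ε : ℝ}
    (hε : 0 ≤ ε) (w : H) : ε * ‖w‖ ≤ ‖S w + (ε : ℂ) • w‖ := by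
  have h0 : 0 ≤ (inner ℂ (S w) w).re := hS.2 w
  refine le_of_sq_le_sq ?_ (norm_nonneg _)
  rw [norm_add_sq (𝕜 := ℂ), inner_smul_right, norm_smul, Complex.norm_real,
    Real.norm_of_nonneg hε, mul_pow]
  have : (0 : ℝ) ≤ 2 * (ε * (inner ℂ (S w) w).re) := by positivity
  simp
  nlinarith [sq_nonneg ‖S w‖]

/-- The regularised inverse `(S + ε)⁻¹`. -/
noncomputable def regInv (S : H →L[ℂ] H) (ε : ℝ) : H →L[ℂ] H :=
  Ring.inverse (S + (ε : ℂ) • (1 : H →L[ℂ] H))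

variable [CompleteSpace H]

/-- The operator is bounded below by `ε` and self-adjoint, so the orthogonal complement of its range
is its kernel, which is zero. -/
theorem isUnit_add_smul_one {S : H →L[ℂ] H} (hS : S.IsPositive) {ε : ℝ} (hε : 0 < ε) :
    IsUnit (S + (ε : ℂ) • (1 : H →L[ℂ] H)) := by
  rw [ContinuousLinearMap.isUnit_iff_bijective,
    ContinuousLinearMap.bijective_iff_dense_range_and_antilipschitz]
  have happ : ∀ w, (S + (ε : ℂ) • (1 : H →L[ℂ] H)) w = S w + (ε : ℂ) • w := fun w => rfl
  constructor
  · rw [Submodule.topologicalClosure_eq_top_iff, Submodule.eq_bot_iff]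
    intro z hz
    rw [Submodule.mem_orthogonal] at hz
    have h1 : S z + (ε : ℂ) • z = 0 := by
      refine ext_inner_left ℂ fun w => ?_
      have h2 := hz _ ⟨w, rfl⟩
      have h3 : inner ℂ (S w) z = inner ℂ w (S z) := hS.1 w z
      rw [ContinuousLinearMap.coe_coe, happ, inner_add_left, inner_smul_left, h3] at h2
      rw [inner_add_right, inner_smul_right, inner_zero_right, ← h2]
      simp
    have h2 := mul_norm_le_norm_add_smul hS hε.le z
    rw [h1, norm_zero] at h2
    exact norm_le_zero_iff.mp (nonpos_of_mul_nonpos_right h2 hε)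
  · refine ⟨⟨ε⁻¹, by positivity⟩, AddMonoidHomClass.antilipschitz_of_bound _ fun w => ?_⟩
    have h2 := mul_norm_le_norm_add_smul hS hε.le w
    rw [happ]
    change ‖w‖ ≤ ε⁻¹ * _
    rwa [← div_eq_inv_mul, le_div_iff₀' hε]

theorem regInv_apply_add {S : H →L[ℂ] H} (hS : S.IsPositive) {ε : ℝ} (hε : 0 < ε) (w : H) :
    regInv S ε (S w + (ε : ℂ) • w) = w :=
  congrArg (fun T : H →L[ℂ] H => T w) (Ring.inverse_mul_cancel _ (isUnit_add_smul_one hS hε))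

theorem apply_regInv_add {S : H →L[ℂ] H} (hS : S.IsPositive) {ε : ℝ} (hε : 0 < ε) (w : H) :
    S (regInv S ε w) + (ε : ℂ) • regInv S ε w = w :=
  congrArg (fun T : H →L[ℂ] H => T w) (Ring.mul_inverse_cancel _ (isUnit_add_smul_one hS hε))

theorem regInv_apply_comm {S : H →L[ℂ] H} (hS : S.IsPositive) {ε : ℝ} (hε : 0 < ε) (w : H) :
    regInv S ε (S w) = S (regInv S ε w) := by
  have h1 := regInv_apply_add hS hε w
  have h2 := apply_regInv_add hS hε w
  rw [map_add, map_smul] at h1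
  exact add_right_cancel (h1.trans h2.symm)

theorem norm_regInv_apply_le {S : H →L[ℂ] H} (hS : S.IsPositive) {ε : ℝ} (hε : 0 < ε) (w : H) :
    ‖regInv S ε w‖ ≤ ε⁻¹ * ‖w‖ := by
  have h := mul_norm_le_norm_add_smul hS hε.le (regInv S ε w)
  rw [apply_regInv_add hS hε] at h
  rwa [← div_eq_inv_mul, le_div_iff₀' hε]

theorem norm_regInv_le {S : H →L[ℂ] H} (hS : S.IsPositive) {ε : ℝ} (hε : 0 < ε) :
    ‖regInv S ε‖ ≤ ε⁻¹ :=
  ContinuousLinearMap.opNorm_le_bound _ (by positivity) (norm_regInv_apply_le hS hε)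

/-- Uniform in `ε`: on a vector `S χ` of the domain of `S⁻¹`, the approximation `(S + ε)⁻¹` never
exceeds the norm of `S⁻¹ (S χ) = χ`. -/
theorem norm_regInv_comp_le {S : H →L[ℂ] H} (hS : S.IsPositive) {ε : ℝ} (hε : 0 < ε) (w : H) :
    ‖regInv S ε (S w)‖ ≤ ‖w‖ := by
  rw [regInv_apply_comm hS hε]
  have h := norm_add_smul_le_norm_add_smul hS le_rfl hε.le (regInv S ε w)
  rwa [apply_regInv_add hS hε, Complex.ofReal_zero, zero_smul, add_zero] at h

theorem inner_regInv {S : H →L[ℂ] H} (hS : S.IsPositive) {ε : ℝ} (hε : 0 < ε) (x y : H) :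
    inner ℂ (regInv S ε x) y = inner ℂ x (regInv S ε y) := by
  conv_lhs => rw [← apply_regInv_add hS hε y]
  conv_rhs => rw [← apply_regInv_add hS hε x]
  have h3 : inner ℂ (S (regInv S ε x)) (regInv S ε y) =
    inner ℂ (regInv S ε x) (S (regInv S ε y)) := hS.1 _ _
  rw [inner_add_left, inner_add_right, inner_smul_left, inner_smul_right, h3]
  simp

theorem regInv_sub_regInv {S : H →L[ℂ] H} (hS : S.IsPositive) {ε δ : ℝ} (hε : 0 < ε)
    (hδ : 0 < δ) (w : H) :
    regInv S ε w - regInv S δ w = ((δ - ε : ℝ) : ℂ) • regInv S δ (regInv S ε w) := by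
  have h1 := regInv_apply_add hS hδ (regInv S ε w)
  have h2 := apply_regInv_add hS hε w
  have h3 : S (regInv S ε w) + (δ : ℂ) • regInv S ε w =
      w + ((δ - ε : ℝ) : ℂ) • regInv S ε w := by
    calc S (regInv S ε w) + (δ : ℂ) • regInv S ε w
        = (S (regInv S ε w) + (ε : ℂ) • regInv S ε w) +
          ((δ - ε : ℝ) : ℂ) • regInv S ε w := by push_cast; module
      _ = _ := by rw [h2]
  rw [h3, map_add, map_smul] at h1
  rw [sub_eq_iff_eq_add', h1]

theorem norm_regInv_anti {S : H →L[ℂ] H} (hS : S.IsPositive) {ε δ : ℝ} (hε : 0 < ε)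
    (hεδ : ε ≤ δ) (w : H) : ‖regInv S δ w‖ ≤ ‖regInv S ε w‖ := by
  have hδ := hε.trans_le hεδ
  -- On this vector `S + δ` gives `regInv S ε w`, and `S + ε`, after commuting the two inverses,
  -- gives `regInv S δ w`.
  have h := norm_add_smul_le_norm_add_smul hS hε.le hεδ (regInv S δ (regInv S ε w))
  rw [apply_regInv_add hS hδ, ← regInv_apply_comm hS hδ, ← map_smul, ← map_add,
    apply_regInv_add hS hε] at h
  exact h

end Regularised

/-! ### Families of inverses of positive operators with a common domain -/

section Family

variable {H : Type*} [NormedAddCommGroup H] [InnerProductSpace ℂ H]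

/-- A family `S t` of bounded positive injective operators such that the (unbounded) inverses
`A t = (S t)⁻¹` have a common domain and `t ↦ A t` is Lipschitz continuous, relative to any `A s`:
`A t (S s) = 1 + B t s`. -/
structure IsLipschitzResolventFamily (S : ℝ → H →L[ℂ] H) (B : ℝ → ℝ → H →L[ℂ] H) (L : ℝ) :
    Prop where
  pos : ∀ t, (S t).IsPositive
  inj : ∀ t, Function.Injective (S t)
  rel : ∀ t s χ, S s χ = S t (χ + B t s χ)
  bound : ∀ t s χ, ‖B t s χ‖ ≤ L * |t - s| * ‖χ‖

namespace IsLipschitzResolventFamily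

variable {S : ℝ → H →L[ℂ] H} {B : ℝ → ℝ → H →L[ℂ] H} {L : ℝ}

theorem inner_apply (h : IsLipschitzResolventFamily S B L) (t : ℝ) (x y : H) :
    inner ℂ (S t x) y = inner ℂ x (S t y) := (h.pos t).1 x y

/-- The bounded generator `-(i/2)((S t + ε)⁻¹ - 1)`. -/
noncomputable def regGen (S : ℝ → H →L[ℂ] H) (ε : ℝ) (t : ℝ) : H →L[ℂ] H :=
  (-(Complex.I / 2)) • (regInv (S t) ε - 1)

theorem regGen_apply (ε t : ℝ) (ψ : H) :
    regGen S ε t ψ = (-(Complex.I / 2)) • (regInv (S t) ε ψ - ψ) := rfl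

variable [CompleteSpace H]

theorem denseRange (h : IsLipschitzResolventFamily S B L) (t : ℝ) : DenseRange (S t) := by
  have h1 : ((S t : H →ₗ[ℂ] H).range).topologicalClosure = ⊤ := by
    rw [Submodule.topologicalClosure_eq_top_iff, Submodule.eq_bot_iff]
    intro z hz
    rw [Submodule.mem_orthogonal] at hz
    refine h.inj t ?_
    rw [map_zero]
    refine ext_inner_left ℂ fun w => ?_
    rw [← h.inner_apply, inner_zero_right]
    exact hz _ ⟨w, rfl⟩
  exact (Submodule.dense_iff_topologicalClosure_eq_top).mpr h1

/-- Here `(S t + ε)⁻¹ (S s + ε) = 1 + (S t + ε)⁻¹ S t (B t s)`, and `(S t + ε)⁻¹ S t` is a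
contraction. Thus the relative Lipschitz bound survives the regularisation with a constant
independent of `ε`. -/
theorem norm_regInv_comp_le (h : IsLipschitzResolventFamily S B L) {ε : ℝ} (hε : 0 < ε)
    (t s : ℝ) (w : H) :
    ‖regInv (S t) ε (S s w + (ε : ℂ) • w)‖ ≤ (1 + L * |t - s|) * ‖w‖ := by
  have h1 : S s w + (ε : ℂ) • w = (S t w + (ε : ℂ) • w) + S t (B t s w) := by
    rw [h.rel t s w, map_add]; abel
  rw [h1, map_add, regInv_apply_add (h.pos t) hε]
  refine (norm_add_le _ _).trans ?_
  have h2 := (_root_.norm_regInv_comp_le (h.pos t) hε (B t s w)).trans (h.bound t s w)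
  linarith

/-- The constant blows up as `ε → 0`; the estimate serves only to make the regularised generator
norm continuous. -/
theorem norm_regInv_sub_le (h : IsLipschitzResolventFamily S B L) (hL : 0 ≤ L) {ε : ℝ} (hε : 0 < ε)
    (t s : ℝ) (w : H) :
    ‖regInv (S t) ε w - regInv (S s) ε w‖ ≤ L * |t - s| * (ε⁻¹ * ‖w‖) := by
  set z := regInv (S s) ε w with hz
  have h0 : S s z + (ε : ℂ) • z = w := apply_regInv_add (h.pos s) hε w
  have h1 : w = (S t z + (ε : ℂ) • z) + S t (B t s z) := by
    conv_lhs => rw [← h0, h.rel t s z, map_add]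
    abel
  have h2 : regInv (S t) ε w - z = regInv (S t) ε (S t (B t s z)) := by
    conv_lhs => rw [h1, map_add, regInv_apply_add (h.pos t) hε]
    abel
  rw [h2]
  refine (_root_.norm_regInv_comp_le (h.pos t) hε _).trans ((h.bound t s z).trans ?_)
  gcongr
  exact norm_regInv_apply_le (h.pos s) hε w

theorem continuous_regInv (h : IsLipschitzResolventFamily S B L) (hL : 0 ≤ L) {ε : ℝ}
    (hε : 0 < ε) : Continuous fun t => regInv (S t) ε := by
  refine LipschitzWith.continuous (K := ⟨L * ε⁻¹, mul_nonneg hL (inv_nonneg.mpr hε.le)⟩)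
    (LipschitzWith.of_dist_le_mul fun t s => ?_)
  rw [dist_eq_norm, Real.dist_eq]
  refine ContinuousLinearMap.opNorm_le_bound _
    (mul_nonneg (NNReal.coe_nonneg _) (abs_nonneg _)) fun w => ?_
  refine (h.norm_regInv_sub_le hL hε t s w).trans (le_of_eq ?_)
  change _ = L * ε⁻¹ * _ * _
  ring

theorem exists_regPropagator (h : IsLipschitzResolventFamily S B L) (hL : 0 ≤ L) {ε : ℝ}
    (hε : 0 < ε) :
    ∃ u : ℝ → ℝ → H →L[ℂ] H, (∀ t ψ, u t t ψ = ψ) ∧ (∀ t s ψ, ‖u t s ψ‖ = ‖ψ‖) ∧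
      (∀ t s r ψ, u t s (u s r ψ) = u t r ψ) ∧
      ∀ t s ψ, HasDerivAt (fun r => u r s ψ) (regGen S ε t (u t s ψ)) t := by
  refine exists_bounded_propagator (K := regGen S ε) (C := 2⁻¹ * (ε⁻¹ + 1)) ?_ (fun t => ?_)
    (fun t ψ => ?_)
  · have hc : Continuous fun t => (regInv (S t) ε - 1 : H →L[ℂ] H) :=
      (h.continuous_regInv hL hε).sub continuous_const
    exact hc.const_smul (-(Complex.I / 2))
  · rw [regGen, norm_smul]
    have h1 : ‖(-(Complex.I / 2))‖ = 2⁻¹ := by simp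
    rw [h1]
    gcongr
    refine (norm_sub_le _ _).trans ?_
    gcongr
    · exact norm_regInv_le (h.pos t) hε
    · exact ContinuousLinearMap.norm_id_le
  -- Skew-adjointness: `regInv (S t) ε - 1` is symmetric, so its expectation values are real, and
  -- the prefactor is imaginary.
  · have h1 : (inner ℂ ψ (regInv (S t) ε ψ)).im = 0 := by
      rw [← Complex.conj_eq_iff_im, inner_conj_symm, inner_regInv (h.pos t) hε]
    have h2 : (inner ℂ ψ ψ).im = 0 := inner_self_im (𝕜 := ℂ) ψ
    rw [regGen_apply, inner_smul_right, inner_sub_right]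
    simp only [neg_mul, Complex.neg_re, Complex.mul_re, Complex.div_ofNat_re, Complex.I_re,
      Complex.div_ofNat_im, Complex.I_im, Complex.sub_im, h1]
    have h3 : (inner ℂ ψ ψ).im = 0 := h2
    rw [h3]
    simp

end IsLipschitzResolventFamily

end Family

/-! ### Bounds on the regularised evolutions, uniform in the regularisation. -/

namespace IsLipschitzResolventFamily

variable {H : Type*} [NormedAddCommGroup H] [InnerProductSpace ℂ H] [CompleteSpace H]
  {S : ℝ → H →L[ℂ] H} {B : ℝ → ℝ → H →L[ℂ] H} {L : ℝ}

theorem im_inner_regInv (h : IsLipschitzResolventFamily S B L) {ε : ℝ} (hε : 0 < ε) (t : ℝ)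
    (ψ : H) : (inner ℂ ψ (regInv (S t) ε ψ)).im = 0 := by
  rw [← Complex.conj_eq_iff_im, inner_conj_symm, inner_regInv (h.pos t) hε]

/-- Stability of the regularised graph norm. With the operator frozen at time `x`, the norm of
`regInv (S x) ε (v z)` is stationary at `z = x`, since `regInv (S x) ε` commutes with the generator
at time `x`, which is skew. Passing from the operator at `x` to the one at `z` costs the factor `1 +
L |z - x|`, so the Gronwall comparison applies. -/
theorem norm_regInv_solution_le (h : IsLipschitzResolventFamily S B L) (hL : 0 ≤ L) {ε : ℝ}
    (hε : 0 < ε) {v : ℝ → H} (hv : ∀ t, HasDerivAt v (regGen S ε t (v t)) t) (t s : ℝ) :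
    ‖regInv (S t) ε (v t)‖ ≤ Real.exp (L * |t - s|) * ‖regInv (S s) ε (v s)‖ := by
  have hvc : Continuous v := continuous_iff_continuousAt.mpr fun t => (hv t).continuousAt
  have hc : Continuous fun t => ‖regInv (S t) ε (v t)‖ ^ 2 :=
    (((h.continuous_regInv hL hε).clm_apply hvc).norm).pow 2
  have key := le_mul_exp_of_forall_le_comparison (f := fun t => ‖regInv (S t) ε (v t)‖ ^ 2)
    (L := L) s t hc.continuousOn fun x _ => by
      refine ⟨fun z => ‖regInv (S x) ε (v z)‖ ^ 2, ?_, rfl, Eventually.of_forall fun z => ?_⟩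
      · have h1 : HasDerivAt (fun z => regInv (S x) ε (v z))
            (regInv (S x) ε (regGen S ε x (v x))) x :=
          ((regInv (S x) ε).restrictScalars ℝ).hasFDerivAt.comp_hasDerivAt x (hv x)
        refine (hasDerivAt_norm_sq_complex h1).congr_deriv ?_
        have h2 := h.im_inner_regInv hε x (regInv (S x) ε (v x))
        have h3 : (inner ℂ (regInv (S x) ε (v x)) (regInv (S x) ε (v x))).im = 0 :=
          inner_self_im (𝕜 := ℂ) _
        rw [regGen_apply, map_smul, map_sub, inner_smul_right, inner_sub_right]
        simp only [neg_mul, Complex.neg_re, Complex.mul_re, Complex.div_ofNat_re, Complex.I_re,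
          Complex.div_ofNat_im, Complex.I_im, Complex.sub_im, h2, h3]
        simp
      · have h1 := h.norm_regInv_comp_le hε z x (regInv (S x) ε (v z))
        rw [apply_regInv_add (h.pos x) hε] at h1
        rw [← mul_pow]
        gcongr
  refine le_of_sq_le_sq (key.trans (le_of_eq ?_)) (by positivity)
  rw [mul_pow, ← Real.exp_nat_mul, mul_comm]
  push_cast
  ring_nf

theorem norm_regInv_solution_le' (h : IsLipschitzResolventFamily S B L) (hL : 0 ≤ L) {ε : ℝ}
    (hε : 0 < ε) {v : ℝ → H} (hv : ∀ t, HasDerivAt v (regGen S ε t (v t)) t) (t s : ℝ) {χ : H}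
    (hs : v s = S s χ) :
    ‖regInv (S t) ε (v t)‖ ≤ Real.exp (L * |t - s|) * ‖χ‖ := by
  refine (h.norm_regInv_solution_le hL hε hv t s).trans ?_
  gcongr
  rw [hs]
  exact _root_.norm_regInv_comp_le (h.pos s) hε χ

/-- In the derivative of `‖v - w‖²` the skew part of the generator drops out. The resolvent identity
leaves the term `(δ - ε) ⟨regInv δ (v - w), regInv ε v⟩`, which is `O(δ)` by the uniform graph norm
bound. This makes the regularised evolutions Cauchy on the domain. -/
theorem norm_sub_sq_le_of_le (h : IsLipschitzResolventFamily S B L) (hL : 0 ≤ L) {ε δ : ℝ}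
    (hε : 0 < ε) (hεδ : ε ≤ δ) {v w : ℝ → H} (hv : ∀ t, HasDerivAt v (regGen S ε t (v t)) t)
    (hw : ∀ t, HasDerivAt w (regGen S δ t (w t)) t) (t s : ℝ) {χ : H}
    (hvs : v s = S s χ) (hws : w s = S s χ) :
    ‖v t - w t‖ ^ 2 ≤ 2 * δ * (Real.exp (L * |t - s|) * ‖χ‖) ^ 2 * |t - s| := by
  have hδ := hε.trans_le hεδ
  set C := Real.exp (L * |t - s|) * ‖χ‖ with hC
  have hC0 : 0 ≤ C := by positivity
  have hexp : ∀ x ∈ uIcc s t, Real.exp (L * |x - s|) * ‖χ‖ ≤ C := by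
    intro x hx
    have : |x - s| ≤ |t - s| := abs_sub_left_of_mem_uIcc hx
    rw [hC]
    gcongr
  have hder := fun x => hasDerivAt_norm_sq_complex ((hv x).sub (hw x))
  have hb : ∀ x ∈ uIcc s t, ‖2 * (inner ℂ (v x - w x)
      (regGen S ε x (v x) - regGen S δ x (w x))).re‖ ≤ 2 * δ * C ^ 2 := by
    intro x hx
    have hvx := (h.norm_regInv_solution_le' hL hε hv x s hvs).trans (hexp x hx)
    have hwx := (h.norm_regInv_solution_le' hL hδ hw x s hws).trans (hexp x hx)
    have hvx' := (norm_regInv_anti (h.pos x) hε hεδ (v x)).trans hvx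
    have e1 : regGen S ε x (v x) - regGen S δ x (w x) = (-(Complex.I / 2)) •
        (regInv (S x) δ (v x - w x) - (v x - w x) +
          ((δ - ε : ℝ) : ℂ) • regInv (S x) δ (regInv (S x) ε (v x))) := by
      rw [← regInv_sub_regInv (h.pos x) hε hδ, regGen_apply, regGen_apply, map_sub]
      module
    have h2 := h.im_inner_regInv hδ x (v x - w x)
    have h3 : (inner ℂ (v x - w x) (v x - w x)).im = 0 := inner_self_im (𝕜 := ℂ) _
    have e2 : (inner ℂ (v x - w x) (regGen S ε x (v x) - regGen S δ x (w x))).re =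
        2⁻¹ * ((δ - ε) * (inner ℂ (regInv (S x) δ (v x - w x)) (regInv (S x) ε (v x))).im) := by
      have e3 : inner ℂ (v x - w x) (regInv (S x) δ (regInv (S x) ε (v x))) =
          inner ℂ (regInv (S x) δ (v x - w x)) (regInv (S x) ε (v x)) :=
        (inner_regInv (h.pos x) hδ _ _).symm
      rw [e1, inner_smul_right, inner_add_right, inner_sub_right, inner_smul_right, e3]
      simp only [neg_mul, Complex.neg_re, Complex.mul_re, Complex.mul_im, Complex.div_ofNat_re,
        Complex.I_re, Complex.div_ofNat_im, Complex.I_im, Complex.sub_im, Complex.add_im, h2, h3,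
        Complex.ofReal_re, Complex.ofReal_im]
      ring
    -- The vector `v` is controlled with parameter `ε`; monotonicity in the parameter (`hvx'`)
    -- transfers the bound to `δ`.
    have h4 : ‖regInv (S x) δ (v x - w x)‖ ≤ 2 * C := by
      rw [map_sub]
      refine (norm_sub_le _ _).trans ?_
      linarith
    have h5 : |(inner ℂ (regInv (S x) δ (v x - w x)) (regInv (S x) ε (v x))).im| ≤
        2 * C * C :=
      (Complex.abs_im_le_norm _).trans ((norm_inner_le_norm _ _).trans
        (mul_le_mul h4 hvx (norm_nonneg _) (by positivity)))
    have h6 : |δ - ε| ≤ δ := by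
      rw [abs_of_nonneg (sub_nonneg.mpr hεδ)]
      linarith
    rw [e2, Real.norm_eq_abs, abs_mul, abs_mul, abs_mul, abs_of_pos (by norm_num : (0 : ℝ) < 2),
      abs_of_pos (by norm_num : (0 : ℝ) < 2⁻¹)]
    have h7 := mul_le_mul h6 h5 (abs_nonneg _) hδ.le
    nlinarith
  have hmain := (convex_uIcc s t).norm_image_sub_le_of_norm_hasDerivWithin_le
    (f := fun x => ‖v x - w x‖ ^ 2) (fun x _ => (hder x).hasDerivWithinAt) hb
    left_mem_uIcc right_mem_uIcc
  simp only [hvs, hws, sub_self, norm_zero, ne_eq, OfNat.ofNat_ne_zero, not_false_eq_true,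
    zero_pow, sub_zero, Real.norm_eq_abs] at hmain
  rwa [abs_of_nonneg (by positivity)] at hmain

end IsLipschitzResolventFamily

/-! ### Strong limits of bounded families from a dense set. -/

section DenseLimits

theorem Dense.exists_mem_lt {X : Type*} [TopologicalSpace X] {D : Set X} (hD : Dense D) (ψ : X)
    {f : X → ℝ}
    (hf : Continuous f) {ε : ℝ} (h : f ψ < ε) : ∃ φ ∈ D, f φ < ε := by
  obtain ⟨φ, hφ, hφD⟩ := hD.inter_open_nonempty {φ | f φ < ε} (isOpen_lt hf continuous_const)
    ⟨ψ, h⟩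
  exact ⟨φ, hφD, hφ⟩

variable {E F ι : Type*} [NormedAddCommGroup E] [NormedSpace ℂ E] [NormedAddCommGroup F]
  [NormedSpace ℂ F] {l : Filter ι}

theorem tendsto_apply_of_dense {T : ι → E →L[ℂ] F} {T₀ : E →L[ℂ] F} {C : ℝ}
    (hT : ∀ᶠ i in l, ∀ ψ, ‖T i ψ‖ ≤ C * ‖ψ‖) {D : Set E} (hD : Dense D)
    (h : ∀ ψ ∈ D, Tendsto (fun i => T i ψ) l (𝓝 (T₀ ψ))) (ψ : E) :
    Tendsto (fun i => T i ψ) l (𝓝 (T₀ ψ)) := by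
  rw [Metric.tendsto_nhds]
  intro ε hε
  obtain ⟨φ, hφD, hφ⟩ := hD.exists_mem_lt ψ
    (f := fun φ => C * ‖ψ - φ‖ + ‖T₀ ψ - T₀ φ‖) (by fun_prop) (ε := ε / 2) (by simpa using hε)
  filter_upwards [hT, Metric.tendsto_nhds.mp (h φ hφD) (ε / 2) (by positivity)] with i hi hi2
  rw [dist_eq_norm] at hi2 ⊢
  have h1 : T i ψ - T₀ ψ = T i (ψ - φ) + (T i φ - T₀ φ) - (T₀ ψ - T₀ φ) := by
    rw [map_sub]; abel
  rw [h1]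
  refine lt_of_le_of_lt ((norm_sub_le _ _).trans (add_le_add_left (norm_add_le _ _) _)) ?_
  linarith [hi (ψ - φ)]

theorem exists_tendsto_apply_of_dense [CompleteSpace F] [l.NeBot] {T : ι → E →L[ℂ] F} {C : ℝ}
    (hT : ∀ᶠ i in l, ∀ ψ, ‖T i ψ‖ ≤ C * ‖ψ‖) {D : Set E} (hD : Dense D)
    (h : ∀ ψ ∈ D, ∃ φ, Tendsto (fun i => T i ψ) l (𝓝 φ)) (ψ : E) :
    ∃ φ, Tendsto (fun i => T i ψ) l (𝓝 φ) := by
  refine cauchy_map_iff_exists_tendsto.mp (Metric.cauchy_iff.mpr ⟨inferInstance, fun ε hε => ?_⟩)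
  obtain ⟨φ, hφD, hφ⟩ := hD.exists_mem_lt ψ (f := fun φ => C * ‖ψ - φ‖) (by fun_prop)
    (ε := ε / 4) (by simpa using hε)
  obtain ⟨z, hz⟩ := h φ hφD
  have h1 := hT.and (Metric.tendsto_nhds.mp hz (ε / 4) (by positivity))
  refine ⟨_, image_mem_map h1, ?_⟩
  have key : ∀ i ∈ {i | (∀ ψ, ‖T i ψ‖ ≤ C * ‖ψ‖) ∧ dist (T i φ) z < ε / 4},
      dist (T i ψ) z < ε / 2 := by
    rintro i ⟨hi, hi2⟩
    have h2 : dist (T i ψ) (T i φ) < ε / 4 := by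
      rw [dist_eq_norm, ← map_sub]
      exact (hi _).trans_lt hφ
    linarith [dist_triangle (T i ψ) (T i φ) z]
  rintro _ ⟨i, hi, rfl⟩ _ ⟨j, hj, rfl⟩
  have h2 := key i hi
  have h3 := key j hj
  rw [dist_comm] at h3
  linarith [dist_triangle (T i ψ) z (T j ψ)]

end DenseLimits

/-! ### Weak limits in a Hilbert space. -/

section WeakLimits

variable {H ι : Type*} [NormedAddCommGroup H] [InnerProductSpace ℂ H] {l : Filter ι}

theorem tendsto_inner_left_of_dense {y : ι → H} {z : H} {C : ℝ} (hy : ∀ᶠ i in l, ‖y i‖ ≤ C)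
    {D : Set H} (hD : Dense D)
    (h : ∀ φ ∈ D, Tendsto (fun i => inner ℂ (y i) φ) l (𝓝 (inner ℂ z φ))) (φ : H) :
    Tendsto (fun i => inner ℂ (y i) φ) l (𝓝 (inner ℂ z φ)) := by
  refine tendsto_apply_of_dense (T := fun i => innerSL ℂ (y i)) (T₀ := innerSL ℂ z) (C := C) ?_
    hD h φ
  filter_upwards [hy] with i hi ψ
  exact (norm_inner_le_norm _ _).trans (by gcongr)

/-- Weak convergence together with an upper bound on the norms that tends to `‖z‖` forces strong
convergence: expand `‖y i - z‖²`. -/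
theorem tendsto_of_norm_le_of_tendsto_inner {y : ι → H} {z : H} {b : ι → ℝ}
    (hy : ∀ᶠ i in l, ‖y i‖ ≤ b i) (hb : Tendsto b l (𝓝 ‖z‖)) {D : Set H} (hD : Dense D)
    (h : ∀ φ ∈ D, Tendsto (fun i => inner ℂ (y i) φ) l (𝓝 (inner ℂ z φ))) :
    Tendsto y l (𝓝 z) := by
  have hC : ∀ᶠ i in l, ‖y i‖ ≤ ‖z‖ + 1 := by
    filter_upwards [hy, hb.eventually_le_const (lt_add_one ‖z‖)] with i h1 h2 using h1.trans h2
  have h1 := tendsto_inner_left_of_dense hC hD h z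
  have h2 : Tendsto (fun i => b i ^ 2 - 2 * (inner ℂ (y i) z).re + ‖z‖ ^ 2) l (𝓝 0) := by
    have h3 := ((hb.pow 2).sub ((Complex.continuous_re.tendsto _).comp h1 |>.const_mul 2)).add_const
      (‖z‖ ^ 2)
    refine h3.trans (le_of_eq ?_)
    congr 1
    have : (inner ℂ z z).re = ‖z‖ ^ 2 := inner_self_eq_norm_sq (𝕜 := ℂ) z
    simp only [this]
    ring
  rw [tendsto_iff_norm_sub_tendsto_zero]
  have h3 : Tendsto (fun i => ‖y i - z‖ ^ 2) l (𝓝 0) := by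
    refine tendsto_of_tendsto_of_tendsto_of_le_of_le' tendsto_const_nhds h2
      (Eventually.of_forall fun i => by positivity) ?_
    filter_upwards [hy] with i hi
    rw [norm_sub_sq (𝕜 := ℂ)]
    have := pow_le_pow_left₀ (norm_nonneg _) hi 2
    simpa using this
  have h4 := h3.sqrt
  simpa using h4

/-- The inner products converge on a dense set, so no subsequence is needed; the limit functional is
represented by Riesz's theorem. -/
theorem exists_weak_limit [CompleteSpace H] {y : ℕ → H} {C : ℝ} (hy : ∀ n, ‖y n‖ ≤ C)
    {D : Set H} (hD : Dense D)
    (h : ∀ φ ∈ D, ∃ c, Tendsto (fun n => inner ℂ (y n) φ) atTop (𝓝 c)) :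
    ∃ z, ‖z‖ ≤ C ∧ ∀ φ, Tendsto (fun n => inner ℂ (y n) φ) atTop (𝓝 (inner ℂ z φ)) := by
  have h1 : ∀ φ, ∃ c, Tendsto (fun n => innerSL ℂ (y n) φ) atTop (𝓝 c) :=
    exists_tendsto_apply_of_dense (C := C) (Eventually.of_forall fun n ψ =>
      (norm_inner_le_norm _ _).trans (by gcongr; exact hy n)) hD h
  choose c hc using h1
  let ℓ : H →L[ℂ] ℂ := continuousLinearMapOfTendsto (fun n => innerSL ℂ (y n))
    (f := c) (tendsto_pi_nhds.mpr hc)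
  have hz : ∀ φ, Tendsto (fun n => inner ℂ (y n) φ) atTop
      (𝓝 (inner ℂ ((InnerProductSpace.toDual ℂ H).symm ℓ) φ)) := by
    intro φ
    rw [InnerProductSpace.toDual_symm_apply]
    exact hc φ
  refine ⟨_, ?_, hz⟩
  set z := (InnerProductSpace.toDual ℂ H).symm ℓ
  have h2 : ‖z‖ * ‖z‖ ≤ C * ‖z‖ := by
    have h3 : ‖(inner ℂ z z : ℂ)‖ ≤ C * ‖z‖ :=
      le_of_tendsto (hz z).norm (Eventually.of_forall fun n =>
        (norm_inner_le_norm _ _).trans (by gcongr; exact hy n))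
    rw [← inner_self_eq_norm_mul_norm (𝕜 := ℂ) z]
    exact (Complex.re_le_norm _).trans h3
  by_contra! hlt
  have h4 : 0 < ‖z‖ := ((norm_nonneg _).trans (hy 0)).trans_lt hlt
  exact absurd (le_of_mul_le_mul_right h2 h4) (not_le.mpr hlt)

end WeakLimits

/-- A propagator `u t s` for `v' = -(i/2)(A t - 1) v`, where `A t = (S t)⁻¹`; `Y t s` is the
operator `A t * u t s * S s`. -/
structure IsResolventPropagator {H : Type*} [NormedAddCommGroup H] [InnerProductSpace ℂ H]
    (S : ℝ → H →L[ℂ] H) (u : ℝ → ℝ → H →L[ℂ] H) (Y : ℝ → ℝ → H → H) (J : Set ℝ) : Prop where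
  refl : ∀ t ∈ J, ∀ ψ, u t t ψ = ψ
  norm_eq : ∀ t ∈ J, ∀ s ∈ J, ∀ ψ, ‖u t s ψ‖ = ‖ψ‖
  comp : ∀ t ∈ J, ∀ s ∈ J, ∀ r ∈ J, ∀ ψ, u t s (u s r ψ) = u t r ψ
  apply_eq : ∀ t ∈ J, ∀ s ∈ J, ∀ χ, u t s (S s χ) = S t (Y t s χ)
  hasDerivAt : ∀ t ∈ J, ∀ s ∈ J, ∀ χ, HasDerivAt (fun r => u r s (S s χ))
    ((-(Complex.I / 2)) • (Y t s χ - S t (Y t s χ))) t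
  tendsto_gen : ∀ s ∈ J, ∀ χ, Tendsto (fun t => Y t s χ) (𝓝 s) (𝓝 χ)
  bound_gen : ∀ t ∈ J, ∀ s ∈ J, ∃ C, 0 ≤ C ∧ ∀ᶠ p in 𝓝 (t, s), ∀ χ, ‖Y p.1 p.2 χ‖ ≤ C * ‖χ‖

/-! ### Removal of the regularisation. -/

namespace IsLipschitzResolventFamily

variable {H : Type*} [NormedAddCommGroup H] [InnerProductSpace ℂ H] [CompleteSpace H]
  {S : ℝ → H →L[ℂ] H} {B : ℝ → ℝ → H →L[ℂ] H} {L : ℝ}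

/-- The regularisation parameters. -/
noncomputable def regSeq (n : ℕ) : ℝ := 1 / ((n : ℝ) + 1)

theorem regSeq_pos (n : ℕ) : 0 < regSeq n := by unfold regSeq; positivity

theorem regSeq_anti {n m : ℕ} (h : n ≤ m) : regSeq m ≤ regSeq n := by
  unfold regSeq; gcongr

theorem tendsto_regSeq : Tendsto regSeq atTop (𝓝 0) := tendsto_one_div_add_atTop_nhds_zero_nat

theorem exists_limit_propagator (h : IsLipschitzResolventFamily S B L) (hL : 0 ≤ L) :
    ∃ (U : ℕ → ℝ → ℝ → H →L[ℂ] H) (u : ℝ → ℝ → H →L[ℂ] H),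
      (∀ n t s ψ, HasDerivAt (fun r => U n r s ψ) (regGen S (regSeq n) t (U n t s ψ)) t) ∧
      (∀ n t ψ, U n t t ψ = ψ) ∧ (∀ n t s ψ, ‖U n t s ψ‖ = ‖ψ‖) ∧
      (∀ t s ψ, Tendsto (fun n => U n t s ψ) atTop (𝓝 (u t s ψ))) ∧
      (∀ t ψ, u t t ψ = ψ) ∧ (∀ t s ψ, ‖u t s ψ‖ = ‖ψ‖) ∧
      (∀ t s r ψ, u t s (u s r ψ) = u t r ψ) := by
  choose U hU1 hU2 hU3 hU4 using fun n => h.exists_regPropagator hL (regSeq_pos n)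
  have hlim : ∀ t s ψ, ∃ φ, Tendsto (fun n => U n t s ψ) atTop (𝓝 φ) := by
    intro t s
    refine exists_tendsto_apply_of_dense (C := 1)
      (Eventually.of_forall fun n ψ => by rw [hU2, one_mul]) (h.denseRange s) ?_
    rintro _ ⟨χ, rfl⟩
    refine cauchySeq_tendsto_of_complete (cauchySeq_of_le_tendsto_0' (fun n =>
      √(2 * regSeq n * (Real.exp (L * |t - s|) * ‖χ‖) ^ 2 * |t - s|)) (fun n m hnm => ?_) ?_)
    · rw [dist_comm, dist_eq_norm]
      refine Real.le_sqrt_of_sq_le ?_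
      exact h.norm_sub_sq_le_of_le hL (regSeq_pos m) (regSeq_anti hnm)
        (fun r => hU4 m r s (S s χ)) (fun r => hU4 n r s (S s χ)) t s (hU1 _ _ _) (hU1 _ _ _)
    · have h1 := (((tendsto_regSeq.const_mul 2).mul_const
        ((Real.exp (L * |t - s|) * ‖χ‖) ^ 2)).mul_const |t - s|).sqrt
      simpa using h1
  choose u' hu' using hlim
  let u : ℝ → ℝ → H →L[ℂ] H := fun t s =>
    continuousLinearMapOfTendsto (fun n => U n t s) (f := u' t s) (tendsto_pi_nhds.mpr (hu' t s))
  have hu : ∀ t s ψ, Tendsto (fun n => U n t s ψ) atTop (𝓝 (u t s ψ)) := hu'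
  have hnorm : ∀ t s ψ, ‖u t s ψ‖ = ‖ψ‖ := fun t s ψ =>
    tendsto_nhds_unique (hu t s ψ).norm (by simp [hU2])
  refine ⟨U, u, hU4, hU1, hU2, hu, fun t ψ => ?_, hnorm, fun t s r ψ => ?_⟩
  · exact tendsto_nhds_unique (hu t t ψ) (by simp [hU1])
  · refine tendsto_nhds_unique ?_ (hu t r ψ)
    -- The factors `U n t s` are isometries, so the strong limit of the product is the product of
    -- the strong limits.
    have h1 : Tendsto (fun n => U n t s (U n s r ψ - u s r ψ)) atTop (𝓝 0) := by
      rw [tendsto_zero_iff_norm_tendsto_zero]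
      simp only [hU2]
      exact tendsto_iff_norm_sub_tendsto_zero.mp (hu s r ψ)
    have h2 := h1.add (hu t s (u s r ψ))
    simpa [hU3] using h2

/-- The regularised graph vectors `y n` are bounded, so they have weak limits `Y t s χ`, which
represent `A t (u t s) (S s) χ`; hence the domain is invariant. The difficulty is strong continuity
of `Y` in `t`. At `t = s` it holds because the bound `exp (L |t - s|) ‖χ‖` tends to `‖χ‖`; elsewhere
it follows from the cocycle identity for `Y`. With `Y` continuous, the integrated equation can be
differentiated. -/
theorem exists_resolventPropagator (h : IsLipschitzResolventFamily S B L) (hL : 0 ≤ L) :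
    ∃ u Y, IsResolventPropagator S u Y univ := by
  obtain ⟨U, u, hUd, hU1, hUn, hUu, hu1, hun, huc⟩ := h.exists_limit_propagator hL
  -- the graph-norm vectors of the regularised problems
  let y : ℕ → ℝ → ℝ → H → H := fun n t s χ => regInv (S t) (regSeq n) (U n t s (S s χ))
  have hy : ∀ n t s χ, ‖y n t s χ‖ ≤ Real.exp (L * |t - s|) * ‖χ‖ := fun n t s χ =>
    h.norm_regInv_solution_le' hL (regSeq_pos n) (fun r => hUd n r s (S s χ)) t s (hU1 n s _)
  have hSy : ∀ t s χ, Tendsto (fun n => S t (y n t s χ)) atTop (𝓝 (u t s (S s χ))) := by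
    intro t s χ
    have h1 : ∀ n, S t (y n t s χ) = U n t s (S s χ) - (regSeq n : ℂ) • y n t s χ := fun n =>
      eq_sub_of_add_eq (apply_regInv_add (h.pos t) (regSeq_pos n) _)
    have h2 : Tendsto (fun n => (regSeq n : ℂ) • y n t s χ) atTop (𝓝 0) := by
      rw [tendsto_zero_iff_norm_tendsto_zero]
      have h3 := tendsto_regSeq.mul_const (Real.exp (L * |t - s|) * ‖χ‖)
      rw [zero_mul] at h3
      refine squeeze_zero (fun n => norm_nonneg _) (fun n => ?_) h3
      rw [norm_smul, Complex.norm_real, Real.norm_of_nonneg (regSeq_pos n).le]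
      exact mul_le_mul_of_nonneg_left (hy n t s χ) (regSeq_pos n).le
    simp only [h1]
    simpa using (hUu t s (S s χ)).sub h2
  have hweak : ∀ t s χ, ∃ z, ‖z‖ ≤ Real.exp (L * |t - s|) * ‖χ‖ ∧
      ∀ φ, Tendsto (fun n => inner ℂ (y n t s χ) φ) atTop (𝓝 (inner ℂ z φ)) := by
    intro t s χ
    refine exists_weak_limit (fun n => hy n t s χ) (h.denseRange t) ?_
    -- Tested against `S t α` the weak limit exists, because `S t` moves to the left and `S t (y n t
    -- s χ)` converges strongly.
    rintro _ ⟨α, rfl⟩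
    refine ⟨inner ℂ (u t s (S s χ)) α, ?_⟩
    simp only [← h.inner_apply]
    exact (hSy t s χ).inner tendsto_const_nhds
  choose Y hYn hYw using hweak
  have hYu : ∀ t s χ, u t s (S s χ) = S t (Y t s χ) := by
    intro t s χ
    refine ext_inner_right ℂ fun α => ?_
    rw [h.inner_apply]
    refine tendsto_nhds_unique ?_ (hYw t s χ (S t α))
    simp only [← h.inner_apply]
    exact (hSy t s χ).inner tendsto_const_nhds
  have hYc : ∀ t s r χ, Y t s (Y s r χ) = Y t r χ := by
    intro t s r χ
    refine h.inj t ?_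
    rw [← hYu, ← hYu, ← hYu, huc]
  -- continuity at the initial time
  have hgenb : ∀ n t s χ, ∀ x ∈ uIcc s t, ‖regGen S (regSeq n) x (U n x s (S s χ))‖ ≤
        2⁻¹ * (Real.exp (L * |t - s|) * ‖χ‖ + ‖S s χ‖) := by
    intro n t s χ x hx
    have hx' : |x - s| ≤ |t - s| := abs_sub_left_of_mem_uIcc hx
    rw [regGen_apply, norm_smul]
    have h1 : ‖(-(Complex.I / 2))‖ = 2⁻¹ := by simp
    rw [h1]
    gcongr
    refine (norm_sub_le _ _).trans ?_
    rw [hUn]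
    gcongr
    refine (hy n x s χ).trans ?_
    gcongr
  have hulip : ∀ t s χ, ‖u t s (S s χ) - S s χ‖ ≤
      2⁻¹ * (Real.exp (L * |t - s|) * ‖χ‖ + ‖S s χ‖) * |t - s| := by
    intro t s χ
    refine le_of_tendsto ((hUu t s (S s χ)).sub_const (S s χ)).norm
      (Eventually.of_forall fun n => ?_)
    have hmain := (convex_uIcc s t).norm_image_sub_le_of_norm_hasDerivWithin_le
      (fun x _ => (hUd n x s (S s χ)).hasDerivWithinAt) (hgenb n t s χ) left_mem_uIcc right_mem_uIcc
    simpa [hU1] using hmain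
  have hudiag : ∀ s χ, Tendsto (fun t => u t s (S s χ)) (𝓝 s) (𝓝 (S s χ)) := by
    intro s χ
    rw [tendsto_iff_norm_sub_tendsto_zero]
    have hc : Continuous fun t : ℝ =>
        2⁻¹ * (Real.exp (L * |t - s|) * ‖χ‖ + ‖S s χ‖) * |t - s| := by fun_prop
    have h1 := hc.tendsto s
    rw [sub_self, abs_zero, mul_zero] at h1
    exact squeeze_zero (fun t => norm_nonneg _) (fun t => hulip t s χ) h1
  have hYdiag : ∀ s χ, Tendsto (fun t => Y t s χ) (𝓝 s) (𝓝 χ) := by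
    intro s χ
    have habs : Tendsto (fun t : ℝ => |t - s|) (𝓝 s) (𝓝 0) := by
      have : Continuous fun t : ℝ => |t - s| := by fun_prop
      simpa using this.tendsto s
    have hexp : Tendsto (fun t : ℝ => Real.exp (L * |t - s|) * ‖χ‖) (𝓝 s) (𝓝 ‖χ‖) := by
      have : Continuous fun t : ℝ => Real.exp (L * |t - s|) * ‖χ‖ := by fun_prop
      simpa using this.tendsto s
    have hu0 := hudiag s χ
    refine tendsto_of_norm_le_of_tendsto_inner (Eventually.of_forall fun t => hYn t s χ) hexp
      (h.denseRange s) ?_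
    rintro _ ⟨α, rfl⟩
    -- The relative bound trades the moving operator `S t` for the fixed `S s`, whose dense range
    -- provides the test vectors.
    have h2 : ∀ t, S s (Y t s χ) = u t s (S s χ) - S s (B s t (Y t s χ)) := by
      intro t
      rw [hYu, h.rel s t (Y t s χ), map_add, add_sub_cancel_right]
    have h3 : Tendsto (fun t => B s t (Y t s χ)) (𝓝 s) (𝓝 0) := by
      rw [tendsto_zero_iff_norm_tendsto_zero]
      have h4 := (habs.const_mul L).mul hexp
      rw [mul_zero, zero_mul] at h4
      refine squeeze_zero (fun t => norm_nonneg _) (fun t => ?_) h4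
      refine (h.bound s t _).trans ?_
      rw [abs_sub_comm s t]
      gcongr
      exact hYn t s χ
    have h4 : Tendsto (fun t => S s (Y t s χ)) (𝓝 s) (𝓝 (S s χ)) := by
      simp only [h2]
      simpa using hu0.sub (((S s).continuous.tendsto 0).comp h3)
    simp only [← h.inner_apply]
    exact h4.inner tendsto_const_nhds
  have hYcont : ∀ s χ, Continuous fun t => Y t s χ := by
    intro s χ
    refine continuous_iff_continuousAt.mpr fun t => ?_
    -- Restart at time `t`: by the cocycle identity, continuity at the initial time gives continuity
    -- at every time.
    have h1 := hYdiag t (Y t s χ)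
    simp only [hYc] at h1
    exact h1
  have hucont : ∀ s χ, Continuous fun t => u t s (S s χ) := by
    intro s χ
    refine continuous_iff_continuousAt.mpr fun t => ?_
    have h1 := hudiag t (Y t s χ)
    simp only [← hYu, huc] at h1
    exact h1
  refine ⟨u, Y, fun t _ => hu1 t, fun t _ s _ => hun t s, fun t _ s _ r _ => huc t s r,
    fun t _ s _ => hYu t s, fun t _ s _ χ => ?_, fun s _ => hYdiag s, fun t _ s _ => ?_⟩
  swap
  · refine ⟨Real.exp (L * |t - s|) + 1, by positivity, ?_⟩
    have hc : Continuous fun p : ℝ × ℝ => Real.exp (L * |p.1 - p.2|) := by fun_prop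
    filter_upwards [(hc.tendsto (t, s)).eventually_le_const (lt_add_one _)] with p hp χ
    exact (hYn p.1 p.2 χ).trans (by gcongr)
  -- pass to the limit in the integrated equation
  set g : ℝ → H := fun r => (-(Complex.I / 2)) • (Y r s χ - u r s (S s χ)) with hg
  have hgc : Continuous g := ((hYcont s χ).sub (hucont s χ)).const_smul (-(Complex.I / 2))
  -- The regularised generators converge only weakly, so the limit in the integrated equation is
  -- taken after pairing with a fixed vector.
  have hint : ∀ t, u t s (S s χ) = S s χ + ∫ r in s..t, g r := by
    intro t
    refine ext_inner_left ℂ fun α => ?_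
    have hUc : ∀ n, Continuous fun r => U n r s (S s χ) := fun n =>
      continuous_iff_continuousAt.mpr fun r => (hUd n r s (S s χ)).continuousAt
    have hgn : ∀ n, Continuous fun r => regGen S (regSeq n) r (U n r s (S s χ)) := by
      intro n
      have : Continuous fun r => (-(Complex.I / 2)) •
          (regInv (S r) (regSeq n) (U n r s (S s χ)) - U n r s (S s χ)) :=
        (((h.continuous_regInv hL (regSeq_pos n)).clm_apply (hUc n)).sub (hUc n)).const_smul
          (-(Complex.I / 2))
      exact this
    have h1 : ∀ n, inner ℂ α (U n t s (S s χ)) = inner ℂ α (S s χ) +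
        ∫ r in s..t, inner ℂ α (regGen S (regSeq n) r (U n r s (S s χ))) := by
      intro n
      have h2 := intervalIntegral.integral_eq_sub_of_hasDerivAt (a := s) (b := t)
        (fun r _ => hUd n r s (S s χ)) ((hgn n).intervalIntegrable s t)
      rw [hU1] at h2
      have h3 := ((innerSL ℂ α).restrictScalars ℝ).intervalIntegral_comp_comm
        ((hgn n).intervalIntegrable (μ := volume) s t)
      have h4 : ∫ r in s..t, inner ℂ α (regGen S (regSeq n) r (U n r s (S s χ))) =
          inner ℂ α (U n t s (S s χ) - S s χ) := by
        rw [← h2]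
        exact h3
      rw [h4, inner_sub_right]
      ring
    have h2 : Tendsto (fun n => ∫ r in s..t,
        inner ℂ α (regGen S (regSeq n) r (U n r s (S s χ)))) atTop
        (𝓝 (∫ r in s..t, inner ℂ α (g r))) := by
      refine intervalIntegral.tendsto_integral_filter_of_dominated_convergence
        (fun _ => ‖α‖ * (2⁻¹ * (Real.exp (L * |t - s|) * ‖χ‖ + ‖S s χ‖)))
        (Eventually.of_forall fun n => ?_) (Eventually.of_forall fun n => ?_)
        intervalIntegrable_const (Eventually.of_forall fun r _ => ?_)
      · exact (continuous_const.inner (hgn n)).aestronglyMeasurable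
      · refine Eventually.of_forall fun r hr => (norm_inner_le_norm _ _).trans ?_
        gcongr
        exact hgenb n t s χ r (uIoc_subset_uIcc hr)
      · simp only [regGen_apply, hg, inner_smul_right, inner_sub_right]
        refine Tendsto.const_mul _ (Tendsto.sub ?_ (tendsto_const_nhds.inner (hUu r s (S s χ))))
        have h3 := (Complex.continuous_conj.tendsto _).comp (hYw r s χ α)
        rw [inner_conj_symm] at h3
        refine h3.congr fun n => ?_
        exact inner_conj_symm _ _
    have h3 : ∫ r in s..t, inner ℂ α (g r) = inner ℂ α (∫ r in s..t, g r) :=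
      ((innerSL ℂ α).restrictScalars ℝ).intervalIntegral_comp_comm
        (hgc.intervalIntegrable (μ := volume) s t)
    rw [inner_add_right, ← h3]
    refine tendsto_nhds_unique ((tendsto_const_nhds (x := α)).inner (hUu t s (S s χ))) ?_
    simp only [h1]
    exact h2.const_add _
  have h1 : HasDerivAt (fun t => S s χ + ∫ r in s..t, g r) (g t) t :=
    ((hgc.integral_hasStrictDerivAt s t).hasDerivAt).const_add _
  rw [← hYu]
  exact h1.congr_of_eventuallyEq (Eventually.of_forall hint)

end IsLipschitzResolventFamily

/-! ### Local families: uniqueness and gluing. -/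

section Local

variable {H : Type*} [NormedAddCommGroup H] [InnerProductSpace ℂ H]

/-- The local version of `IsLipschitzResolventFamily` on the interval `(a, b)`. -/
structure IsLocLipschitzResolventFamily (S : ℝ → H →L[ℂ] H) (B : ℝ → ℝ → H →L[ℂ] H) (a b : ℝ) :
    Prop where
  pos : ∀ t ∈ Ioo a b, (S t).IsPositive
  inj : ∀ t ∈ Ioo a b, Function.Injective (S t)
  rel : ∀ t ∈ Ioo a b, ∀ s ∈ Ioo a b, ∀ χ, S s χ = S t (χ + B t s χ)
  bound : ∀ α ∈ Ioo a b, ∀ β ∈ Ioo a b, ∃ L, 0 ≤ L ∧ ∀ t ∈ Icc α β, ∀ s ∈ Icc α β, ∀ χ,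
    ‖B t s χ‖ ≤ L * |t - s| * ‖χ‖

theorem re_inner_generator_eq_zero {S : H →L[ℂ] H} (hS : S.IsPositive) (y : H) :
    (inner ℂ (S y) ((-(Complex.I / 2)) • (y - S y))).re = 0 := by
  have h1 : (inner ℂ (S y) y).im = 0 := by
    rw [← Complex.conj_eq_iff_im, inner_conj_symm]
    exact (hS.1 y y).symm
  have h2 : (inner ℂ (S y) (S y)).im = 0 := inner_self_im (𝕜 := ℂ) _
  rw [inner_smul_right, inner_sub_right]
  simp only [neg_mul, Complex.neg_re, Complex.mul_re, Complex.div_ofNat_re, Complex.I_re,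
    Complex.div_ofNat_im, Complex.I_im, Complex.sub_im, h1, h2]
  simp

theorem norm_eq_of_hasDerivAt_generator {S : ℝ → H →L[ℂ] H} {J : Set ℝ} (hJ : IsOpen J)
    (hJc : IsPreconnected J) (hS : ∀ t ∈ J, (S t).IsPositive) {y : ℝ → H} {v : ℝ → H}
    (hvy : ∀ t ∈ J, v t = S t (y t))
    (hv : ∀ t ∈ J, HasDerivAt v ((-(Complex.I / 2)) • (y t - S t (y t))) t) {s t : ℝ}
    (hs : s ∈ J) (ht : t ∈ J) : ‖v s‖ = ‖v t‖ :=
  norm_eq_of_re_inner_deriv_eq_zero hJ hJc hv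
    (fun t ht => by rw [hvy t ht]; exact re_inner_generator_eq_zero (hS t ht) (y t)) hs ht

theorem IsResolventPropagator.mono {S : ℝ → H →L[ℂ] H} {u : ℝ → ℝ → H →L[ℂ] H}
    {Y : ℝ → ℝ → H → H} {J J' : Set ℝ} (h : IsResolventPropagator S u Y J) (hJ : J' ⊆ J) :
    IsResolventPropagator S u Y J' where
  refl t ht := h.refl t (hJ ht)
  norm_eq t ht s hs := h.norm_eq t (hJ ht) s (hJ hs)
  comp t ht s hs r hr := h.comp t (hJ ht) s (hJ hs) r (hJ hr)
  apply_eq t ht s hs := h.apply_eq t (hJ ht) s (hJ hs)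
  hasDerivAt t ht s hs := h.hasDerivAt t (hJ ht) s (hJ hs)
  tendsto_gen s hs := h.tendsto_gen s (hJ hs)
  bound_gen t ht s hs := h.bound_gen t (hJ ht) s (hJ hs)

namespace IsLocLipschitzResolventFamily

variable {S : ℝ → H →L[ℂ] H} {B : ℝ → ℝ → H →L[ℂ] H} {a b : ℝ}

theorem inner_apply (h : IsLocLipschitzResolventFamily S B a b) {t : ℝ} (ht : t ∈ Ioo a b)
    (x y : H) : inner ℂ (S t x) y = inner ℂ x (S t y) := (h.pos t ht).1 x y

/-- Freezing the family outside `[α, β]` at its end values makes it globally Lipschitz, because the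
projection of the line onto an interval is a contraction. -/
theorem clamp (h : IsLocLipschitzResolventFamily S B a b) {α β : ℝ} (hα : α ∈ Ioo a b)
    (hβ : β ∈ Ioo a b) (hαβ : α ≤ β) :
    ∃ L, 0 ≤ L ∧ IsLipschitzResolventFamily (fun t => S (projIcc α β hαβ t))
      (fun t s => B (projIcc α β hαβ t) (projIcc α β hαβ s)) L := by
  obtain ⟨L, hL, hB⟩ := h.bound α hα β hβ
  have hsub : ∀ t, (projIcc α β hαβ t : ℝ) ∈ Ioo a b := fun t =>
    ⟨hα.1.trans_le (projIcc α β hαβ t).2.1, (projIcc α β hαβ t).2.2.trans_lt hβ.2⟩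
  refine ⟨L, hL, ⟨fun t => h.pos _ (hsub t), fun t => h.inj _ (hsub t),
    fun t s => h.rel _ (hsub t) _ (hsub s), fun t s χ => ?_⟩⟩
  refine (hB _ (projIcc α β hαβ t).2 _ (projIcc α β hαβ s).2 χ).trans ?_
  refine mul_le_mul_of_nonneg_right (mul_le_mul_of_nonneg_left ?_ hL) (norm_nonneg _)
  have h1 := abs_max_sub_max_le_abs (min β t) (min β s) α
  rw [max_comm _ α, max_comm _ α, min_comm β, min_comm β] at h1
  rw [coe_projIcc, coe_projIcc, min_comm β, min_comm β]
  refine h1.trans ?_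
  have h2 := abs_min_sub_min_le_max t β s β
  simpa using h2

variable [CompleteSpace H]

theorem denseRange (h : IsLocLipschitzResolventFamily S B a b) {t : ℝ} (ht : t ∈ Ioo a b) :
    DenseRange (S t) := by
  obtain ⟨L, hL, hc⟩ := h.clamp ht ht le_rfl
  have h1 := hc.denseRange t
  simpa using h1

theorem exists_resolventPropagator_Ioo (h : IsLocLipschitzResolventFamily S B a b) {α β : ℝ}
    (hα : α ∈ Ioo a b) (hβ : β ∈ Ioo a b) :
    ∃ u Y, IsResolventPropagator S u Y (Ioo α β) := by
  rcases le_or_gt α β with hαβ | hαβ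
  swap
  · refine ⟨fun _ _ => 0, fun _ _ _ => 0, ?_⟩
    rw [Ioo_eq_empty (not_lt.mpr hαβ.le)]
    constructor <;> simp
  obtain ⟨L, hL, hc⟩ := h.clamp hα hβ hαβ
  obtain ⟨u, Y, hu⟩ := hc.exists_resolventPropagator hL
  have hu' := hu.mono (subset_univ (Ioo α β))
  have hp : ∀ t ∈ Ioo α β, (projIcc α β hαβ t : ℝ) = t := fun t ht => by
    rw [projIcc_of_mem hαβ (Ioo_subset_Icc_self ht)]
  refine ⟨u, Y, hu'.refl, hu'.norm_eq, hu'.comp, fun t ht s hs χ => ?_, fun t ht s hs χ => ?_,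
    hu'.tendsto_gen, hu'.bound_gen⟩
  · have h1 := hu'.apply_eq t ht s hs χ
    rwa [hp t ht, hp s hs] at h1
  · have h1 := hu'.hasDerivAt t ht s hs χ
    simp only [hp t ht, hp s hs] at h1
    exact h1

theorem propagator_unique (h : IsLocLipschitzResolventFamily S B a b) {u u' : ℝ → ℝ → H →L[ℂ] H}
    {Y Y' : ℝ → ℝ → H → H} {α β : ℝ} (hsub : Ioo α β ⊆ Ioo a b)
    (hu : IsResolventPropagator S u Y (Ioo α β)) (hu' : IsResolventPropagator S u' Y' (Ioo α β))
    {t s : ℝ} (ht : t ∈ Ioo α β) (hs : s ∈ Ioo α β) : u t s = u' t s ∧ Y t s = Y' t s := by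
  have h1 : ∀ χ, u t s (S s χ) = u' t s (S s χ) := by
    intro χ
    have h2 := norm_eq_of_hasDerivAt_generator (S := S) isOpen_Ioo isPreconnected_Ioo
      (fun t ht => h.pos t (hsub ht)) (y := fun r => Y r s χ - Y' r s χ)
      (v := fun r => u r s (S s χ) - u' r s (S s χ))
      (fun r hr => by rw [hu.apply_eq r hr s hs, hu'.apply_eq r hr s hs, map_sub])
      (fun r hr => ((hu.hasDerivAt r hr s hs χ).sub (hu'.hasDerivAt r hr s hs χ)).congr_deriv
        (by rw [map_sub]; module)) ht hs
    rw [hu.refl s hs, hu'.refl s hs, sub_self, norm_zero, norm_eq_zero, sub_eq_zero] at h2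
    exact h2
  constructor
  · refine ContinuousLinearMap.ext fun ψ => ?_
    exact congrFun ((u t s).continuous.ext_on (h.denseRange (hsub hs)) (u' t s).continuous
      (by rintro _ ⟨χ, rfl⟩; exact h1 χ)) ψ
  · funext χ
    refine h.inj t (hsub ht) ?_
    rw [← hu.apply_eq t ht s hs, ← hu'.apply_eq t ht s hs, h1]

/-- The propagators on intervals compactly contained in `(a, b)` agree on overlaps by uniqueness, so
they glue. -/
theorem exists_resolventPropagator (h : IsLocLipschitzResolventFamily S B a b) :
    ∃ u Y, IsResolventPropagator S u Y (Ioo a b) := by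
  choose U V hUV using fun (α : Ioo a b) (β : Ioo a b) =>
    h.exists_resolventPropagator_Ioo α.2 β.2
  have hsub : ∀ α β : Ioo a b, Ioo (α : ℝ) β ⊆ Ioo a b := fun α β x hx =>
    ⟨α.2.1.trans hx.1, hx.2.trans β.2.2⟩
  have hcons : ∀ α β α' β' : Ioo a b, ∀ t s : ℝ, t ∈ Ioo (α : ℝ) β → s ∈ Ioo (α : ℝ) β →
      t ∈ Ioo (α' : ℝ) β' → s ∈ Ioo (α' : ℝ) β' →
      U α β t s = U α' β' t s ∧ V α β t s = V α' β' t s := by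
    intro α β α' β' t s ht hs ht' hs'
    have hI : ∀ x, x ∈ Ioo (α : ℝ) β → x ∈ Ioo (α' : ℝ) β' →
        x ∈ Ioo (max (α : ℝ) α') (min (β : ℝ) β') := fun x hx hx' =>
      ⟨max_lt hx.1 hx'.1, lt_min hx.2 hx'.2⟩
    have h1 : Ioo (max (α : ℝ) α') (min (β : ℝ) β') ⊆ Ioo α β :=
      Ioo_subset_Ioo (le_max_left _ _) (min_le_left _ _)
    have h2 : Ioo (max (α : ℝ) α') (min (β : ℝ) β') ⊆ Ioo α' β' :=
      Ioo_subset_Ioo (le_max_right _ _) (min_le_right _ _)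
    exact h.propagator_unique (h1.trans (hsub α β)) ((hUV α β).mono h1) ((hUV α' β').mono h2)
      (hI t ht ht') (hI s hs hs')
  have hex : ∀ t ∈ Ioo a b, ∀ s ∈ Ioo a b, ∀ r ∈ Ioo a b, ∃ α β : Ioo a b,
      t ∈ Ioo (α : ℝ) β ∧ s ∈ Ioo (α : ℝ) β ∧ r ∈ Ioo (α : ℝ) β := by
    intro t ht s hs r hr
    obtain ⟨α, hα, hα'⟩ := exists_between (lt_min ht.1 (lt_min hs.1 hr.1))
    obtain ⟨β, hβ, hβ'⟩ := exists_between (max_lt ht.2 (max_lt hs.2 hr.2))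
    simp only [lt_min_iff, max_lt_iff] at hα' hβ
    exact ⟨⟨α, hα, hα'.1.trans ht.2⟩, ⟨β, ht.1.trans hβ.1, hβ'⟩, ⟨hα'.1, hβ.1⟩,
      ⟨hα'.2.1, hβ.2.1⟩, ⟨hα'.2.2, hβ.2.2⟩⟩
  have hloc : ∃ (u : ℝ → ℝ → H →L[ℂ] H) (Y : ℝ → ℝ → H → H), ∀ α β : Ioo a b, ∀ t s : ℝ,
      t ∈ Ioo (α : ℝ) β → s ∈ Ioo (α : ℝ) β → u t s = U α β t s ∧ Y t s = V α β t s := by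
    have : ∀ t s : ℝ, ∃ (T : H →L[ℂ] H) (Z : H → H), ∀ α β : Ioo a b,
        t ∈ Ioo (α : ℝ) β → s ∈ Ioo (α : ℝ) β → T = U α β t s ∧ Z = V α β t s := by
      intro t s
      by_cases hts : t ∈ Ioo a b ∧ s ∈ Ioo a b
      · obtain ⟨α, β, ht, hs, -⟩ := hex t hts.1 s hts.2 s hts.2
        exact ⟨U α β t s, V α β t s, fun α' β' ht' hs' => hcons _ _ _ _ t s ht hs ht' hs'⟩
      -- An arbitrary value for times outside `(a, b)`, where nothing is claimed.
      · exact ⟨0, 0, fun α β ht hs => absurd ⟨hsub α β ht, hsub α β hs⟩ hts⟩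
    choose u Y huY using this
    exact ⟨u, Y, fun α β t s => huY t s α β⟩
  obtain ⟨u, Y, huY⟩ := hloc
  refine ⟨u, Y, fun t ht ψ => ?_, fun t ht s hs ψ => ?_, fun t ht s hs r hr ψ => ?_,
    fun t ht s hs χ => ?_, fun t ht s hs χ => ?_, fun s hs χ => ?_, fun t ht s hs => ?_⟩
  · obtain ⟨α, β, ht', -, -⟩ := hex t ht t ht t ht
    rw [(huY α β t t ht' ht').1, (hUV α β).refl t ht']
  · obtain ⟨α, β, ht', hs', -⟩ := hex t ht s hs s hs
    rw [(huY α β t s ht' hs').1, (hUV α β).norm_eq t ht' s hs']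
  · obtain ⟨α, β, ht', hs', hr'⟩ := hex t ht s hs r hr
    rw [(huY α β t s ht' hs').1, (huY α β s r hs' hr').1, (huY α β t r ht' hr').1,
      (hUV α β).comp t ht' s hs' r hr']
  · obtain ⟨α, β, ht', hs', -⟩ := hex t ht s hs s hs
    rw [(huY α β t s ht' hs').1, (huY α β t s ht' hs').2, (hUV α β).apply_eq t ht' s hs']
  · obtain ⟨α, β, ht', hs', -⟩ := hex t ht s hs s hs
    rw [(huY α β t s ht' hs').2]
    refine ((hUV α β).hasDerivAt t ht' s hs' χ).congr_of_eventuallyEq ?_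
    filter_upwards [Ioo_mem_nhds ht'.1 ht'.2] with r hr
    rw [(huY α β r s hr hs').1]
  · obtain ⟨α, β, hs', -, -⟩ := hex s hs s hs s hs
    refine ((hUV α β).tendsto_gen s hs' χ).congr' ?_
    filter_upwards [Ioo_mem_nhds hs'.1 hs'.2] with r hr
    rw [(huY α β r s hr hs').2]
  · obtain ⟨α, β, ht', hs', -⟩ := hex t ht s hs s hs
    obtain ⟨C, hC, hev⟩ := (hUV α β).bound_gen t ht' s hs'
    refine ⟨C, hC, ?_⟩
    filter_upwards [hev, prod_mem_nhds (Ioo_mem_nhds ht'.1 ht'.2)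
      (Ioo_mem_nhds hs'.1 hs'.2)] with p hp hpm χ
    rw [(huY α β p.1 p.2 hpm.1 hpm.2).2]
    exact hp χ

end IsLocLipschitzResolventFamily

end Local

/-! ### Joint regularity of the propagator. -/

namespace IsResolventPropagator

variable {H : Type*} [NormedAddCommGroup H] [InnerProductSpace ℂ H]
  {S : ℝ → H →L[ℂ] H} {B : ℝ → ℝ → H →L[ℂ] H} {a b : ℝ} {u : ℝ → ℝ → H →L[ℂ] H}
  {Y : ℝ → ℝ → H → H}

/-- In the structure `Y t s` is a bare map; its algebraic properties are inherited from `u t s`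
through injectivity of `S t`. -/
theorem gen_sub (hu : IsResolventPropagator S u Y (Ioo a b))
    (h : IsLocLipschitzResolventFamily S B a b) {t s : ℝ} (ht : t ∈ Ioo a b) (hs : s ∈ Ioo a b)
    (χ χ' : H) : Y t s (χ - χ') = Y t s χ - Y t s χ' := by
  refine h.inj t ht ?_
  rw [map_sub, ← hu.apply_eq t ht s hs, ← hu.apply_eq t ht s hs, ← hu.apply_eq t ht s hs,
    map_sub, map_sub]

theorem gen_zero (hu : IsResolventPropagator S u Y (Ioo a b))
    (h : IsLocLipschitzResolventFamily S B a b) {t s : ℝ} (ht : t ∈ Ioo a b) (hs : s ∈ Ioo a b) :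
    Y t s 0 = 0 := by
  have := hu.gen_sub h ht hs 0 0
  simpa using this

theorem gen_comp (hu : IsResolventPropagator S u Y (Ioo a b))
    (h : IsLocLipschitzResolventFamily S B a b) {t s r : ℝ} (ht : t ∈ Ioo a b)
    (hs : s ∈ Ioo a b) (hr : r ∈ Ioo a b) (χ : H) : Y t s (Y s r χ) = Y t r χ := by
  refine h.inj t ht ?_
  rw [← hu.apply_eq t ht s hs, ← hu.apply_eq t ht r hr, ← hu.apply_eq s hs r hr,
    hu.comp t ht s hs r hr]

theorem gen_refl (hu : IsResolventPropagator S u Y (Ioo a b))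
    (h : IsLocLipschitzResolventFamily S B a b) {t : ℝ} (ht : t ∈ Ioo a b) (χ : H) :
    Y t t χ = χ := by
  refine h.inj t ht ?_
  rw [← hu.apply_eq t ht t ht, hu.refl t ht]

/-- Continuity in the initial time: `Y s r` inverts `Y r s`, so the error is `Y s r (y r - Y r s (y
s))`, where the argument tends to `0` and `Y s r` is locally bounded. -/
theorem tendsto_gen_initial (hu : IsResolventPropagator S u Y (Ioo a b))
    (h : IsLocLipschitzResolventFamily S B a b) {y : ℝ → H} {s : ℝ} (hs : s ∈ Ioo a b)
    (hy : ContinuousAt y s) : Tendsto (fun r => Y s r (y r)) (𝓝 s) (𝓝 (y s)) := by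
  obtain ⟨C, hC, hev⟩ := hu.bound_gen s hs s hs
  have hev' : ∀ᶠ r in 𝓝 s, ∀ χ, ‖Y s r χ‖ ≤ C * ‖χ‖ :=
    ((Continuous.prodMk_right s).tendsto s).eventually hev
  rw [tendsto_iff_norm_sub_tendsto_zero]
  have h1 : Tendsto (fun r => C * ‖y r - Y r s (y s)‖) (𝓝 s) (𝓝 0) := by
    have h2 := ((Tendsto.sub hy (hu.tendsto_gen s hs (y s))).norm).const_mul C
    simpa using h2
  refine squeeze_zero' (Eventually.of_forall fun r => norm_nonneg _) ?_ h1
  filter_upwards [hev', Ioo_mem_nhds hs.1 hs.2] with r hr hrm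
  have h2 : Y s r (y r) - y s = Y s r (y r - Y r s (y s)) := by
    rw [hu.gen_sub h hs hrm, hu.gen_comp h hs hrm hs, hu.gen_refl h hs]
  rw [h2]
  exact hr _

/-- Joint continuity by factoring `Y p.1 p.2 = Y p.1 t ∘ Y t s ∘ Y s p.2`: each outer factor moves
in one variable only. -/
theorem continuousOn_gen (hu : IsResolventPropagator S u Y (Ioo a b))
    (h : IsLocLipschitzResolventFamily S B a b) {y : ℝ → H} (hy : ContinuousOn y (Ioo a b)) :
    ContinuousOn (fun p : ℝ × ℝ => Y p.1 p.2 (y p.2)) (Ioo a b ×ˢ Ioo a b) := by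
  rintro ⟨t, s⟩ ⟨ht, hs⟩
  refine ContinuousAt.continuousWithinAt ?_
  have hys : ContinuousAt y s := hy.continuousAt (Ioo_mem_nhds hs.1 hs.2)
  obtain ⟨C, hC, hev⟩ := hu.bound_gen t ht t ht
  have hev' : ∀ᶠ p : ℝ × ℝ in 𝓝 (t, s), ∀ χ, ‖Y p.1 t χ‖ ≤ C * ‖χ‖ :=
    ((continuous_fst.prodMk (continuous_const (y := t))).tendsto (t, s)).eventually hev
  obtain ⟨C', hC', hev1⟩ := hu.bound_gen t ht s hs
  have hts := hev1.self_of_nhds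
  simp only at hts
  have h1 : Tendsto (fun p : ℝ × ℝ => Y p.1 t (Y t s (y s))) (𝓝 (t, s)) (𝓝 (Y t s (y s))) :=
    (hu.tendsto_gen t ht _).comp (continuous_fst.tendsto (t, s))
  have h2 : Tendsto (fun p : ℝ × ℝ => C * (C' * ‖Y s p.2 (y p.2) - y s‖)) (𝓝 (t, s)) (𝓝 0) := by
    have h3 := (hu.tendsto_gen_initial h hs hys).comp
      ((continuous_snd (X := ℝ) (Y := ℝ)).tendsto (t, s))
    have h4 := ((h3.sub_const (y s)).norm.const_mul C').const_mul C
    simpa using h4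
  have h3 : Tendsto (fun p : ℝ × ℝ => Y p.1 p.2 (y p.2) - Y p.1 t (Y t s (y s))) (𝓝 (t, s))
      (𝓝 0) := by
    rw [tendsto_zero_iff_norm_tendsto_zero]
    refine squeeze_zero' (Eventually.of_forall fun r => norm_nonneg _) ?_ h2
    filter_upwards [hev', prod_mem_nhds (Ioo_mem_nhds ht.1 ht.2)
      (Ioo_mem_nhds hs.1 hs.2)] with p hp hpm
    have e1 : Y p.1 p.2 (y p.2) - Y p.1 t (Y t s (y s)) =
        Y p.1 t (Y t s (Y s p.2 (y p.2) - y s)) := by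
      rw [hu.gen_sub h ht hs, hu.gen_sub h hpm.1 ht, hu.gen_comp h ht hs hpm.2,
        hu.gen_comp h hpm.1 ht hpm.2]
    rw [e1]
    refine (hp _).trans ?_
    gcongr
    exact hts _
  have h4 := h3.add h1
  simp only [sub_add_cancel, zero_add] at h4
  exact h4

variable [CompleteSpace H]

theorem continuousOn (hu : IsResolventPropagator S u Y (Ioo a b))
    (h : IsLocLipschitzResolventFamily S B a b) (ψ : H) :
    ContinuousOn (fun p : ℝ × ℝ => u p.1 p.2 ψ) (Ioo a b ×ˢ Ioo a b) := by
  rintro ⟨t, s⟩ ⟨ht, hs⟩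
  refine ContinuousAt.continuousWithinAt ?_
  have hmem : ∀ᶠ p : ℝ × ℝ in 𝓝 (t, s), p.1 ∈ Ioo a b ∧ p.2 ∈ Ioo a b :=
    prod_mem_nhds (Ioo_mem_nhds ht.1 ht.2) (Ioo_mem_nhds hs.1 hs.2)
  refine tendsto_apply_of_dense (T := fun p : ℝ × ℝ => u p.1 p.2) (T₀ := u t s) (C := 1) ?_
    (h.denseRange hs) ?_ ψ
  · filter_upwards [hmem] with p hp ψ
    rw [hu.norm_eq p.1 hp.1 p.2 hp.2, one_mul]
  · rintro _ ⟨χ, rfl⟩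
    have h1 : Tendsto (fun p : ℝ × ℝ => u p.1 s (S s χ)) (𝓝 (t, s)) (𝓝 (u t s (S s χ))) :=
      ((hu.hasDerivAt t ht s hs χ).continuousAt.tendsto).comp (continuous_fst.tendsto (t, s))
    have h2 : Tendsto (fun p : ℝ × ℝ => ‖S s χ - u p.2 s (S s χ)‖) (𝓝 (t, s)) (𝓝 0) := by
      have h3 := ((hu.hasDerivAt s hs s hs χ).continuousAt.tendsto).comp
        ((continuous_snd (X := ℝ) (Y := ℝ)).tendsto (t, s))
      have h4 := (h3.const_sub (S s χ)).norm
      rw [hu.refl s hs, sub_self, norm_zero] at h4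
      exact h4
    have h3 : Tendsto (fun p : ℝ × ℝ => u p.1 p.2 (S s χ) - u p.1 s (S s χ)) (𝓝 (t, s))
        (𝓝 0) := by
      rw [tendsto_zero_iff_norm_tendsto_zero]
      refine h2.congr' ?_
      filter_upwards [hmem] with p hp
      rw [← hu.comp p.1 hp.1 p.2 hp.2 s hs, ← map_sub, hu.norm_eq p.1 hp.1 p.2 hp.2]
    have h4 := h3.add h1
    simp only [sub_add_cancel, zero_add] at h4
    exact h4

theorem tendsto_apply_right (hu : IsResolventPropagator S u Y (Ioo a b))
    (h : IsLocLipschitzResolventFamily S B a b) {t s : ℝ} (ht : t ∈ Ioo a b) (hs : s ∈ Ioo a b)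
    {l : Filter ℝ} (hl : l ≤ 𝓝 s) {w : ℝ → H} {w₀ : H} (hw : Tendsto w l (𝓝 w₀)) :
    Tendsto (fun r => u t r (w r)) l (𝓝 (u t s w₀)) := by
  have h1 : Tendsto (fun r => u t r w₀) l (𝓝 (u t s w₀)) := by
    have h2 := (hu.continuousOn h w₀).continuousAt
      (prod_mem_nhds (Ioo_mem_nhds ht.1 ht.2) (Ioo_mem_nhds hs.1 hs.2))
    exact (h2.tendsto.comp ((Continuous.prodMk_right t).tendsto s)).mono_left hl
  have h3 : Tendsto (fun r => u t r (w r) - u t r w₀) l (𝓝 0) := by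
    rw [tendsto_zero_iff_norm_tendsto_zero]
    refine (tendsto_iff_norm_sub_tendsto_zero.mp hw).congr' ?_
    filter_upwards [hl (Ioo_mem_nhds hs.1 hs.2)] with r hr
    rw [← map_sub, hu.norm_eq t ht r hr]
  have h4 := h3.add h1
  simp only [sub_add_cancel, zero_add] at h4
  exact h4

/-- With `ψ = S s χ` one has `u t r ψ - u t s ψ = u t r (ψ - u r s ψ)`, so the difference quotient
in the second time is `-u t r` applied to the one in the first time, taken at `r = s`. -/
theorem hasDerivAt_right (hu : IsResolventPropagator S u Y (Ioo a b))
    (h : IsLocLipschitzResolventFamily S B a b) {t s : ℝ} (ht : t ∈ Ioo a b) (hs : s ∈ Ioo a b)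
    (χ : H) :
    HasDerivAt (fun r => u t r (S s χ)) ((Complex.I / 2) • u t s (χ - S s χ)) s := by
  have h1 := hu.hasDerivAt s hs s hs χ
  rw [hu.gen_refl h hs] at h1
  rw [hasDerivAt_iff_tendsto_slope] at h1 ⊢
  have h2 := hu.tendsto_apply_right h ht hs nhdsWithin_le_nhds h1.neg
  rw [← neg_smul, neg_neg, map_smul] at h2
  refine h2.congr' ?_
  filter_upwards [nhdsWithin_le_nhds (Ioo_mem_nhds hs.1 hs.2)] with r hr
  rw [slope_def_module, slope_def_module, hu.refl s hs, ← smul_neg, neg_sub,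
    ContinuousLinearMap.map_smul_of_tower, map_sub, hu.comp t ht r hr s hs]

/-- The vector `y s` stands for `A s ψ`; having it for every `s` expresses that `ψ` lies in the
common domain. Both partial derivatives are then jointly continuous. -/
theorem contDiffOn (hu : IsResolventPropagator S u Y (Ioo a b))
    (h : IsLocLipschitzResolventFamily S B a b) {ψ : H} {y : ℝ → H}
    (hyψ : ∀ s ∈ Ioo a b, S s (y s) = ψ) (hy : ContinuousOn y (Ioo a b)) :
    ContDiffOn ℝ 1 (fun p : ℝ × ℝ => u p.1 p.2 ψ) (Ioo a b ×ˢ Ioo a b) := by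
  have hopen : IsOpen (Ioo a b ×ˢ Ioo a b) := isOpen_Ioo.prod isOpen_Ioo
  set d₁ : ℝ → ℝ → ℝ →L[ℝ] H := fun t s => ContinuousLinearMap.toSpanSingleton ℝ
    ((-(Complex.I / 2)) • (Y t s (y s) - u t s ψ)) with hd₁
  set d₂ : ℝ → ℝ → ℝ →L[ℝ] H := fun t s => ContinuousLinearMap.toSpanSingleton ℝ
    ((Complex.I / 2) • u t s (y s - ψ)) with hd₂
  have huy : ContinuousOn (fun p : ℝ × ℝ => u p.1 p.2 (y p.2 - ψ)) (Ioo a b ×ˢ Ioo a b) := by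
    rintro ⟨t, s⟩ hp
    refine ContinuousAt.continuousWithinAt ?_
    have hys : ContinuousAt y s := hy.continuousAt (Ioo_mem_nhds hp.2.1 hp.2.2)
    have h1 := (hu.continuousOn h (y s - ψ)).continuousAt (hopen.mem_nhds hp)
    have h3 : Tendsto (fun p : ℝ × ℝ => u p.1 p.2 (y p.2 - ψ) - u p.1 p.2 (y s - ψ)) (𝓝 (t, s))
        (𝓝 0) := by
      rw [tendsto_zero_iff_norm_tendsto_zero]
      have h4 := (tendsto_iff_norm_sub_tendsto_zero.mp hys).comp
        ((continuous_snd (X := ℝ) (Y := ℝ)).tendsto (t, s))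
      refine h4.congr' ?_
      filter_upwards [hopen.mem_nhds hp] with p hp
      rw [← map_sub, hu.norm_eq p.1 hp.1 p.2 hp.2, sub_sub_sub_cancel_right]
      rfl
    have h4 := h3.add h1.tendsto
    simp only [sub_add_cancel, zero_add] at h4
    exact h4
  have hc₁ : ContinuousOn (fun p : ℝ × ℝ => d₁ p.1 p.2) (Ioo a b ×ˢ Ioo a b) :=
    (ContinuousLinearMap.toSpanSingletonCLE (𝕜 := ℝ) (E := H)).continuous.comp_continuousOn
      (((hu.continuousOn_gen h hy).sub (hu.continuousOn h ψ)).const_smul (-(Complex.I / 2)))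
  have hc₂ : ContinuousOn (fun p : ℝ × ℝ => d₂ p.1 p.2) (Ioo a b ×ˢ Ioo a b) :=
    (ContinuousLinearMap.toSpanSingletonCLE (𝕜 := ℝ) (E := H)).continuous.comp_continuousOn
      (huy.const_smul (Complex.I / 2))
  have hF : ∀ p ∈ Ioo a b ×ˢ Ioo a b, HasFDerivAt (fun p : ℝ × ℝ => u p.1 p.2 ψ)
      ((d₁ p.1 p.2).coprod (d₂ p.1 p.2)) p := by
    intro p hp
    refine (hasStrictFDerivAt_uncurry_coprod (𝕜 := ℝ) (u := p) (f := fun t s => u t s ψ)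
      (f₁ := d₁) (f₂ := d₂) ?_ ?_ (hc₁.continuousAt (hopen.mem_nhds hp))
      (hc₂.continuousAt (hopen.mem_nhds hp))).hasFDerivAt
    · filter_upwards [hopen.mem_nhds hp] with q hq
      have h1 := (hu.hasDerivAt q.1 hq.1 q.2 hq.2 (y q.2)).hasFDerivAt
      rw [← hu.apply_eq q.1 hq.1 q.2 hq.2, hyψ q.2 hq.2] at h1
      exact h1
    · filter_upwards [hopen.mem_nhds hp] with q hq
      have h1 := (hu.hasDerivAt_right h hq.1 hq.2 (y q.2)).hasFDerivAt
      rw [hyψ q.2 hq.2] at h1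
      exact h1
  rw [← zero_add (1 : WithTop ℕ∞), contDiffOn_succ_iff_fderiv_of_isOpen hopen, contDiffOn_zero]
  refine ⟨fun p hp => (hF p hp).differentiableAt.differentiableWithinAt, by simp, ?_⟩
  refine ContinuousOn.congr (f := fun p : ℝ × ℝ => (d₁ p.1 p.2).coprod (d₂ p.1 p.2)) ?_
    fun p hp => (hF p hp).fderiv
  exact hc₁.continuousLinearMapCoprod hc₂

end IsResolventPropagator

/-- The energy structure of a family of inverses `S t = (T t)* (T t)`: the form norms
`‖T t (A t ψ)‖`, `A t = (S t)⁻¹`, vary by at most `|M t - M s| ‖ψ‖`. -/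
structure HasEnergyForm {H K : Type*} [NormedAddCommGroup H] [InnerProductSpace ℂ H]
    [NormedAddCommGroup K] [InnerProductSpace ℂ K]
    (S : ℝ → H →L[ℂ] H) (T : ℝ → H →L[ℂ] K) (M : ℝ → ℝ) (J : Set ℝ) : Prop where
  inner_eq : ∀ t ∈ J, ∀ x y, inner ℂ (T t x) (T t y) = inner ℂ x (S t y)
  norm_le : ∀ t ∈ J, ∀ s ∈ J, ∀ χ χ', S t χ = S s χ' →
    ‖T t χ‖ ≤ ‖T s χ'‖ + |M t - M s| * ‖S t χ‖
  mono : MonotoneOn M J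
  cont : ContinuousOn M J

/-! ### Growth of the energy norm along the evolution. -/

namespace IsResolventPropagator

variable {H K : Type*} [NormedAddCommGroup H] [InnerProductSpace ℂ H]
  [NormedAddCommGroup K] [InnerProductSpace ℂ K]
  {S : ℝ → H →L[ℂ] H} {B : ℝ → ℝ → H →L[ℂ] H} {a b : ℝ} {u : ℝ → ℝ → H →L[ℂ] H}
  {Y : ℝ → ℝ → H → H} {T : ℝ → H →L[ℂ] K} {M : ℝ → ℝ}

theorem continuousAt_gen (hu : IsResolventPropagator S u Y (Ioo a b))
    (h : IsLocLipschitzResolventFamily S B a b) {t s : ℝ} (ht : t ∈ Ioo a b) (hs : s ∈ Ioo a b)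
    (χ : H) : ContinuousAt (fun r => Y r s χ) t := by
  have h1 := hu.tendsto_gen t ht (Y t s χ)
  have h2 : Tendsto (fun r => Y r s χ) (𝓝 t) (𝓝 (Y t s χ)) := by
    refine h1.congr' ?_
    filter_upwards [Ioo_mem_nhds ht.1 ht.2] with r hr
    rw [hu.gen_comp h hr ht hs]
  exact h2

theorem uIcc_subset_Ioo' {t s : ℝ} (ht : t ∈ Ioo a b) (hs : s ∈ Ioo a b) :
    uIcc s t ⊆ Ioo a b := by
  intro x hx
  rcases mem_uIcc.mp hx with h | h
  · exact ⟨hs.1.trans_le h.1, h.2.trans_lt ht.2⟩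
  · exact ⟨ht.1.trans_le h.1, h.2.trans_lt hs.2⟩

/-- The form norm taken with the form frozen at time `x` is stationary along the solution at that
time, since a time-independent Hamiltonian conserves its own energy. Changing the form from time `x`
to `z` costs `|M z - M x| ‖ψ‖`, and the solution has constant norm, so the additive comparison lemma
applies. -/
theorem norm_form_le (hu : IsResolventPropagator S u Y (Ioo a b))
    (h : IsLocLipschitzResolventFamily S B a b) (hE : HasEnergyForm S T M (Ioo a b)) {t s : ℝ}
    (ht : t ∈ Ioo a b) (hs : s ∈ Ioo a b) (χ : H) :
    ‖T t (Y t s χ)‖ ≤ ‖T s χ‖ + |M t - M s| * ‖S s χ‖ := by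
  have hsub := uIcc_subset_Ioo' ht hs
  -- For a nonzero vector the energy never vanishes, so its square root can be differentiated.
  by_cases hψ : S s χ = 0
  · have hχ : χ = 0 := h.inj s hs (by rw [hψ, map_zero])
    rw [hχ, hu.gen_zero h ht hs]
    simp
  have hsq : ∀ x ∈ Ioo a b, ∀ y, ‖T x y‖ ^ 2 = (inner ℂ y (S x y)).re := by
    intro x hx y
    rw [← hE.inner_eq x hx]
    exact (inner_self_eq_norm_sq (𝕜 := ℂ) _).symm
  have hfc : ContinuousOn (fun x => ‖T x (Y x s χ)‖) (uIcc s t) := by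
    intro x hx
    have hx' := hsub hx
    -- No continuity of `T` in time is assumed; the energy is rewritten as `⟨Y, u⟩`, in which both
    -- factors are continuous.
    have h1 : ContinuousAt (fun r => √((inner ℂ (Y r s χ) (u r s (S s χ))).re)) x :=
      (Complex.continuous_re.continuousAt.comp ((hu.continuousAt_gen h hx' hs χ).inner (𝕜 := ℂ)
        (hu.hasDerivAt x hx' s hs χ).continuousAt)).sqrt
    refine (h1.congr ?_).continuousWithinAt
    filter_upwards [Ioo_mem_nhds hx'.1 hx'.2] with r hr
    rw [hu.apply_eq r hr s hs, ← hsq r hr, Real.sqrt_sq (norm_nonneg _)]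
  have key := le_add_abs_sub_of_forall_le_comparison (f := fun x => ‖T x (Y x s χ)‖)
    (M := fun x => M x * ‖S s χ‖) (s := s) (t := t) hfc
    ((hE.cont.mono hsub).mul continuousOn_const)
    (fun x hx y hy hxy => mul_le_mul_of_nonneg_right (hE.mono (hsub hx) (hsub hy) hxy)
      (norm_nonneg _)) fun x hx => by
    have hx' := hsub hx
    -- This is `A x` applied to the solution at time `z`: the operator stays at `x` while the
    -- solution moves.
    obtain ⟨α, hα⟩ : ∃ α : ℝ → H, ∀ z, α z = Y z s χ + B x z (Y z s χ) := ⟨_, fun _ => rfl⟩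
    have hαS : ∀ z ∈ Ioo a b, S x (α z) = u z s (S s χ) := by
      intro z hz
      rw [hα, hu.apply_eq z hz s hs, h.rel x hx' z hz]
    have hαx : α x = Y x s χ := by
      refine h.inj x hx' ?_
      rw [hαS x hx', hu.apply_eq x hx' s hs]
    have hαc : Tendsto α (𝓝 x) (𝓝 (Y x s χ)) := by
      obtain ⟨α₀, h1, h2⟩ := exists_between hx'.1
      obtain ⟨β₀, h3, h4⟩ := exists_between hx'.2
      obtain ⟨L, hL, hB⟩ := h.bound α₀ ⟨h1, h2.trans hx'.2⟩ β₀ ⟨hx'.1.trans h3, h4⟩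
      have hc := hu.continuousAt_gen h hx' hs χ
      have h5 : Tendsto (fun z => B x z (Y z s χ)) (𝓝 x) (𝓝 0) := by
        rw [tendsto_zero_iff_norm_tendsto_zero]
        have h6 : Tendsto (fun z => L * |x - z| * ‖Y z s χ‖) (𝓝 x) (𝓝 0) := by
          have h7 : Continuous fun z : ℝ => L * |x - z| := by fun_prop
          have h8 := (h7.tendsto x).mul hc.tendsto.norm
          simpa using h8
        refine squeeze_zero' (Eventually.of_forall fun _ => norm_nonneg _) ?_ h6
        filter_upwards [Icc_mem_nhds h2 h3] with z hz
        exact hB x ⟨h2.le, h3.le⟩ z hz _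
      have h9 := hc.tendsto.add h5
      rw [add_zero] at h9
      exact h9.congr fun z => (hα z).symm
    -- The curve `α` is only continuous. By symmetry of `S x`, the increment of the energy is the
    -- real part of `⟨S x (α z) - S x (α x), α z + α x⟩`, and `S x (α z)` is the differentiable
    -- solution.
    have hder : HasDerivAt (fun z => (inner ℂ (α z) (S x (α z))).re) 0 x := by
      rw [hasDerivAt_iff_tendsto_slope]
      have h1 := hu.hasDerivAt x hx' s hs χ
      rw [hasDerivAt_iff_tendsto_slope] at h1
      have h2 := (Complex.continuous_re.tendsto _).comp (h1.inner (𝕜 := ℂ)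
        ((hαc.add_const (α x)).mono_left nhdsWithin_le_nhds))
      have h3 : (inner ℂ ((-(Complex.I / 2)) • (Y x s χ - S x (Y x s χ)))
          (Y x s χ + α x)).re = 0 := by
        have h4 : (inner ℂ (Y x s χ) (S x (Y x s χ))).im = 0 := by
          rw [← Complex.conj_eq_iff_im, inner_conj_symm, h.inner_apply hx']
        have h5 : (inner ℂ (Y x s χ) (Y x s χ)).im = 0 := inner_self_im (𝕜 := ℂ) _
        have h8 : (starRingEnd ℂ) (-(Complex.I / 2)) = Complex.I / 2 := by
          rw [map_neg, map_div₀, Complex.conj_I, neg_div, neg_neg, Complex.conj_ofNat]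
        rw [hαx, inner_smul_left, inner_sub_left, inner_add_right, inner_add_right,
          h.inner_apply hx', h8]
        simp only [Complex.mul_re, Complex.div_ofNat_re, Complex.I_re, Complex.div_ofNat_im,
          Complex.I_im, Complex.sub_im, Complex.add_im, h4, h5]
        simp
      rw [h3] at h2
      refine h2.congr' ?_
      filter_upwards [nhdsWithin_le_nhds (Ioo_mem_nhds hx'.1 hx'.2)] with z hz
      have h6 : (inner ℂ (S x (α z)) (α x)).re = (inner ℂ (S x (α x)) (α z)).re := by
        rw [h.inner_apply hx', ← inner_conj_symm, Complex.conj_re]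
      have h7 : ∀ w, (inner ℂ (S x w) w).re = (inner ℂ w (S x w)).re := fun w => by
        rw [h.inner_apply hx']
      rw [slope_def_field]
      simp only [Function.comp, slope_def_module]
      rw [← hαS z hz, ← hαS x hx', ← Complex.coe_smul, inner_smul_left, Complex.conj_ofReal,
        Complex.re_ofReal_mul, inner_sub_left, inner_add_right, inner_add_right]
      simp only [Complex.sub_re, Complex.add_re, h6, h7]
      field_simp
      ring
    refine ⟨fun z => ‖T x (α z)‖, ?_, by simp only [hαx], fun z hz => ?_⟩
    · have hpos : (inner ℂ (α x) (S x (α x))).re ≠ 0 := by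
        rw [← hsq x hx']
        intro h0
        have h1 : T x (α x) = 0 := by simpa using h0
        refine hψ ?_
        have h2 : S x (α x) = 0 := by
          refine ext_inner_left ℂ fun w => ?_
          rw [← hE.inner_eq x hx', h1, inner_zero_right, inner_zero_right]
        rw [hαS x hx'] at h2
        rw [← norm_eq_zero, ← hu.norm_eq x hx' s hs, h2, norm_zero]
      have h1 := hder.sqrt hpos
      rw [zero_div] at h1
      refine h1.congr_of_eventuallyEq (Eventually.of_forall fun z => ?_)
      simp only
      rw [← hsq x hx', Real.sqrt_sq (norm_nonneg _)]
    · have hz' := hsub hz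
      have h1 := hE.norm_le z hz' x hx' (Y z s χ) (α z)
        (by rw [hαS z hz', hu.apply_eq z hz' s hs])
      rw [← hu.apply_eq z hz' s hs, hu.norm_eq z hz' s hs] at h1
      simp only
      rwa [← sub_mul, abs_mul, abs_of_nonneg (norm_nonneg (S s χ))]
  rwa [← sub_mul, abs_mul, abs_of_nonneg (norm_nonneg (S s χ)), hu.gen_refl h hs] at key

end IsResolventPropagator

/-! ### Strong limits at the ends of the time interval. -/

namespace IsResolventPropagator

variable {H K : Type*} [NormedAddCommGroup H] [InnerProductSpace ℂ H]
  [NormedAddCommGroup K] [InnerProductSpace ℂ K]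
  {S : ℝ → H →L[ℂ] H} {B : ℝ → ℝ → H →L[ℂ] H} {a b : ℝ} {u : ℝ → ℝ → H →L[ℂ] H}
  {Y : ℝ → ℝ → H → H} {T : ℝ → H →L[ℂ] K} {M : ℝ → ℝ}

theorem exists_apply_eq (h : IsLocLipschitzResolventFamily S B a b) {t s : ℝ} (ht : t ∈ Ioo a b)
    (hs : s ∈ Ioo a b) (χ : H) : ∃ χ', S t χ' = S s χ := ⟨_, (h.rel t ht s hs χ).symm⟩

/-- Writing the fixed vector as `S r χ'` turns `⟨ψ, A r (u r s ψ)⟩` into an inner product of two `T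
r` vectors. Cauchy-Schwarz then needs only form norms, which grow like `M`, and no graph norm. -/
theorem norm_inner_deriv_le (hu : IsResolventPropagator S u Y (Ioo a b))
    (h : IsLocLipschitzResolventFamily S B a b) (hE : HasEnergyForm S T M (Ioo a b)) {r s : ℝ}
    (hr : r ∈ Ioo a b) (hs : s ∈ Ioo a b) (χ : H) :
    ‖inner ℂ (S s χ) ((-(Complex.I / 2)) • (Y r s χ - S r (Y r s χ)))‖ ≤
      2⁻¹ * ((‖T s χ‖ + |M r - M s| * ‖S s χ‖) ^ 2 + ‖S s χ‖ ^ 2) := by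
  obtain ⟨χ', hχ'⟩ := exists_apply_eq h hr hs χ
  have h1 : ‖T r χ'‖ ≤ ‖T s χ‖ + |M r - M s| * ‖S s χ‖ := by
    have := hE.norm_le r hr s hs χ' χ hχ'
    rwa [hχ'] at this
  have h2 := hu.norm_form_le h hE hr hs χ
  have h3 : ‖inner ℂ (S s χ) (Y r s χ)‖ ≤ (‖T s χ‖ + |M r - M s| * ‖S s χ‖) ^ 2 := by
    rw [← hχ', h.inner_apply hr, ← hE.inner_eq r hr, hχ', pow_two]
    exact (norm_inner_le_norm _ _).trans (mul_le_mul h1 h2 (norm_nonneg _) (by positivity))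
  have h4 : ‖inner ℂ (S s χ) (S r (Y r s χ))‖ ≤ ‖S s χ‖ ^ 2 := by
    refine (norm_inner_le_norm _ _).trans (le_of_eq ?_)
    rw [← hu.apply_eq r hr s hs, hu.norm_eq r hr s hs, pow_two]
  have h5 : ‖(-(Complex.I / 2))‖ = 2⁻¹ := by simp
  rw [inner_smul_right, norm_mul, h5, inner_sub_right]
  gcongr
  exact (norm_sub_le _ _).trans (add_le_add h3 h4)

/-- Since `u t s` is isometric, `‖u t s ψ - ψ‖² = 2 Re (⟨ψ, ψ⟩ - ⟨ψ, u t s ψ⟩)`, which is first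
order in the matrix element. The hypothesis `hM` says that the estimate starts from the time with
the smaller `|M|`. -/
theorem norm_sub_sq_le (hu : IsResolventPropagator S u Y (Ioo a b))
    (h : IsLocLipschitzResolventFamily S B a b) (hE : HasEnergyForm S T M (Ioo a b))
    {t s : ℝ} (ht : t ∈ Ioo a b) (hs : s ∈ Ioo a b) {C : ℝ} {χ : H}
    (hC1 : ‖S s χ‖ ≤ C) (hC2 : ‖T s χ‖ ≤ C * (1 + |M s|))
    (hM : ∀ r ∈ uIcc s t, |M s| ≤ |M r| ∧ |M r - M s| ≤ |M r|) :
    ‖u t s (S s χ) - S s χ‖ ^ 2 ≤ 5 * C ^ 2 * |∫ r in s..t, (1 + |M r|) ^ 2| := by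
  have hsub := uIcc_subset_Ioo' ht hs
  have hC0 : 0 ≤ C := (norm_nonneg _).trans hC1
  set g : ℝ → ℂ := fun r => inner ℂ (S s χ) ((-(Complex.I / 2)) • (Y r s χ - S r (Y r s χ)))
    with hg
  have hder : ∀ r ∈ uIcc s t, HasDerivAt (fun r => inner ℂ (S s χ) (u r s (S s χ))) (g r) r := by
    intro r hr
    have h1 := (hasDerivAt_const r (S s χ)).inner ℂ (hu.hasDerivAt r (hsub hr) s hs χ)
    refine h1.congr_deriv ?_
    rw [inner_zero_left, add_zero]
  have hgc : ContinuousOn g (uIcc s t) := by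
    intro r hr
    have h1 := (hu.continuousAt_gen h (hsub hr) hs χ).sub
      (hu.hasDerivAt r (hsub hr) s hs χ).continuousAt
    have h2 : ContinuousAt (fun r => inner ℂ (S s χ)
        ((-(Complex.I / 2)) • (Y r s χ - u r s (S s χ)))) r :=
      continuousAt_const.inner (h1.const_smul (-(Complex.I / 2)))
    refine (h2.congr ?_).continuousWithinAt
    filter_upwards [Ioo_mem_nhds (hsub hr).1 (hsub hr).2] with x hx
    rw [hg, hu.apply_eq x hx s hs]
  have hint := intervalIntegral.integral_eq_sub_of_hasDerivAt hder hgc.intervalIntegrable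
  have hwc : ContinuousOn (fun r => (1 + |M r|) ^ 2) (uIcc s t) :=
    (continuousOn_const.add (hE.cont.mono hsub).abs).pow 2
  have hbound : ∀ r ∈ uIcc s t, ‖g r‖ ≤ 2⁻¹ * (5 * C ^ 2) * (1 + |M r|) ^ 2 := by
    intro r hr
    obtain ⟨hM1, hM2⟩ := hM r hr
    refine (hu.norm_inner_deriv_le h hE (hsub hr) hs χ).trans ?_
    rw [mul_assoc]
    gcongr
    have h1 : ‖T s χ‖ + |M r - M s| * ‖S s χ‖ ≤ 2 * (C * (1 + |M r|)) := by
      have h2 : |M r - M s| * ‖S s χ‖ ≤ |M r| * C :=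
        mul_le_mul hM2 hC1 (norm_nonneg _) (abs_nonneg _)
      have h3 : C * (1 + |M s|) ≤ C * (1 + |M r|) := by gcongr
      nlinarith
    have h2 : ‖S s χ‖ ≤ C * (1 + |M r|) := by nlinarith [abs_nonneg (M r)]
    -- The constant `5` is `2² + 1²`.
    calc (‖T s χ‖ + |M r - M s| * ‖S s χ‖) ^ 2 + ‖S s χ‖ ^ 2
        ≤ (2 * (C * (1 + |M r|))) ^ 2 + (C * (1 + |M r|)) ^ 2 := by gcongr
      _ = 5 * C ^ 2 * (1 + |M r|) ^ 2 := by ring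
  have hle : ‖∫ r in s..t, g r‖ ≤ 2⁻¹ * (5 * C ^ 2) * |∫ r in s..t, (1 + |M r|) ^ 2| := by
    have h1 := intervalIntegral.norm_integral_le_abs_of_norm_le (μ := volume) (f := g) (a := s)
      (b := t) (g := fun r => 2⁻¹ * (5 * C ^ 2) * (1 + |M r|) ^ 2)
      ((ae_restrict_iff' measurableSet_uIoc).mpr
        (Eventually.of_forall fun r hr => hbound r (uIoc_subset_uIcc hr)))
      (hwc.intervalIntegrable.const_mul _)
    rw [intervalIntegral.integral_const_mul, abs_mul] at h1
    rwa [abs_of_nonneg (by positivity : (0 : ℝ) ≤ 2⁻¹ * (5 * C ^ 2))] at h1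
  have hsq : ‖u t s (S s χ) - S s χ‖ ^ 2 = -2 * (∫ r in s..t, g r).re := by
    rw [hint, norm_sub_sq (𝕜 := ℂ), hu.norm_eq t ht s hs, hu.refl s hs, Complex.sub_re]
    have h1 : (inner ℂ (S s χ) (S s χ)).re = ‖S s χ‖ ^ 2 := inner_self_eq_norm_sq (𝕜 := ℂ) _
    have h2 : (inner ℂ (u t s (S s χ)) (S s χ)).re = (inner ℂ (S s χ) (u t s (S s χ))).re := by
      rw [← inner_conj_symm, Complex.conj_re]
    rw [h1]
    simp only [RCLike.re_to_complex, h2]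
    ring
  rw [hsq]
  have h1 := (Complex.abs_re_le_norm (∫ r in s..t, g r)).trans hle
  have h2 := neg_abs_le (∫ r in s..t, g r).re
  linarith

/-- The estimate is started at `s` from the evolved vector `u s 0 ψ`, whose energy at time `s` is
bounded by the growth estimate. -/
theorem norm_forward_sub_sq_le (hu : IsResolventPropagator S u Y (Ioo a b))
    (h : IsLocLipschitzResolventFamily S B a b) (hE : HasEnergyForm S T M (Ioo a b))
    (h0 : (0 : ℝ) ∈ Ioo a b) (hM0 : M 0 = 0) {t s : ℝ} (ht : t ∈ Ioo a b) (hs : s ∈ Ioo a b)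
    (hM : ∀ r ∈ uIcc s t, |M s| ≤ |M r| ∧ |M r - M s| ≤ |M r|) (χ : H) :
    ‖u t 0 (S 0 χ) - u s 0 (S 0 χ)‖ ^ 2 ≤
      5 * (‖T 0 χ‖ + ‖S 0 χ‖) ^ 2 * |∫ r in s..t, (1 + |M r|) ^ 2| := by
  rw [← hu.comp t ht s hs 0 h0, hu.apply_eq s hs 0 h0]
  refine hu.norm_sub_sq_le h hE ht hs ?_ ?_ hM
  · rw [← hu.apply_eq s hs 0 h0, hu.norm_eq s hs 0 h0]
    exact le_add_of_nonneg_left (norm_nonneg _)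
  · have h1 := hu.norm_form_le h hE hs h0 χ
    rw [hM0, sub_zero] at h1
    nlinarith [mul_nonneg (norm_nonneg (T 0 χ)) (abs_nonneg (M s)), norm_nonneg (S 0 χ)]

/-- By isometry the difference has the norm of `ψ - u t s ψ` with the fixed vector `ψ`; its form
norm at time `s` is compared directly with that at time `0`. -/
theorem norm_backward_sub_sq_le (hu : IsResolventPropagator S u Y (Ioo a b))
    (h : IsLocLipschitzResolventFamily S B a b) (hE : HasEnergyForm S T M (Ioo a b))
    (h0 : (0 : ℝ) ∈ Ioo a b) (hM0 : M 0 = 0) {t s : ℝ} (ht : t ∈ Ioo a b) (hs : s ∈ Ioo a b)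
    (hM : ∀ r ∈ uIcc s t, |M s| ≤ |M r| ∧ |M r - M s| ≤ |M r|) (χ : H) :
    ‖u 0 t (S 0 χ) - u 0 s (S 0 χ)‖ ^ 2 ≤
      5 * (‖T 0 χ‖ + ‖S 0 χ‖) ^ 2 * |∫ r in s..t, (1 + |M r|) ^ 2| := by
  obtain ⟨χ', hχ'⟩ := exists_apply_eq h hs h0 χ
  have h2 : u 0 t (S 0 χ) - u 0 s (S 0 χ) = u 0 t (S s χ' - u t s (S s χ')) := by
    rw [hχ', map_sub, hu.comp 0 h0 t ht s hs]
  rw [h2, hu.norm_eq 0 h0 t ht, norm_sub_rev]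
  refine hu.norm_sub_sq_le h hE ht hs ?_ ?_ hM
  · rw [hχ']
    exact le_add_of_nonneg_left (norm_nonneg _)
  · have h1 := hE.norm_le s hs 0 h0 χ' χ hχ'
    rw [hM0, sub_zero, hχ'] at h1
    nlinarith [mul_nonneg (norm_nonneg (T 0 χ)) (abs_nonneg (M s)), norm_nonneg (S 0 χ)]

theorem exists_tendsto_of_norm_sub_sq_le {E : Type*} [NormedAddCommGroup E] [CompleteSpace E]
    {f : ℝ → E} {l : Filter ℝ} [l.NeBot] {G : ℝ → ℝ} {g C : ℝ} (hC : 0 ≤ C) (hG : Tendsto G l (𝓝 g)) {P : ℝ → Prop} (hP : ∀ᶠ t in l, P t)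
    (hf : ∀ t s, P t → P s → ‖f t - f s‖ ^ 2 ≤ C * |G t - G s|) :
    ∃ z, Tendsto f l (𝓝 z) := by
  refine cauchy_map_iff_exists_tendsto.mp (Metric.cauchy_iff.mpr ⟨inferInstance, fun ε hε => ?_⟩)
  have hδ : 0 < ε ^ 2 / (2 * (C + 1)) := by positivity
  have h1 := hP.and (Metric.tendsto_nhds.mp hG _ hδ)
  refine ⟨_, image_mem_map h1, ?_⟩
  rintro _ ⟨t, ⟨ht, ht'⟩, rfl⟩ _ ⟨s, ⟨hs, hs'⟩, rfl⟩
  have h2 := hf t s ht hs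
  have h3 : |G t - G s| < ε ^ 2 / (C + 1) := by
    rw [← Real.dist_eq]
    rw [dist_comm] at hs'
    have h4 := dist_triangle (G t) g (G s)
    have h5 : ε ^ 2 / (2 * (C + 1)) + ε ^ 2 / (2 * (C + 1)) = ε ^ 2 / (C + 1) := by
      field_simp; ring
    linarith
  rw [dist_eq_norm]
  refine lt_of_pow_lt_pow_left₀ 2 hε.le (h2.trans_lt ?_)
  rw [lt_div_iff₀ (by positivity)] at h3
  nlinarith [abs_nonneg (G t - G s)]

/-- Existence of the strong limits of `u t 0` and `u 0 t` at an end of the time interval at which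
`(1 + |M|)²` is integrable. -/
theorem exists_tendsto [CompleteSpace H] (hu : IsResolventPropagator S u Y (Ioo a b))
    (h : IsLocLipschitzResolventFamily S B a b) (hE : HasEnergyForm S T M (Ioo a b))
    (h0 : (0 : ℝ) ∈ Ioo a b) (hM0 : M 0 = 0)
    (hint : IntegrableOn (fun r => (1 + |M r|) ^ 2) (Ioo a b)) {l : Filter ℝ} [l.NeBot]
    (hl : (∀ᶠ t in l, t ∈ Ico 0 b) ∨ ∀ᶠ t in l, t ∈ Ioc a 0) {c : ℝ} (hlc : l ≤ 𝓝 c)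
    (ψ : H) :
    (∃ φ, Tendsto (fun t => u t 0 ψ) l (𝓝 φ)) ∧ ∃ φ, Tendsto (fun t => u 0 t ψ) l (𝓝 φ) := by
  -- a version of the weight which is integrable on the whole line
  set w : ℝ → ℝ := (Ioo a b).indicator fun r => (1 + |M r|) ^ 2 with hw
  have hwi : Integrable w := hint.integrable_indicator measurableSet_Ioo
  set G : ℝ → ℝ := fun t => ∫ r in (0 : ℝ)..t, w r with hG
  have hGc : Continuous G := intervalIntegral.continuous_primitive
    (fun _ _ => hwi.intervalIntegrable) 0
  have hGl : Tendsto G l (𝓝 (G c)) := (hGc.tendsto c).mono_left hlc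
  have hGsub : ∀ t ∈ Ioo a b, ∀ s ∈ Ioo a b, ∫ r in s..t, (1 + |M r|) ^ 2 = G t - G s := by
    intro t ht s hs
    rw [hG]
    simp only
    rw [intervalIntegral.integral_interval_sub_left hwi.intervalIntegrable
      hwi.intervalIntegrable]
    refine intervalIntegral.integral_congr fun r hr => ?_
    rw [hw, indicator_of_mem (uIcc_subset_Ioo' ht hs hr)]
  -- On each side of `0`, `|M|` increases away from `0`, so of two times the one nearer to `0` can
  -- serve as starting time.
  have hMb : ∀ P : Set ℝ, P = Ico 0 b ∨ P = Ioc a 0 → ∀ t ∈ P, ∀ s ∈ P,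
      t ∈ Ioo a b ∧ s ∈ Ioo a b ∧ ((∀ r ∈ uIcc s t, |M s| ≤ |M r| ∧ |M r - M s| ≤ |M r|) ∨
        ∀ r ∈ uIcc t s, |M t| ≤ |M r| ∧ |M r - M t| ≤ |M r|) := by
    have haux : ∀ s ∈ Ioo a b, ∀ r ∈ Ioo a b, (0 ≤ s ∧ s ≤ r ∨ r ≤ s ∧ s ≤ 0) →
        |M s| ≤ |M r| ∧ |M r - M s| ≤ |M r| := by
      rintro s hs r hr (⟨h1, h2⟩ | ⟨h1, h2⟩)
      · have h3 := hE.mono h0 hs h1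
        have h4 := hE.mono hs hr h2
        rw [hM0] at h3
        rw [abs_of_nonneg h3, abs_of_nonneg (h3.trans h4), abs_of_nonneg (sub_nonneg.mpr h4)]
        exact ⟨h4, by linarith⟩
      · have h3 := hE.mono hr hs h1
        have h4 := hE.mono hs h0 h2
        rw [hM0] at h4
        rw [abs_of_nonpos h4, abs_of_nonpos (h3.trans h4), abs_of_nonpos (sub_nonpos.mpr h3)]
        exact ⟨by linarith, by linarith⟩
    rintro P (rfl | rfl) t ht s hs
    · have ht' : t ∈ Ioo a b := ⟨h0.1.trans_le ht.1, ht.2⟩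
      have hs' : s ∈ Ioo a b := ⟨h0.1.trans_le hs.1, hs.2⟩
      refine ⟨ht', hs', ?_⟩
      rcases le_total s t with hst | hst
      · left
        intro r hr
        have hr' := uIcc_subset_Ioo' ht' hs' hr
        rw [uIcc_of_le hst] at hr
        exact haux s hs' r hr' (Or.inl ⟨hs.1, hr.1⟩)
      · right
        intro r hr
        have hr' := uIcc_subset_Ioo' hs' ht' hr
        rw [uIcc_of_le hst] at hr
        exact haux t ht' r hr' (Or.inl ⟨ht.1, hr.1⟩)
    · have ht' : t ∈ Ioo a b := ⟨ht.1, ht.2.trans_lt h0.2⟩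
      have hs' : s ∈ Ioo a b := ⟨hs.1, hs.2.trans_lt h0.2⟩
      refine ⟨ht', hs', ?_⟩
      rcases le_total t s with hst | hst
      · left
        intro r hr
        have hr' := uIcc_subset_Ioo' ht' hs' hr
        rw [uIcc_of_ge hst] at hr
        exact haux s hs' r hr' (Or.inr ⟨hr.2, hs.2⟩)
      · right
        intro r hr
        have hr' := uIcc_subset_Ioo' hs' ht' hr
        rw [uIcc_of_ge hst] at hr
        exact haux t ht' r hr' (Or.inr ⟨hr.2, ht.2⟩)
  obtain ⟨P, hP, hPl⟩ : ∃ P : Set ℝ, (P = Ico 0 b ∨ P = Ioc a 0) ∧ ∀ᶠ t in l, t ∈ P := by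
    rcases hl with hl | hl
    · exact ⟨_, Or.inl rfl, hl⟩
    · exact ⟨_, Or.inr rfl, hl⟩
  have hPJ : ∀ t ∈ P, t ∈ Ioo a b := fun t ht => (hMb P hP t ht t ht).1
  have hC : ∀ χ, 0 ≤ 5 * (‖T 0 χ‖ + ‖S 0 χ‖) ^ 2 := fun χ => by positivity
  constructor
  · refine exists_tendsto_apply_of_dense (C := 1) ?_ (h.denseRange h0) ?_ ψ
    · filter_upwards [hPl] with t ht ψ
      rw [hu.norm_eq t (hPJ t ht) 0 h0, one_mul]
    · rintro _ ⟨χ, rfl⟩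
      refine exists_tendsto_of_norm_sub_sq_le (hC χ) hGl hPl fun t s ht hs => ?_
      obtain ⟨ht', hs', hM | hM⟩ := hMb P hP t ht s hs
      · rw [← hGsub t ht' s hs']
        exact hu.norm_forward_sub_sq_le h hE h0 hM0 ht' hs' hM χ
      · rw [norm_sub_rev, abs_sub_comm, ← hGsub s hs' t ht']
        exact hu.norm_forward_sub_sq_le h hE h0 hM0 hs' ht' hM χ
  · refine exists_tendsto_apply_of_dense (C := 1) ?_ (h.denseRange h0) ?_ ψ
    · filter_upwards [hPl] with t ht ψ
      rw [hu.norm_eq 0 h0 t (hPJ t ht), one_mul]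
    · rintro _ ⟨χ, rfl⟩
      refine exists_tendsto_of_norm_sub_sq_le (hC χ) hGl hPl fun t s ht hs => ?_
      obtain ⟨ht', hs', hM | hM⟩ := hMb P hP t ht s hs
      · rw [← hGsub t ht' s hs']
        exact hu.norm_backward_sub_sq_le h hE h0 hM0 ht' hs' hM χ
      · rw [norm_sub_rev, abs_sub_comm, ← hGsub s hs' t ht']
        exact hu.norm_backward_sub_sq_le h hE h0 hM0 hs' ht' hM χ

end IsResolventPropagator

/-! ### Mollification in `L²` -/

section Mollify

open scoped Convolution

theorem tendsto_eLpNorm_translate_sub {f : E3 → ℂ} (hf : MemLp f 2 volume) :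
    Tendsto (fun t : E3 => eLpNorm (fun x => f (x - t) - f x) 2 volume) (𝓝 0) (𝓝 0) := by
  let g : E3 → C(E3, E3) := fun t => ⟨fun x => x - t, by fun_prop⟩
  have hg : Continuous g := ContinuousMap.continuous_of_continuous_uncurry _ (by
    change Continuous fun p : E3 × E3 => p.2 - p.1
    fun_prop)
  have hgm : ∀ t, MeasurePreserving (g t) volume volume := fun t =>
    measurePreserving_sub_right volume t
  have h1 := (continuous_const (y := hf.toLp f)).compMeasurePreservingLp hg hgm (by norm_num)
  have h2 := (h1.tendsto 0).edist (tendsto_const_nhds (x := hf.toLp f))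
  have h0 : Lp.compMeasurePreserving (g 0) (hgm 0) (hf.toLp f) = hf.toLp f := by
    refine Lp.ext ?_
    filter_upwards [Lp.coeFn_compMeasurePreserving (hf.toLp f) (hgm 0)] with x hx
    rw [hx]
    simp [g]
  rw [h0, edist_self] at h2
  refine h2.congr fun t => ?_
  rw [Lp.edist_def]
  refine eLpNorm_congr_ae ?_
  filter_upwards [Lp.coeFn_compMeasurePreserving (hf.toLp f) (hgm t), hf.coeFn_toLp,
    (hgm t).quasiMeasurePreserving.ae hf.coeFn_toLp] with x h3 h4 h5
  simp only [Pi.sub_apply, h3, h4, Function.comp, h5]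
  rfl

/-- The difference is an average of `f(x - t) - f(x)` against a probability density. Cauchy-Schwarz
with the density split into two square roots bounds its square pointwise, and Tonelli reduces the
claim to the translation bound. -/
theorem eLpNorm_convolution_sub_le_aux {f : E3 → ℂ} (hfm : StronglyMeasurable f)
    (hf : MemLp f 2 volume) (ρ : ContDiffBump (0 : E3)) {ε : ℝ≥0∞}
    (hε : ∀ t ∈ Metric.ball (0 : E3) ρ.rOut, eLpNorm (fun x => f (x - t) - f x) 2 volume ≤ ε) :
    eLpNorm (fun x => (ρ.normed volume ⋆[ContinuousLinearMap.lsmul ℝ ℝ, volume] f) x - f x) 2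
      volume ≤ ε := by
  set r : E3 → ℝ≥0∞ := fun t => ENNReal.ofReal (ρ.normed volume t) with hr
  have hrm : Measurable r := (ρ.continuous_normed.measurable).ennreal_ofReal
  have hr1 : ∫⁻ t, r t = 1 := by
    rw [← ofReal_integral_eq_lintegral_ofReal ρ.integrable_normed
      (Eventually.of_forall fun t => ρ.nonneg_normed t), ρ.integral_normed, ENNReal.ofReal_one]
  set F : E3 → E3 → ℝ≥0∞ := fun x t => ‖f (x - t) - f x‖ₑ with hF
  have hFm : Measurable (Function.uncurry F) := by
    have h1 : Measurable fun p : E3 × E3 => f (p.1 - p.2) - f p.1 :=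
      (hfm.measurable.comp (measurable_fst.sub measurable_snd)).sub
        (hfm.measurable.comp measurable_fst)
    exact h1.enorm
  have hpt : ∀ x, ‖(ρ.normed volume ⋆[ContinuousLinearMap.lsmul ℝ ℝ, volume] f) x - f x‖ₑ ^ 2 ≤
      ∫⁻ t, r t * F x t ^ 2 := by
    intro x
    have hex : ConvolutionExistsAt (ρ.normed volume) f x (ContinuousLinearMap.lsmul ℝ ℝ) volume :=
      ρ.hasCompactSupport_normed.convolutionExists_left _ ρ.continuous_normed
        (hf.locallyIntegrable (by norm_num)) x
    have h1 : (ρ.normed volume ⋆[ContinuousLinearMap.lsmul ℝ ℝ, volume] f) x - f x =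
        ∫ t, ρ.normed volume t • (f (x - t) - f x) := by
      have h2 : ∫ t, ρ.normed volume t • f x = f x := by
        rw [integral_smul_const, ρ.integral_normed, one_smul]
      conv_lhs => rw [← h2]
      rw [convolution_def, ← integral_sub hex (ρ.integrable_normed.smul_const _)]
      refine integral_congr_ae (Eventually.of_forall fun t => ?_)
      simp [smul_sub]
    have h2 : ‖∫ t, ρ.normed volume t • (f (x - t) - f x)‖ₑ ≤ ∫⁻ t, r t * F x t := by
      refine (enorm_integral_le_lintegral_enorm _).trans (lintegral_mono fun t => ?_)
      rw [enorm_smul, Real.enorm_eq_ofReal (ρ.nonneg_normed t)]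
    have hFx : Measurable (F x) := hFm.of_uncurry_left
    have h3 : ∫⁻ t, r t * F x t ≤ (∫⁻ t, r t) ^ (1 / 2 : ℝ) *
        (∫⁻ t, r t * F x t ^ 2) ^ (1 / 2 : ℝ) := by
      have h4 := ENNReal.lintegral_mul_le_Lp_mul_Lq (μ := (volume : Measure E3))
        (p := 2) (q := 2) ⟨by norm_num, by norm_num, by norm_num⟩
        (f := fun t => r t ^ (1 / 2 : ℝ)) (g := fun t => r t ^ (1 / 2 : ℝ) * F x t)
        (hrm.pow_const _).aemeasurable ((hrm.pow_const _).mul hFx).aemeasurable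
      have e1 : ∀ t, (r t ^ (1 / 2 : ℝ)) ^ (2 : ℝ) = r t := fun t => by
        rw [← ENNReal.rpow_mul]; norm_num
      have e2 : ∀ t, r t ^ (1 / 2 : ℝ) * (r t ^ (1 / 2 : ℝ) * F x t) = r t * F x t := fun t => by
        rw [← mul_assoc, ← ENNReal.rpow_add_of_nonneg _ _ (by norm_num) (by norm_num)]
        norm_num
      simp only [Pi.mul_apply, e2, ENNReal.mul_rpow_of_nonneg _ _ (by norm_num : (0 : ℝ) ≤ 2),
        e1, ENNReal.rpow_two] at h4
      exact h4
    rw [hr1, ENNReal.one_rpow, one_mul] at h3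
    rw [h1]
    calc ‖∫ t, ρ.normed volume t • (f (x - t) - f x)‖ₑ ^ 2
        ≤ ((∫⁻ t, r t * F x t ^ 2) ^ (1 / 2 : ℝ)) ^ 2 := by gcongr; exact h2.trans h3
      _ = ∫⁻ t, r t * F x t ^ 2 := by
        rw [← ENNReal.rpow_natCast, ← ENNReal.rpow_mul]; norm_num
  have hsq : ∀ k : E3 → ℂ, eLpNorm k 2 volume ^ 2 = ∫⁻ x, ‖k x‖ₑ ^ 2 := by
    intro k
    have := eLpNorm_nnreal_pow_eq_lintegral (μ := (volume : Measure E3)) (f := k) (p := 2)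
      (by norm_num)
    simpa using this
  have hmain : eLpNorm (fun x => (ρ.normed volume ⋆[ContinuousLinearMap.lsmul ℝ ℝ, volume] f) x -
      f x) 2 volume ^ 2 ≤ ε ^ 2 := by
    rw [hsq]
    calc ∫⁻ x, ‖(ρ.normed volume ⋆[ContinuousLinearMap.lsmul ℝ ℝ, volume] f) x - f x‖ₑ ^ 2
        ≤ ∫⁻ x, ∫⁻ t, r t * F x t ^ 2 := lintegral_mono hpt
      _ = ∫⁻ t, ∫⁻ x, r t * F x t ^ 2 := by
        refine lintegral_lintegral_swap ?_
        exact ((hrm.comp measurable_snd).mul (hFm.pow_const 2)).aemeasurable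
      _ ≤ ∫⁻ t, r t * ε ^ 2 := by
        refine lintegral_mono fun t => ?_
        rw [lintegral_const_mul _ ((hFm.of_uncurry_right (y := t)).pow_const 2)]
        by_cases ht : t ∈ Metric.ball (0 : E3) ρ.rOut
        · gcongr
          rw [← hsq]
          gcongr
          exact hε t ht
        · have : ρ.normed volume t = 0 := by
            rw [← Function.notMem_support, ρ.support_normed_eq]
            exact ht
          simp [hr, this]
      _ = ε ^ 2 := by rw [lintegral_mul_const _ hrm, hr1, one_mul]
  exact (ENNReal.pow_le_pow_left_iff (two_ne_zero)).mp hmain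

theorem exists_eLpNorm_convolution_sub_le {f : E3 → ℂ} (hf : MemLp f 2 volume) {ε : ℝ≥0∞}
    (hε : 0 < ε) :
    ∀ᶠ δ in 𝓝[>] (0 : ℝ), ∀ ρ : ContDiffBump (0 : E3), ρ.rOut = δ →
      eLpNorm (fun x => (ρ.normed volume ⋆[ContinuousLinearMap.lsmul ℝ ℝ, volume] f) x - f x) 2
        volume ≤ ε := by
  obtain ⟨f', hf'm, hff'⟩ := hf.1
  have hf' : MemLp f' 2 volume := hf.ae_eq hff'
  have h1 := (tendsto_eLpNorm_translate_sub hf').eventually_le_const hε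
  obtain ⟨δ₀, hδ₀, h2⟩ := Metric.eventually_nhds_iff_ball.mp h1
  filter_upwards [Ioc_mem_nhdsGT hδ₀] with δ hδ ρ hρ
  have h3 := eLpNorm_convolution_sub_le_aux hf'm hf' ρ (ε := ε) fun t ht =>
    h2 t (Metric.ball_subset_ball (hρ.le.trans hδ.2) ht)
  refine le_trans (le_of_eq (eLpNorm_congr_ae ?_)) h3
  filter_upwards [hff'] with x hx
  rw [hx, convolution_congr _ (EventuallyEq.refl _ _) hff']

end Mollify

/-! ### Test functions are a form core -/

section FormCore

open scoped Convolution

theorem eLpNorm_two_sq (k : E3 → ℂ) : eLpNorm k 2 volume ^ 2 = ∫⁻ x, ‖k x‖ₑ ^ 2 := by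
  have := eLpNorm_nnreal_pow_eq_lintegral (μ := (volume : Measure E3)) (f := k) (p := 2)
    (by norm_num)
  simpa using this

theorem IsTestFn.memLp {φ : E3 → ℂ} (hφ : IsTestFn φ) (p : ℝ≥0∞) : MemLp φ p volume :=
  hφ.1.continuous.memLp_of_hasCompactSupport hφ.2

theorem IsTestFn.pderiv3 {φ : E3 → ℂ} (hφ : IsTestFn φ) (j : Fin 3) : IsTestFn (pderiv3 j φ) := by
  refine ⟨?_, ?_⟩
  · exact (hφ.1.fderiv_right (m := ∞) (by simp)).clm_apply contDiff_const
  · exact (hφ.2.fderiv ℝ).mono' (fun x hx => subset_tsupport _ fun h => hx (by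
      simp [_root_.pderiv3, h]))

theorem IsTestFn.differentiable {φ : E3 → ℂ} (hφ : IsTestFn φ) : Differentiable ℝ φ :=
  hφ.1.differentiable (by simp)

theorem IsTestFn.mul {φ η : E3 → ℂ} (hφ : IsTestFn φ) (hη : IsTestFn η) :
    IsTestFn (fun x => φ x * η x) :=
  ⟨hφ.1.mul hη.1, hφ.2.mul_right⟩

theorem pderiv3_mul {φ η : E3 → ℂ} (hφ : IsTestFn φ) (hη : IsTestFn η) (j : Fin 3) (x : E3) :
    pderiv3 j (fun x => φ x * η x) x = φ x * pderiv3 j η x + η x * pderiv3 j φ x := by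
  rw [pderiv3, fderiv_fun_mul hφ.differentiable.differentiableAt
    hη.differentiable.differentiableAt]
  simp [pderiv3]

theorem IsTestFn.integrable_mul {φ f : E3 → ℂ} (hφ : IsTestFn φ) (hf : MemLp f 2 volume) :
    Integrable (fun x => φ x * f x) volume :=
  (hφ.memLp 2).integrable_mul hf

theorem isTestFn_ofReal_normed_sub (ρ : ContDiffBump (0 : E3)) (x : E3) :
    IsTestFn (fun t => ((ρ.normed volume (x - t) : ℝ) : ℂ)) := by
  refine ⟨?_, ?_⟩
  · exact Complex.ofRealCLM.contDiff.comp (ρ.contDiff_normed.comp (contDiff_const.sub contDiff_id))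
  · have h : HasCompactSupport fun t => ρ.normed volume (x - t) :=
      ρ.hasCompactSupport_normed.comp_homeomorph (Homeomorph.subLeft x)
    exact h.comp_left (g := fun r : ℝ => (r : ℂ)) (by simp)

theorem pderiv3_ofReal_normed_sub (ρ : ContDiffBump (0 : E3)) (x t : E3) (j : Fin 3) :
    pderiv3 j (fun t => ((ρ.normed volume (x - t) : ℝ) : ℂ)) t =
      -((fderiv ℝ (ρ.normed volume) (x - t) (EuclideanSpace.single j 1) : ℝ) : ℂ) := by
  have h1 : HasFDerivAt (ρ.normed volume) (fderiv ℝ (ρ.normed volume) (x - t)) (x - t) :=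
    ((ρ.contDiff_normed (n := 1)).differentiable (by simp)).differentiableAt.hasFDerivAt
  have h2 := (Complex.ofRealCLM.hasFDerivAt (x := ρ.normed volume (x - t))).comp t
    (h1.comp t ((hasFDerivAt_id t).const_sub x))
  have h3 : fderiv ℝ (fun t => ((ρ.normed volume (x - t) : ℝ) : ℂ)) t = _ := h2.fderiv
  rw [pderiv3, h3]
  simp

/-- The derivative falls on the kernel; the weak derivative is then tested against `t ↦ ρ(x - t)`,
whose derivative in `t` supplies the compensating sign. -/
theorem pderiv3_convolution {f g : E3 → ℂ} (hf : MemLp f 2 volume) (j : Fin 3)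
    (hw : ∀ φ, IsTestFn φ → ∫ x, pderiv3 j φ x * f x = -∫ x, φ x * g x)
    (ρ : ContDiffBump (0 : E3)) (x : E3) :
    pderiv3 j (ρ.normed volume ⋆[ContinuousLinearMap.lsmul ℝ ℝ, volume] f) x =
      (ρ.normed volume ⋆[ContinuousLinearMap.lsmul ℝ ℝ, volume] g) x := by
  have hl : LocallyIntegrable f volume := hf.locallyIntegrable (by norm_num)
  have h1 := ρ.hasCompactSupport_normed.hasFDerivAt_convolution_left (μ := volume)
    (ContinuousLinearMap.lsmul ℝ ℝ) (ρ.contDiff_normed (μ := volume) (n := 1)) hl x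
  have h2 : ConvolutionExistsAt (fderiv ℝ (ρ.normed volume)) f x
      ((ContinuousLinearMap.lsmul ℝ ℝ : ℝ →L[ℝ] ℂ →L[ℝ] ℂ).precompL E3) volume :=
    ((ρ.hasCompactSupport_normed (μ := volume)).fderiv ℝ).convolutionExists_left _
      ((ρ.contDiff_normed (n := 1)).continuous_fderiv (by simp)) hl x
  have h3 : pderiv3 j (ρ.normed volume ⋆[ContinuousLinearMap.lsmul ℝ ℝ, volume] f) x =
      ((fun y => fderiv ℝ (ρ.normed volume) y (EuclideanSpace.single j 1))
        ⋆[ContinuousLinearMap.lsmul ℝ ℝ, volume] f) x := by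
    rw [pderiv3, h1.fderiv, convolution_def, convolution_def,
      ContinuousLinearMap.integral_apply h2]
    rfl
  rw [h3, convolution_eq_swap, convolution_eq_swap]
  have h4 := hw _ (isTestFn_ofReal_normed_sub ρ x)
  simp only [pderiv3_ofReal_normed_sub, neg_mul, integral_neg, neg_inj] at h4
  simpa using h4

theorem eLpNorm_coord_mul_sub_le {f φ : E3 → ℂ} {R : ℝ}
    (hs : ∀ x, R < ‖x‖ → φ x = f x) (j : Fin 3) :
    eLpNorm (fun x : E3 => (x j : ℂ) * φ x - (x j : ℂ) * f x) 2 volume ≤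
      ENNReal.ofReal R * eLpNorm (fun x => φ x - f x) 2 volume := by
  refine eLpNorm_le_mul_eLpNorm_of_ae_le_mul (Eventually.of_forall fun x => ?_) 2
  rw [← mul_sub, norm_mul, Complex.norm_real]
  by_cases hx : R < ‖x‖
  · simp [hs x hx]
  · gcongr
    exact (PiLp.norm_apply_le x j).trans (not_lt.mp hx)

theorem exists_testFn_of_hasCompactSupport {f : E3 → ℂ} {g : Fin 3 → E3 → ℂ}
    (hf : MemLp f 2 volume) (hg : ∀ j, MemLp (g j) 2 volume) (hc : HasCompactSupport f)
    (hw : ∀ j φ, IsTestFn φ → ∫ x, pderiv3 j φ x * f x = -∫ x, φ x * g j x)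
    {ε : ℝ≥0∞} (hε : 0 < ε) :
    ∃ φ, IsTestFn φ ∧ eLpNorm (fun x => φ x - f x) 2 volume ≤ ε ∧
      (∀ j, eLpNorm (fun x => pderiv3 j φ x - g j x) 2 volume ≤ ε) ∧
      ∀ j, eLpNorm (fun x : E3 => (x j : ℂ) * φ x - (x j : ℂ) * f x) 2 volume ≤ ε := by
  obtain ⟨R, hR⟩ := hc.isCompact.isBounded.subset_closedBall (0 : E3)
  -- The mollification radius is at most `1`, so `f` and its mollification both vanish beyond `R'`,
  -- and there the weight `x_j` is at most `R'`.
  set R' : ℝ := max R 0 + 1 with hR'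
  have hR'0 : 0 < R' := by positivity
  have hε' : 0 < min ε (ε / ENNReal.ofReal R') :=
    lt_min hε (ENNReal.div_pos hε.ne' ENNReal.ofReal_ne_top)
  have h1 := exists_eLpNorm_convolution_sub_le hf hε'
  have h2 := eventually_all.mpr fun j => exists_eLpNorm_convolution_sub_le (hg j) hε
  obtain ⟨δ, hδ1, hδ2, hδ0, hδ3⟩ :=
    (h1.and (h2.and (Ioc_mem_nhdsGT (zero_lt_one (α := ℝ))))).exists
  let ρ : ContDiffBump (0 : E3) := ⟨δ / 2, δ, by positivity, by linarith⟩
  set φ := ρ.normed volume ⋆[ContinuousLinearMap.lsmul ℝ ℝ, volume] f with hφ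
  have hφt : IsTestFn φ :=
    ⟨ρ.hasCompactSupport_normed.contDiff_convolution_left (n := ⊤) _ ρ.contDiff_normed
      (hf.locallyIntegrable (by norm_num)), ρ.hasCompactSupport_normed.convolution _ hc⟩
  have hd1 := hδ1 ρ rfl
  refine ⟨φ, hφt, hd1.trans (min_le_left _ _), fun j => ?_, fun j => ?_⟩
  · simp only [hφ, pderiv3_convolution hf j (hw j)]
    exact hδ2 j ρ rfl
  · refine (eLpNorm_coord_mul_sub_le (R := R') (fun x hx => ?_) j).trans ?_
    · have hfx : f x = 0 := by
        by_contra h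
        have := hR (subset_tsupport f h)
        rw [mem_closedBall_zero_iff] at this
        have := le_max_left R 0
        linarith
      have hφx : φ x = 0 := by
        by_contra h
        obtain ⟨y, hy, z, hz, rfl⟩ := support_convolution_subset _ h
        have h3 := hR (subset_tsupport f hz)
        rw [mem_closedBall_zero_iff] at h3
        rw [ρ.support_normed_eq, mem_ball_zero_iff] at hy
        have h4 := norm_add_le y z
        have h5 : ‖y‖ < δ := hy
        have := le_max_left R 0
        have h6 : R' < ‖y + z‖ := hx
        linarith
      rw [hfx, hφx]
    · refine (mul_le_mul_right (hd1.trans (min_le_right _ _)) _).trans ?_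
      exact ENNReal.mul_div_le

theorem tendsto_eLpNorm_mul_sub {k : E3 → ℂ} (hk : MemLp k 2 volume) {η : ℕ → E3 → ℂ}
    (hηc : ∀ n, Continuous (η n)) (hη1 : ∀ n x, ‖η n x - 1‖ ≤ 1)
    (hη : ∀ x, Tendsto (fun n => η n x) atTop (𝓝 1)) :
    Tendsto (fun n => eLpNorm (fun x => η n x * k x - k x) 2 volume) atTop (𝓝 0) := by
  have h1 : Tendsto (fun n => ∫⁻ x, ‖η n x * k x - k x‖ₑ ^ 2) atTop (𝓝 (∫⁻ _ : E3, 0)) := by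
    refine tendsto_lintegral_of_dominated_convergence' (fun x => ‖k x‖ₑ ^ 2) (fun n => ?_)
      (fun n => Eventually.of_forall fun x => ?_) ?_ (Eventually.of_forall fun x => ?_)
    · exact ((((hηc n).aestronglyMeasurable.mul hk.1).sub hk.1).enorm).pow_const 2
    · have : η n x * k x - k x = (η n x - 1) * k x := by ring
      simp only [this, enorm_mul]
      gcongr
      refine mul_le_of_le_one_left zero_le ?_
      rw [← ofReal_norm]
      exact ENNReal.ofReal_le_one.mpr (hη1 n x)
    · rw [← eLpNorm_two_sq]
      exact ENNReal.pow_ne_top hk.2.ne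
    · have h2 : Tendsto (fun n => η n x * k x - k x) atTop (𝓝 0) := by
        simpa using ((hη x).mul_const (k x)).sub_const (k x)
      have h3 := (ENNReal.continuous_pow 2).continuousAt.tendsto.comp h2.enorm
      simpa [Function.comp_def] using h3
  simp only [lintegral_zero, ← eLpNorm_two_sq] at h1
  have h3 := (ENNReal.continuous_rpow_const (y := 1 / 2)).continuousAt.tendsto.comp h1
  simp only [Function.comp_def, ENNReal.zero_rpow_of_pos (by norm_num : (0 : ℝ) < 1 / 2)] at h3
  refine h3.congr fun n => ?_
  rw [← ENNReal.rpow_natCast, ← ENNReal.rpow_mul]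
  norm_num

/-- Smooth cutoff functions `x ↦ χ(x/(n+1))`. -/
noncomputable def cutoff3 (n : ℕ) (x : E3) : ℂ :=
  (((⟨1, 2, one_pos, one_lt_two⟩ : ContDiffBump (0 : E3)) (((n : ℝ) + 1)⁻¹ • x) : ℝ) : ℂ)

theorem isTestFn_cutoff3 (n : ℕ) : IsTestFn (cutoff3 n) := by
  refine ⟨?_, ?_⟩
  · exact Complex.ofRealCLM.contDiff.comp
      ((ContDiffBump.contDiff _).comp (contDiff_const_smul _))
  · have h : HasCompactSupport fun x : E3 =>
        (⟨1, 2, one_pos, one_lt_two⟩ : ContDiffBump (0 : E3)) (((n : ℝ) + 1)⁻¹ • x) :=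
      (ContDiffBump.hasCompactSupport _).comp_smul (by positivity)
    exact h.comp_left (g := fun r : ℝ => (r : ℂ)) (by simp)

theorem norm_cutoff3_sub_one_le (n : ℕ) (x : E3) : ‖cutoff3 n x - 1‖ ≤ 1 := by
  rw [cutoff3, ← Complex.ofReal_one, ← Complex.ofReal_sub, Complex.norm_real, Real.norm_eq_abs,
    abs_le]
  constructor
  · linarith [ContDiffBump.nonneg (⟨1, 2, one_pos, one_lt_two⟩ : ContDiffBump (0 : E3))
      (x := ((n : ℝ) + 1)⁻¹ • x)]
  · linarith [ContDiffBump.le_one (⟨1, 2, one_pos, one_lt_two⟩ : ContDiffBump (0 : E3))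
      (x := ((n : ℝ) + 1)⁻¹ • x)]

theorem tendsto_cutoff3 (x : E3) : Tendsto (fun n => cutoff3 n x) atTop (𝓝 1) := by
  refine tendsto_const_nhds.congr' ?_
  filter_upwards [eventually_ge_atTop ⌈‖x‖⌉₊] with n hn
  have h1 : ‖x‖ ≤ n := (Nat.le_ceil _).trans (by exact_mod_cast hn)
  rw [cutoff3, ContDiffBump.one_of_mem_closedBall, Complex.ofReal_one]
  rw [mem_closedBall_zero_iff, norm_smul, norm_inv, Real.norm_of_nonneg (by positivity),
    inv_mul_le_iff₀ (by positivity)]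
  change ‖x‖ ≤ ((n : ℝ) + 1) * 1
  linarith

theorem exists_norm_pderiv3_cutoff3_le :
    ∃ C : ℝ, 0 ≤ C ∧ ∀ n j x, ‖pderiv3 j (cutoff3 n) x‖ ≤ C * ((n : ℝ) + 1)⁻¹ := by
  have h0 := isTestFn_cutoff3 0
  obtain ⟨C, hC⟩ := (h0.2.fderiv ℝ).exists_bound_of_continuous
    (h0.1.continuous_fderiv (by simp))
  refine ⟨C, (norm_nonneg _).trans (hC 0), fun n j x => ?_⟩
  have h1 : cutoff3 n = fun x => cutoff3 0 (((n : ℝ) + 1)⁻¹ • x) := by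
    funext x; simp [cutoff3]
  rw [pderiv3, h1, fderiv_comp_smul, smul_apply, norm_smul, norm_inv,
    Real.norm_of_nonneg (by positivity), mul_comm]
  gcongr
  refine (ContinuousLinearMap.le_opNorm _ _).trans ?_
  simpa using hC _

theorem weakDeriv_mul {f g η : E3 → ℂ} (hf : MemLp f 2 volume) (hg : MemLp g 2 volume)
    (hη : IsTestFn η) {j : Fin 3}
    (hw : ∀ φ, IsTestFn φ → ∫ x, pderiv3 j φ x * f x = -∫ x, φ x * g x) {φ : E3 → ℂ}
    (hφ : IsTestFn φ) :
    ∫ x, pderiv3 j φ x * (η x * f x) = -∫ x, φ x * (η x * g x + pderiv3 j η x * f x) := by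
  have h1 := hw _ (hφ.mul hη)
  have i1 := (hφ.mul (hη.pderiv3 j)).integrable_mul hf
  have i2 := (hη.mul (hφ.pderiv3 j)).integrable_mul hf
  have i3 := (hφ.mul hη).integrable_mul hg
  have e1 : ∫ x, pderiv3 j (fun x => φ x * η x) x * f x =
      (∫ x, φ x * pderiv3 j η x * f x) + ∫ x, η x * pderiv3 j φ x * f x := by
    rw [← integral_add i1 i2]
    refine integral_congr_ae (Eventually.of_forall fun x => ?_)
    simp only [pderiv3_mul hφ hη]
    ring
  have e2 : ∫ x, φ x * (η x * g x + pderiv3 j η x * f x) =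
      (∫ x, φ x * η x * g x) + ∫ x, φ x * pderiv3 j η x * f x := by
    rw [← integral_add i3 i1]
    refine integral_congr_ae (Eventually.of_forall fun x => ?_)
    ring
  have e3 : ∫ x, pderiv3 j φ x * (η x * f x) = ∫ x, η x * pderiv3 j φ x * f x :=
    integral_congr_ae (Eventually.of_forall fun x => by ring)
  rw [e3, e2]
  rw [e1] at h1
  linear_combination h1

/-- Every function in `{ψ | ∇ψ ∈ L², xψ ∈ L²}` can be approximated by test functions, in the
form norm of the oscillator. -/
theorem exists_testFn_form_approx {f : E3 → ℂ} {g : Fin 3 → E3 → ℂ}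
    (hf : MemLp f 2 volume) (hg : ∀ j, MemLp (g j) 2 volume)
    (hx : ∀ j, MemLp (fun x : E3 => (x j : ℂ) * f x) 2 volume)
    (hw : ∀ j φ, IsTestFn φ → ∫ x, pderiv3 j φ x * f x = -∫ x, φ x * g j x)
    {ε : ℝ≥0∞} (hε : 0 < ε) :
    ∃ φ, IsTestFn φ ∧ eLpNorm (fun x => φ x - f x) 2 volume ≤ ε ∧
      (∀ j, eLpNorm (fun x => pderiv3 j φ x - g j x) 2 volume ≤ ε) ∧
      ∀ j, eLpNorm (fun x : E3 => (x j : ℂ) * φ x - (x j : ℂ) * f x) 2 volume ≤ ε := by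
  -- Three errors: the cutoff, the derivative of the cutoff (only for `∂_j`), and the mollification.
  have hε3 : 0 < ε / 3 := ENNReal.div_pos hε.ne' (by norm_num)
  have key : ∀ {k : E3 → ℂ}, MemLp k 2 volume → ∀ᶠ n in atTop,
      eLpNorm (fun x => cutoff3 n x * k x - k x) 2 volume ≤ ε / 3 := fun hk =>
    (tendsto_eLpNorm_mul_sub hk (fun n => (isTestFn_cutoff3 n).1.continuous)
      norm_cutoff3_sub_one_le tendsto_cutoff3).eventually_le_const hε3
  obtain ⟨C, hC0, hC⟩ := exists_norm_pderiv3_cutoff3_le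
  have hd : ∀ᶠ n : ℕ in atTop, ENNReal.ofReal (C * ((n : ℝ) + 1)⁻¹) * eLpNorm f 2 volume ≤ ε / 3 := by
    have h1 : Tendsto (fun n : ℕ => C * ((n : ℝ) + 1)⁻¹) atTop (𝓝 0) := by
      simpa using (tendsto_one_div_add_atTop_nhds_zero_nat (𝕜 := ℝ)).const_mul C
    have h2 := ENNReal.Tendsto.mul_const (b := eLpNorm f 2 volume)
      (ENNReal.tendsto_ofReal h1) (Or.inr hf.2.ne)
    rw [ENNReal.ofReal_zero, zero_mul] at h2
    exact h2.eventually_le_const hε3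
  obtain ⟨n, h1, h2, h3, h4⟩ := ((key hf).and ((eventually_all.mpr fun j => key (hg j)).and
    ((eventually_all.mpr fun j => key (hx j)).and hd))).exists
  have hη := isTestFn_cutoff3 n
  have hmul : ∀ {η k : E3 → ℂ}, IsTestFn η → MemLp k 2 volume →
      MemLp (fun x => η x * k x) 2 volume := fun hη hk => hk.mul (hη.memLp ∞)
  have hg' : ∀ j, MemLp (fun x => cutoff3 n x * g j x + pderiv3 j (cutoff3 n) x * f x) 2 volume :=
    fun j => (hmul hη (hg j)).add (hmul (hη.pderiv3 j) hf)
  obtain ⟨φ, hφ, a1, a2, a3⟩ := exists_testFn_of_hasCompactSupport (hmul hη hf) hg'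
    hη.2.mul_right (fun j φ hφ => weakDeriv_mul hf (hg j) hη (hw j) hφ) hε3
  have e3 : ε / 3 + (ε / 3 + ε / 3) = ε := by rw [← add_assoc, ENNReal.add_thirds]
  have tri : ∀ {p q r : E3 → ℂ}, AEStronglyMeasurable p volume → AEStronglyMeasurable q volume →
      AEStronglyMeasurable r volume → eLpNorm (fun x => p x - r x) 2 volume ≤
      eLpNorm (fun x => p x - q x) 2 volume + eLpNorm (fun x => q x - r x) 2 volume := by
    intro p q r hp hq hr
    have := eLpNorm_add_le (p := 2) (hp.sub hq) (hq.sub hr) (by norm_num)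
    simpa only [Pi.sub_def, Pi.add_def, sub_add_sub_cancel] using this
  have hcoord : ∀ j : Fin 3, Continuous fun x : E3 => (x j : ℂ) := fun j => by fun_prop
  refine ⟨φ, hφ, ?_, fun j => ?_, fun j => ?_⟩
  · refine (tri hφ.1.continuous.aestronglyMeasurable (hmul hη hf).1 hf.1).trans ?_
    rw [← e3]
    exact add_le_add a1 (h1.trans le_self_add)
  · refine (tri (hφ.pderiv3 j).1.continuous.aestronglyMeasurable (hg' j).1 (hg j).1).trans ?_
    rw [← e3]
    refine add_le_add (a2 j) ?_
    have h5 : (fun x => cutoff3 n x * g j x + pderiv3 j (cutoff3 n) x * f x - g j x) =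
        (fun x => cutoff3 n x * g j x - g j x) + fun x => pderiv3 j (cutoff3 n) x * f x := by
      funext x; simp only [Pi.add_apply]; ring
    rw [h5]
    refine (eLpNorm_add_le ((hmul hη (hg j)).1.sub (hg j).1) (hmul (hη.pderiv3 j) hf).1
      (by norm_num)).trans (add_le_add (h2 j) (le_trans ?_ h4))
    refine eLpNorm_le_mul_eLpNorm_of_ae_le_mul (Eventually.of_forall fun x => ?_) 2
    rw [norm_mul]
    gcongr
    exact hC n j x
  · have hm : AEStronglyMeasurable (fun x : E3 => (x j : ℂ) * (cutoff3 n x * f x)) volume :=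
      (hcoord j).aestronglyMeasurable.mul (hmul hη hf).1
    refine (tri ((hcoord j).mul hφ.1.continuous).aestronglyMeasurable hm (hx j).1).trans ?_
    rw [← e3]
    refine add_le_add (a3 j) (le_trans (le_of_eq ?_) ((h3 j).trans le_self_add))
    congr 1
    funext x
    ring

end FormCore

/-! ### The form graph of the oscillator Hamiltonian -/

/-- Multiplication by an essentially bounded function (zero if `f` is not in `L^∞`). -/
noncomputable def mulInf (f : E3 → ℂ) : WaveSpace →L[ℂ] WaveSpace :=
  open Classical in
  if h : MemLp f ∞ (volume : Measure E3) then
    (ContinuousLinearMap.mul ℂ ℂ).holderL (volume : Measure E3) ∞ 2 2 (h.toLp f) else 0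

theorem mulInf_apply_ae {f : E3 → ℂ} (hf : MemLp f ∞ volume) (ψ : WaveSpace) :
    mulInf f ψ =ᵐ[volume] fun x => f x * ψ x := by
  have h := (ContinuousLinearMap.mul ℂ ℂ).coeFn_holder (r := 2) (hf.toLp f) ψ
  rw [mulInf, dif_pos hf]
  filter_upwards [h, hf.coeFn_toLp] with x hx h1
  simp only [ContinuousLinearMap.mul_apply'] at hx
  rw [h1] at hx
  exact hx

theorem norm_mulInf_apply_le {f : E3 → ℂ} (hf : MemLp f ∞ volume) {C : ℝ}
    (hC : ∀ᵐ x, ‖f x‖ ≤ C) (ψ : WaveSpace) : ‖mulInf f ψ‖ ≤ C * ‖ψ‖ := by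
  refine Lp.norm_le_mul_norm_of_ae_le_mul ?_
  filter_upwards [mulInf_apply_ae hf ψ, hC] with x hx h1
  rw [hx, norm_mul]
  gcongr

theorem inner_waveSpace (ψ χ : WaveSpace) : inner ℂ ψ χ = ∫ x, conj (ψ x) * χ x := by
  rw [L2.inner_def]
  simp only [RCLike.inner_apply, mul_comm]

theorem IsTestFn.add {φ η : E3 → ℂ} (hφ : IsTestFn φ) (hη : IsTestFn η) : IsTestFn (φ + η) :=
  ⟨hφ.1.add hη.1, hφ.2.add hη.2⟩

theorem IsTestFn.smul {φ : E3 → ℂ} (hφ : IsTestFn φ) (c : ℂ) : IsTestFn (c • φ) :=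
  ⟨contDiff_const.smul hφ.1, hφ.2.smul_left (f := fun _ => c)⟩

theorem isTestFn_zero : IsTestFn (0 : E3 → ℂ) := ⟨contDiff_const, HasCompactSupport.zero⟩

theorem IsTestFn.conj {φ : E3 → ℂ} (hφ : IsTestFn φ) : IsTestFn (fun x => conj (φ x)) :=
  ⟨Complex.conjCLE.contDiff.comp hφ.1, hφ.2.comp_left (g := fun z : ℂ => conj z) (by simp)⟩

theorem IsTestFn.coord_mul {φ : E3 → ℂ} (hφ : IsTestFn φ) (j : Fin 3) :
    IsTestFn (fun x => (x j : ℂ) * φ x) :=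
  ⟨(Complex.ofRealCLM.contDiff.comp (EuclideanSpace.proj (𝕜 := ℝ) j).contDiff).mul hφ.1,
    hφ.2.mul_left⟩

theorem pderiv3_conj {φ : E3 → ℂ} (hφ : IsTestFn φ) (j : Fin 3) (x : E3) :
    pderiv3 j (fun x => conj (φ x)) x = conj (pderiv3 j φ x) := by
  have h1 := (Complex.conjCLE.hasFDerivAt (x := φ x)).comp x
    (hφ.differentiable.differentiableAt.hasFDerivAt (x := x))
  have h2 : fderiv ℝ (fun x => conj (φ x)) x = _ := h1.fderiv
  rw [pderiv3, h2]
  simp [pderiv3]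

/-- A test function as an element of `L²`. -/
noncomputable def testLp {φ : E3 → ℂ} (hφ : IsTestFn φ) : WaveSpace := (hφ.memLp 2).toLp φ

theorem coeFn_testLp {φ : E3 → ℂ} (hφ : IsTestFn φ) : testLp hφ =ᵐ[volume] φ :=
  (hφ.memLp 2).coeFn_toLp

theorem testLp_add {φ η : E3 → ℂ} (hφ : IsTestFn φ) (hη : IsTestFn η) :
    testLp (hφ.add hη) = testLp hφ + testLp hη :=
  MemLp.toLp_add _ _

theorem testLp_smul {φ : E3 → ℂ} (hφ : IsTestFn φ) (c : ℂ) :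
    testLp (hφ.smul c) = c • testLp hφ :=
  MemLp.toLp_const_smul _ _

theorem testLp_congr {φ η : E3 → ℂ} (hφ : IsTestFn φ) (hη : IsTestFn η) (h : φ = η) :
    testLp hφ = testLp hη := by
  subst h; rfl

theorem inner_testLp {φ : E3 → ℂ} (hφ : IsTestFn φ) (χ : WaveSpace) :
    inner ℂ (testLp hφ) χ = ∫ x, conj (φ x) * χ x := by
  rw [inner_waveSpace]
  refine integral_congr_ae ?_
  filter_upwards [coeFn_testLp hφ] with x hx
  rw [hx]

theorem eq_zero_of_inner_testLp {χ : WaveSpace}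
    (h : ∀ φ, ∀ hφ : IsTestFn φ, inner ℂ (testLp hφ) χ = 0) : χ = 0 := by
  refine (Lp.eq_zero_iff_ae_eq_zero).mpr ?_
  refine ae_eq_zero_of_integral_contDiff_smul_eq_zero
    ((Lp.memLp χ).locallyIntegrable (by norm_num)) fun g hg hgc => ?_
  have hφ : IsTestFn (fun x => (g x : ℂ)) :=
    ⟨Complex.ofRealCLM.contDiff.comp hg, hgc.comp_left (g := fun r : ℝ => (r : ℂ)) (by simp)⟩
  have h1 := h _ hφ
  rw [inner_testLp] at h1
  simpa using h1

theorem hasWeakPDeriv_iff {j : Fin 3} {ψ g : WaveSpace} :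
    HasWeakPDeriv j ψ g ↔ ∀ φ, ∀ hφ : IsTestFn φ,
      inner ℂ (testLp (hφ.pderiv3 j)) ψ = -inner ℂ (testLp hφ) g := by
  constructor
  · intro h φ hφ
    have h1 := h _ hφ.conj
    simp only [pderiv3_conj hφ] at h1
    rw [inner_testLp, inner_testLp, h1]
  · intro h φ hφ
    have h1 := h _ hφ.conj
    rw [inner_testLp, inner_testLp] at h1
    simpa only [pderiv3_conj hφ, Complex.conj_conj] using h1

/-- The index set of the components `ψ`, `π_j ψ`, `x_j ψ`. -/
abbrev FormIdx : Type := Option (Fin 3 ⊕ Fin 3)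

/-- The Hilbert space of the vectors `(ψ, π ψ, x ψ)`. -/
abbrev FormSpace : Type := PiLp 2 (fun _ : FormIdx => WaveSpace)

theorem inner_formSpace (m k : FormSpace) :
    inner ℂ m k = inner ℂ (m none) (k none) +
      ((∑ j, inner ℂ (m (some (Sum.inl j))) (k (some (Sum.inl j)))) +
        ∑ j, inner ℂ (m (some (Sum.inr j))) (k (some (Sum.inr j)))) := by
  rw [PiLp.inner_apply, Fintype.sum_option, Fintype.sum_sum_type]

/-- The vector `(ψ, p - bψ, y)`. -/
noncomputable def formVec (b : E3 → E3) (ψ : WaveSpace) (p y : Fin 3 → WaveSpace) : FormSpace :=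
  WithLp.toLp 2 fun i => match i with
    | none => ψ
    | some (Sum.inl j) => p j - mulInf (fun x => (b x j : ℂ)) ψ
    | some (Sum.inr j) => y j

/-- The vector `(φ, π φ, x φ)` of a test function. -/
noncomputable def testVec (b : E3 → E3) {φ : E3 → ℂ} (hφ : IsTestFn φ) : FormSpace :=
  formVec b (testLp hφ) (fun j => -Complex.I • testLp (hφ.pderiv3 j))
    (fun j => testLp (hφ.coord_mul j))

theorem formVec_add (b : E3 → E3) (ψ ψ' : WaveSpace) (p y p' y' : Fin 3 → WaveSpace) :
    formVec b (ψ + ψ') (p + p') (y + y') = formVec b ψ p y + formVec b ψ' p' y' := by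
  refine PiLp.ext fun i => ?_
  rcases i with _ | j | j
  · rfl
  · simp only [formVec, PiLp.add_apply, map_add, Pi.add_apply]; abel
  · rfl

theorem formVec_smul (b : E3 → E3) (c : ℂ) (ψ : WaveSpace) (p y : Fin 3 → WaveSpace) :
    formVec b (c • ψ) (c • p) (c • y) = c • formVec b ψ p y := by
  refine PiLp.ext fun i => ?_
  rcases i with _ | j | j
  · rfl
  · simp only [formVec, PiLp.smul_apply, map_smul, Pi.smul_apply, smul_sub]
  · rfl

/-- The graph of `φ ↦ (π φ, x φ)` on test functions. -/
noncomputable def testGraph (b : E3 → E3) : Submodule ℂ FormSpace where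
  carrier := {k | ∃ φ, ∃ hφ : IsTestFn φ, testVec b hφ = k}
  zero_mem' := by
    refine ⟨0, isTestFn_zero, ?_⟩
    have h0 : ∀ {η : E3 → ℂ} (hη : IsTestFn η), η = 0 → testLp hη = 0 := by
      intro η hη h
      subst h
      exact MemLp.toLp_zero _
    have e1 : ∀ j, testLp (isTestFn_zero.pderiv3 j) = 0 := fun j => h0 _ (by
      funext x; simp [pderiv3])
    have e2 : ∀ j, testLp (isTestFn_zero.coord_mul j) = 0 := fun j => h0 _ (by
      funext x; simp)
    refine PiLp.ext fun i => ?_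
    rcases i with _ | j | j
    · exact h0 isTestFn_zero rfl
    · simp [testVec, formVec, h0 isTestFn_zero rfl, e1]
    · exact e2 j
  add_mem' := by
    rintro _ _ ⟨φ, hφ, rfl⟩ ⟨η, hη, rfl⟩
    refine ⟨φ + η, hφ.add hη, ?_⟩
    rw [testVec, testVec, testVec, ← formVec_add, testLp_add hφ hη]
    congr 1
    · funext j
      rw [Pi.add_apply, ← smul_add, ← testLp_add]
      congr 1
      refine testLp_congr _ _ ?_
      funext x
      simp [pderiv3, fderiv_add hφ.differentiable.differentiableAt
        hη.differentiable.differentiableAt]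
    · funext j
      rw [Pi.add_apply, ← testLp_add]
      refine testLp_congr _ _ ?_
      funext x
      simp [mul_add]
  smul_mem' := by
    rintro c _ ⟨φ, hφ, rfl⟩
    refine ⟨c • φ, hφ.smul c, ?_⟩
    rw [testVec, testVec, ← formVec_smul, testLp_smul hφ c]
    congr 1
    · funext j
      rw [Pi.smul_apply, smul_comm c (-Complex.I)]
      congr 1
      rw [← testLp_smul]
      refine testLp_congr _ _ ?_
      funext x
      simp [pderiv3, fderiv_const_smul hφ.differentiable.differentiableAt]
    · funext j
      rw [Pi.smul_apply, ← testLp_smul]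
      refine testLp_congr _ _ ?_
      funext x
      simp only [Pi.smul_apply, smul_eq_mul]
      ring

/-- The graph of `ψ ↦ (π ψ, x ψ)` on the form domain. -/
noncomputable def formGraph (b : E3 → E3) : Submodule ℂ FormSpace :=
  (testGraph b).topologicalClosure

noncomputable instance (b : E3 → E3) : CompleteSpace (formGraph b) :=
  Submodule.topologicalClosure.completeSpace _

theorem testVec_mem_formGraph (b : E3 → E3) {φ : E3 → ℂ} (hφ : IsTestFn φ) :
    testVec b hφ ∈ formGraph b :=
  Submodule.le_topologicalClosure _ ⟨φ, hφ, rfl⟩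

theorem formGraph_induction {b : E3 → E3} {p : FormSpace → Prop} (hp : IsClosed {k | p k})
    (h : ∀ φ, ∀ hφ : IsTestFn φ, p (testVec b hφ)) {k : FormSpace} (hk : k ∈ formGraph b) :
    p k :=
  closure_minimal (s := (testGraph b : Set FormSpace)) (t := {k | p k})
    (by rintro _ ⟨φ, hφ, rfl⟩; exact h φ hφ) hp hk

theorem formGraph_eqOn {b : E3 → E3} {E : Type*} [TopologicalSpace E] [T2Space E]
    {f g : FormSpace → E} (hf : Continuous f) (hg : Continuous g)
    (h : ∀ φ, ∀ hφ : IsTestFn φ, f (testVec b hφ) = g (testVec b hφ)) {k : FormSpace}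
    (hk : k ∈ formGraph b) : f k = g k :=
  formGraph_induction (p := fun k => f k = g k) (isClosed_eq hf hg) h hk

theorem integral_pderiv3_mul {φ η : E3 → ℂ} (hφ : IsTestFn φ) (hη : IsTestFn η) (j : Fin 3) :
    ∫ x, pderiv3 j φ x * η x = -∫ x, φ x * pderiv3 j η x := by
  have h := integral_mul_fderiv_eq_neg_fderiv_mul_of_integrable (μ := (volume : Measure E3))
    (𝕜 := ℂ) (f := φ) (g := η) (v := EuclideanSpace.single j 1)
    ((hφ.pderiv3 j).integrable_mul (hη.memLp 2))
    (hφ.integrable_mul ((hη.pderiv3 j).memLp 2)) (hφ.integrable_mul (hη.memLp 2))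
    (fun x _ => hφ.differentiable x) (fun x _ => hη.differentiable x)
  rw [eq_comm, neg_eq_iff_eq_neg]
  exact h

theorem inner_testLp_testLp {φ η : E3 → ℂ} (hφ : IsTestFn φ) (hη : IsTestFn η) :
    inner ℂ (testLp hφ) (testLp hη) = ∫ x, conj (φ x) * η x := by
  rw [inner_testLp]
  refine integral_congr_ae ?_
  filter_upwards [coeFn_testLp hη] with x hx
  rw [hx]

theorem continuous_formSpace_apply (i : FormIdx) : Continuous fun k : FormSpace => k i :=
  (PiLp.proj 2 (fun _ : FormIdx => WaveSpace) (𝕜 := ℂ) i).continuous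

theorem memLp_coord {b : E3 → E3} (hb : MemLp b ∞ volume) (j : Fin 3) :
    MemLp (fun x => (b x j : ℂ)) ∞ volume := by
  refine hb.mono ?_ (Eventually.of_forall fun x => ?_)
  · have hc : Continuous fun y : E3 => (y j : ℂ) := by fun_prop
    exact hc.comp_aestronglyMeasurable hb.1
  · rw [Complex.norm_real]
    exact PiLp.norm_apply_le _ j

/-- Characterization of the form domain: the weak and the strong closure agree. -/
theorem mem_formGraph_iff {b : E3 → E3} {k : FormSpace} :
    k ∈ formGraph b ↔ ∃ g : Fin 3 → WaveSpace, (∀ j, HasWeakPDeriv j (k none) (g j)) ∧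
      (∀ j, k (some (Sum.inl j)) = -Complex.I • g j - mulInf (fun x => (b x j : ℂ)) (k none)) ∧
      ∀ j, k (some (Sum.inr j)) =ᵐ[volume] fun x => (x j : ℂ) * k none x := by
  constructor
  · intro hk
    refine ⟨fun j => Complex.I • (k (some (Sum.inl j)) + mulInf (fun x => (b x j : ℂ)) (k none)),
      fun j => ?_, fun j => ?_, fun j => ?_⟩
    · rw [hasWeakPDeriv_iff]
      intro φ hφ
      -- The weak derivative identity is closed in the graph norm, and on test vectors it is
      -- integration by parts.
      refine formGraph_eqOn (b := b)
        (f := fun k : FormSpace => inner ℂ (testLp (hφ.pderiv3 j)) (k none))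
        (g := fun k : FormSpace => -inner ℂ (testLp hφ) (Complex.I • (k (some (Sum.inl j)) +
          mulInf (fun x => (b x j : ℂ)) (k none)))) ?_ ?_ (fun η hη => ?_) hk
      · exact continuous_const.inner (continuous_formSpace_apply _)
      · have hc : Continuous fun k : FormSpace => Complex.I • (k (some (Sum.inl j)) +
            mulInf (fun x => (b x j : ℂ)) (k none)) :=
          ((continuous_formSpace_apply (some (Sum.inl j))).add
            ((mulInf _).continuous.comp (continuous_formSpace_apply none))).const_smul Complex.I
        exact (continuous_const.inner (𝕜 := ℂ) hc).neg
      · have h1 := integral_pderiv3_mul hφ.conj hη j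
        simp only [pderiv3_conj hφ] at h1
        simp only [testVec, formVec, sub_add_cancel, smul_smul]
        rw [inner_testLp_testLp, h1, mul_neg, Complex.I_mul_I, neg_neg, one_smul,
          inner_testLp_testLp]
    · rw [smul_smul]
      simp
    · have h1 : ∀ φ, ∀ hφ : IsTestFn φ, inner ℂ (testLp hφ) (k (some (Sum.inr j))) =
          inner ℂ (testLp (hφ.coord_mul j)) (k none) := by
        intro φ hφ
        refine formGraph_eqOn (b := b)
          (f := fun k : FormSpace => inner ℂ (testLp hφ) (k (some (Sum.inr j))))
          (g := fun k : FormSpace => inner ℂ (testLp (hφ.coord_mul j)) (k none)) ?_ ?_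
          (fun η hη => ?_) hk
        · exact continuous_const.inner (continuous_formSpace_apply _)
        · exact continuous_const.inner (continuous_formSpace_apply _)
        · simp only [testVec, formVec]
          rw [inner_testLp_testLp, inner_testLp_testLp]
          refine integral_congr_ae (Eventually.of_forall fun x => ?_)
          simp only [map_mul, Complex.conj_ofReal]
          ring
      have hl : LocallyIntegrable (fun x : E3 => (x j : ℂ) * k none x) volume := by
        have hc : Continuous fun y : E3 => (y j : ℂ) := by fun_prop
        exact ((Lp.memLp (k none)).locallyIntegrable (by norm_num)).continuous_mul hc
      have hl2 : LocallyIntegrable (k (some (Sum.inr j))) volume :=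
        (Lp.memLp _).locallyIntegrable (by norm_num)
      have h2 : ∀ᵐ x, (k (some (Sum.inr j)) : E3 → ℂ) x - (x j : ℂ) * k none x = 0 := by
        refine ae_eq_zero_of_integral_contDiff_smul_eq_zero (hl2.sub hl) fun g hg hgc => ?_
        have hφ : IsTestFn (fun x => (g x : ℂ)) :=
          ⟨Complex.ofRealCLM.contDiff.comp hg,
            hgc.comp_left (g := fun r : ℝ => (r : ℂ)) (by simp)⟩
        have h3 := h1 _ hφ
        rw [inner_testLp, inner_testLp] at h3
        simp only [map_mul, Complex.conj_ofReal] at h3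
        have i1 := hφ.integrable_mul (Lp.memLp (k (some (Sum.inr j))))
        have i2 := (hφ.coord_mul j).integrable_mul (Lp.memLp (k none))
        rw [← sub_eq_zero, ← integral_sub i1 i2] at h3
        rw [← h3]
        refine integral_congr_ae (Eventually.of_forall fun x => ?_)
        simp only [Complex.real_smul]
        ring
      filter_upwards [h2] with x hx
      exact sub_eq_zero.mp hx
  · rintro ⟨g, hg, hinl, hinr⟩
    have hx : ∀ j, MemLp (fun x : E3 => (x j : ℂ) * k none x) 2 volume := fun j =>
      (Lp.memLp (k (some (Sum.inr j)))).ae_eq (hinr j)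
    have hε : ∀ n : ℕ, (0 : ℝ≥0∞) < ((n : ℝ≥0∞) + 1)⁻¹ := fun n =>
      ENNReal.inv_pos.mpr (by finiteness)
    -- Conversely, test functions are dense in the maximal form domain; the bounded potential does
    -- not disturb the approximation.
    choose φ hφ h1 h2 h3 using fun n : ℕ => exists_testFn_form_approx (Lp.memLp (k none))
      (fun j => Lp.memLp (g j)) hx (fun j φ hφ => hg j φ hφ) (hε n)
    have hε0 : Tendsto (fun n : ℕ => ((n : ℝ≥0∞) + 1)⁻¹) atTop (𝓝 0) := by
      have := (tendsto_add_atTop_iff_nat 1).mpr ENNReal.tendsto_inv_nat_nhds_zero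
      simpa using this
    have hlim : ∀ {η : ℕ → E3 → ℂ} (hη : ∀ n, IsTestFn (η n)) (χ : WaveSpace),
        (∀ n, eLpNorm (fun x => η n x - χ x) 2 volume ≤ ((n : ℝ≥0∞) + 1)⁻¹) →
        Tendsto (fun n => testLp (hη n)) atTop (𝓝 χ) := by
      intro η hη χ h
      rw [Lp.tendsto_Lp_iff_tendsto_eLpNorm']
      refine tendsto_of_tendsto_of_tendsto_of_le_of_le tendsto_const_nhds hε0
        (fun _ => zero_le) (fun n => le_trans (le_of_eq (eLpNorm_congr_ae ?_)) (h n))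
      filter_upwards [coeFn_testLp (hη n)] with x hx
      simp [hx]
    have t1 := hlim hφ (k none) h1
    have t2 := fun j => hlim (fun n => (hφ n).pderiv3 j) (g j) (fun n => h2 n j)
    have t3 : ∀ j, Tendsto (fun n => testLp ((hφ n).coord_mul j)) atTop
        (𝓝 (k (some (Sum.inr j)))) := fun j => hlim _ _ fun n => by
      refine le_trans (le_of_eq (eLpNorm_congr_ae ?_)) (h3 n j)
      filter_upwards [hinr j] with x hx
      rw [hx]
    have ht : Tendsto (fun n => testVec b (hφ n)) atTop (𝓝 k) := by
      refine ((PiLp.continuous_toLp 2 (fun _ : FormIdx => WaveSpace)).tendsto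
        (WithLp.ofLp k)).comp (tendsto_pi_nhds.mpr fun i => ?_)
      rcases i with _ | j | j
      · exact t1
      · change Tendsto _ _ (𝓝 (k (some (Sum.inl j))))
        rw [hinl j]
        exact ((t2 j).const_smul _).sub (((mulInf _).continuous.tendsto _).comp t1)
      · exact t3 j
    exact mem_closure_of_tendsto ht (Eventually.of_forall fun n => ⟨_, hφ n, rfl⟩)

/-! ### The inverse of `2h + 1` -/

/-- `χ ↦ (ψ, π ψ, x ψ)` with `ψ = (2h + 1)⁻¹ χ`. -/
noncomputable def formMap (b : E3 → E3) : WaveSpace →L[ℂ] FormSpace :=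
  (formGraph b).starProjection ∘L
    ContinuousLinearMap.adjoint (PiLp.proj 2 (fun _ : FormIdx => WaveSpace) none)

/-- The operator `(2h + 1)⁻¹`. -/
noncomputable def formInv (b : E3 → E3) : WaveSpace →L[ℂ] WaveSpace :=
  PiLp.proj 2 (fun _ : FormIdx => WaveSpace) none ∘L formMap b

theorem formInv_apply (b : E3 → E3) (χ : WaveSpace) : formInv b χ = formMap b χ none := rfl

theorem formMap_mem (b : E3 → E3) (χ : WaveSpace) : formMap b χ ∈ formGraph b :=
  Submodule.starProjection_apply_mem _ _

/-- On the graph the inner product of `FormSpace` is the form of `2h + 1`. Hence the projection of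
`(χ, 0, 0)` onto the graph is the weak solution of `(2h + 1) ψ = χ`. -/
theorem inner_formMap_right {b : E3 → E3} {k : FormSpace} (hk : k ∈ formGraph b)
    (χ : WaveSpace) : inner ℂ k (formMap b χ) = inner ℂ (k none) χ := by
  rw [formMap, ContinuousLinearMap.comp_apply, ← Submodule.inner_starProjection_left_eq_right,
    Submodule.starProjection_eq_self_iff.mpr hk, ContinuousLinearMap.adjoint_inner_right]
  rfl

theorem formMap_eq {b : E3 → E3} {χ : WaveSpace} {k : FormSpace} (hk : k ∈ formGraph b)
    (h : ∀ φ, ∀ hφ : IsTestFn φ, inner ℂ (testVec b hφ) k = inner ℂ (testLp hφ) χ) :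
    formMap b χ = k := by
  have h1 : ∀ m ∈ formGraph b, inner ℂ m k = inner ℂ m (formMap b χ) := by
    intro m hm
    rw [inner_formMap_right hm]
    exact formGraph_eqOn (f := fun m : FormSpace => inner ℂ m k)
      (g := fun m : FormSpace => inner ℂ (m none) χ) (continuous_id.inner continuous_const)
      ((continuous_formSpace_apply _).inner continuous_const) h hm
  have h2 := h1 _ (Submodule.sub_mem _ (formMap_mem b χ) hk)
  rw [← sub_eq_zero, ← inner_sub_right, ← neg_sub, inner_neg_left, neg_eq_zero,
    inner_self_eq_zero, sub_eq_zero] at h2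
  exact h2.symm

theorem inner_formMap (b : E3 → E3) (χ χ' : WaveSpace) :
    inner ℂ (formMap b χ) (formMap b χ') = inner ℂ χ (formInv b χ') := by
  rw [← inner_conj_symm, inner_formMap_right (formMap_mem b χ'), inner_conj_symm]
  rfl

theorem norm_formMap_apply_le (b : E3 → E3) (χ : WaveSpace) : ‖formMap b χ‖ ≤ ‖χ‖ := by
  rw [formMap, ContinuousLinearMap.comp_apply]
  refine (Submodule.norm_starProjection_apply_le _ _).trans ?_
  refine (ContinuousLinearMap.le_opNorm _ _).trans (mul_le_of_le_one_left (norm_nonneg _) ?_)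
  rw [LinearIsometryEquiv.norm_map]
  refine ContinuousLinearMap.opNorm_le_bound _ zero_le_one fun k => ?_
  rw [one_mul]
  exact PiLp.norm_apply_le k none

/-- The factorisation `formInv b = (formMap b)* (formMap b)`. -/
theorem formInv_isPositive (b : E3 → E3) : (formInv b).IsPositive := by
  have h : formInv b = ContinuousLinearMap.adjoint (formMap b) ∘L formMap b := by
    refine ContinuousLinearMap.ext fun χ => ext_inner_left ℂ fun v => ?_
    rw [ContinuousLinearMap.comp_apply, ContinuousLinearMap.adjoint_inner_right, inner_formMap]
  rw [h]
  exact ContinuousLinearMap.isPositive_adjoint_comp_self _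

theorem formInv_eq_zero {b : E3 → E3} {χ : WaveSpace} (h : formInv b χ = 0) : χ = 0 := by
  have h1 : formMap b χ = 0 := by
    rw [← inner_self_eq_zero (𝕜 := ℂ), inner_formMap, h, inner_zero_right]
  refine eq_zero_of_inner_testLp fun φ hφ => ?_
  have h2 := inner_formMap_right (testVec_mem_formGraph b hφ) χ
  rw [h1, inner_zero_right] at h2
  exact h2.symm

/-! ### The Hamiltonian -/

theorem inner_testVec_inl {b : E3 → E3} (hb : MemLp b ∞ volume) {φ : E3 → ℂ} (hφ : IsTestFn φ)
    (j : Fin 3) (w : WaveSpace) : inner ℂ (testVec b hφ (some (Sum.inl j))) w =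
      ∫ x, conj (-Complex.I * pderiv3 j φ x - (b x j : ℂ) * φ x) * w x := by
  rw [inner_waveSpace]
  refine integral_congr_ae ?_
  filter_upwards [Lp.coeFn_sub (-Complex.I • testLp (hφ.pderiv3 j))
    (mulInf (fun x => (b x j : ℂ)) (testLp hφ)), Lp.coeFn_smul (-Complex.I)
    (testLp (hφ.pderiv3 j)), coeFn_testLp (hφ.pderiv3 j), coeFn_testLp hφ,
    mulInf_apply_ae (memLp_coord hb j) (testLp hφ)] with x h1 h2 h3 h4 h5
  have h6 : (testVec b hφ (some (Sum.inl j)) : E3 → ℂ) x =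
      -Complex.I * pderiv3 j φ x - (b x j : ℂ) * φ x := by
    refine h1.trans ?_
    rw [Pi.sub_apply, h2, h5, Pi.smul_apply, h3, h4, smul_eq_mul]
  rw [h6]

/-- The equation `h ψ = χ` amounts to `(2h + 1) ψ = 2χ + ψ`; this is the bridge from the form
definition to bounded operators. -/
theorem isHamiltonian_iff {b : E3 → E3} (hb : MemLp b ∞ volume) {ψ χ : WaveSpace} :
    IsHamiltonian b ψ χ ↔ formInv b ((2 : ℂ) • χ + ψ) = ψ := by
  have key : ∀ (g : Fin 3 → WaveSpace) (k : FormSpace), k none = ψ →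
      (∀ j, k (some (Sum.inl j)) = -Complex.I • g j - mulInf (fun x => (b x j : ℂ)) (k none)) →
      (∀ j, k (some (Sum.inr j)) =ᵐ[volume] fun x => (x j : ℂ) * k none x) →
      ∀ φ, ∀ hφ : IsTestFn φ, inner ℂ (testVec b hφ) k = inner ℂ (testLp hφ) ψ +
        ((∑ j, ∫ x, conj (-Complex.I * pderiv3 j φ x - (b x j : ℂ) * φ x) *
          (-Complex.I * g j x - (b x j : ℂ) * ψ x)) +
        ∑ j, ∫ x : E3, conj ((x j : ℂ) * φ x) * ((x j : ℂ) * ψ x)) := by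
    intro g k hk hinl hinr φ hφ
    rw [inner_formSpace, hk]
    congr 2
    · refine Finset.sum_congr rfl fun j _ => ?_
      rw [inner_testVec_inl hb]
      refine integral_congr_ae ?_
      rw [hinl j, hk]
      filter_upwards [Lp.coeFn_sub (-Complex.I • g j) (mulInf (fun x => (b x j : ℂ)) ψ),
        Lp.coeFn_smul (-Complex.I) (g j), mulInf_apply_ae (memLp_coord hb j) ψ] with x h1 h2 h3
      rw [h1, Pi.sub_apply, h2, h3, Pi.smul_apply, smul_eq_mul]
    · refine Finset.sum_congr rfl fun j _ => ?_
      change inner ℂ (testLp (hφ.coord_mul j)) _ = _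
      rw [inner_testLp]
      refine integral_congr_ae ?_
      filter_upwards [hinr j] with x hx
      rw [hx, hk]
  constructor
  · rintro ⟨g, hg, hx, h⟩
    set k : FormSpace := formVec b ψ (fun j => -Complex.I • g j) (fun j => (hx j).toLp _) with hk
    have hkm : k ∈ formGraph b :=
      mem_formGraph_iff.mpr ⟨g, hg, fun j => rfl, fun j => (hx j).coeFn_toLp⟩
    have h1 : formMap b ((2 : ℂ) • χ + ψ) = k := by
      refine formMap_eq hkm fun φ hφ => ?_
      rw [key g k rfl (fun j => rfl) (fun j => (hx j).coeFn_toLp), inner_add_right,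
        inner_smul_right, inner_testLp hφ χ, ← h φ hφ]
      ring
    rw [formInv_apply, h1]
    rfl
  · intro h
    obtain ⟨g, hg, hinl, hinr⟩ := mem_formGraph_iff.mp (formMap_mem b ((2 : ℂ) • χ + ψ))
    have hk : formMap b ((2 : ℂ) • χ + ψ) none = ψ := h
    refine ⟨g, fun j => ?_, fun j => ?_, fun φ hφ => ?_⟩
    · have := hg j
      rwa [hk] at this
    · have h1 := (Lp.memLp _).ae_eq (hinr j)
      rwa [hk] at h1
    · have h1 := key g _ hk hinl hinr φ hφ
      rw [inner_formMap_right (testVec_mem_formGraph b hφ)] at h1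
      change inner ℂ (testLp hφ) _ = _ at h1
      rw [inner_add_right, inner_smul_right, inner_testLp hφ χ] at h1
      linear_combination (-1 / 2 : ℂ) * h1

theorem oscDomain_eq_range : oscDomain = range (formInv 0) := by
  have h0 : MemLp (0 : E3 → E3) ∞ volume := MemLp.zero
  ext ψ
  constructor
  · rintro ⟨χ, hχ⟩
    exact ⟨_, (isHamiltonian_iff h0).mp hχ⟩
  · rintro ⟨η, rfl⟩
    refine ⟨(1 / 2 : ℂ) • (η - formInv 0 η), (isHamiltonian_iff h0).mpr ?_⟩
    rw [smul_smul]
    norm_num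

/-! ### Change of the vector potential -/

theorem inner_mulInf_left {f : E3 → ℝ} (hf : MemLp (fun x => (f x : ℂ)) ∞ volume)
    (ψ χ : WaveSpace) : inner ℂ (mulInf (fun x => (f x : ℂ)) ψ) χ =
      inner ℂ ψ (mulInf (fun x => (f x : ℂ)) χ) := by
  rw [inner_waveSpace, inner_waveSpace]
  refine integral_congr_ae ?_
  filter_upwards [mulInf_apply_ae hf ψ, mulInf_apply_ae hf χ] with x h1 h2
  rw [h1, h2, map_mul, Complex.conj_ofReal]
  ring

theorem mulInf_comm {f g : E3 → ℂ} (hf : MemLp f ∞ volume) (hg : MemLp g ∞ volume)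
    (ψ : WaveSpace) : mulInf f (mulInf g ψ) = mulInf g (mulInf f ψ) := by
  refine Lp.ext ?_
  filter_upwards [mulInf_apply_ae hf ψ, mulInf_apply_ae hg ψ, mulInf_apply_ae hf (mulInf g ψ),
    mulInf_apply_ae hg (mulInf f ψ)] with x h1 h2 h3 h4
  rw [h3, h4, h1, h2]
  ring

theorem mulInf_add {f g : E3 → ℂ} (hf : MemLp f ∞ volume) (hg : MemLp g ∞ volume)
    (ψ : WaveSpace) : mulInf (fun x => f x + g x) ψ = mulInf f ψ + mulInf g ψ := by
  refine Lp.ext ?_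
  filter_upwards [mulInf_apply_ae hf ψ, mulInf_apply_ae hg ψ, mulInf_apply_ae (hf.add hg) ψ,
    Lp.coeFn_add (mulInf f ψ) (mulInf g ψ)] with x h1 h2 h3 h4
  rw [h4, Pi.add_apply, h1, h2]
  refine h3.trans ?_
  rw [Pi.add_apply]
  ring

theorem inner_testLp_mulInf {φ θ : E3 → ℂ} (hφ : IsTestFn φ) (hθ : IsTestFn θ) {f : E3 → ℂ}
    (hf : MemLp f ∞ volume) :
    inner ℂ (testLp hφ) (mulInf f (testLp hθ)) = ∫ x, f x * (conj (φ x) * θ x) := by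
  rw [inner_testLp]
  refine integral_congr_ae ?_
  filter_upwards [mulInf_apply_ae hf (testLp hθ), coeFn_testLp hθ] with x h1 h2
  rw [h1, h2]
  ring

theorem IsTestFn.integrable_top_mul {η f : E3 → ℂ} (hη : IsTestFn η) (hf : MemLp f ∞ volume) :
    Integrable (fun x => f x * η x) volume :=
  memLp_one_iff_integrable.mp ((hη.memLp 1).mul hf)

theorem HasWeakDiv.sum_integral {c : E3 → E3} {d : E3 → ℝ} (h : HasWeakDiv c d)
    (hc : MemLp c ∞ volume) (hd : MemLp (fun x => (d x : ℂ)) ∞ volume) {η : E3 → ℂ}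
    (hη : IsTestFn η) :
    ∑ j, ∫ x, (c x j : ℂ) * pderiv3 j η x = -∫ x, (d x : ℂ) * η x := by
  have hexp : ∀ x, fderiv ℝ η x (c x) = ∑ j, (c x j : ℂ) * pderiv3 j η x := by
    intro x
    conv_lhs => rw [← (EuclideanSpace.basisFun (Fin 3) ℝ).sum_repr (c x)]
    simp [pderiv3]
  have hi : ∀ j, Integrable (fun x => (c x j : ℂ) * pderiv3 j η x) volume := fun j =>
    (hη.pderiv3 j).integrable_top_mul (memLp_coord hc j)
  have hi' : Integrable (fun x => fderiv ℝ η x (c x)) volume := by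
    simp only [hexp]
    exact integrable_finsetSum _ fun j _ => hi j
  have hid := hη.integrable_top_mul hd
  rw [← integral_finsetSum _ fun j _ => hi j]
  simp only [← hexp]
  -- The weak divergence is tested on real functions, so it is applied to the real and imaginary
  -- parts of `η`.
  have hL : ∀ L : ℂ →L[ℝ] ℝ, L (∫ x, fderiv ℝ η x (c x)) = L (-∫ x, (d x : ℂ) * η x) := by
    intro L
    have h1 := h (fun x => L (η x)) (L.contDiff.comp hη.1)
      (hη.2.comp_left (g := L) (map_zero L))
    have h2 : ∀ x, fderiv ℝ (fun x => L (η x)) x (c x) = L (fderiv ℝ η x (c x)) := by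
      intro x
      have := (L.hasFDerivAt (x := η x)).comp x
        (hη.differentiable.differentiableAt.hasFDerivAt (x := x))
      have h3 : fderiv ℝ (fun x => L (η x)) x = _ := this.fderiv
      rw [h3]
      rfl
    simp only [h2] at h1
    rw [L.integral_comp_comm hi'] at h1
    rw [h1, map_neg, ← L.integral_comp_comm hid]
    congr 1
    refine integral_congr_ae (Eventually.of_forall fun x => ?_)
    simp only [← smul_eq_mul (a := (d x : ℂ)), Complex.coe_smul, map_smul]
    rfl
  exact Complex.ext (hL Complex.reCLM) (hL Complex.imCLM)

/-- The weak form of `∑ π_j c_j = ∑ c_j π_j - i ∇·c`. Only the divergence of `c` appears, not its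
single derivatives, by testing against `conj φ * θ`. -/
theorem sum_inner_mulInf_comm {b c : E3 → E3} {d : E3 → ℝ} (hb : MemLp b ∞ volume)
    (hc : MemLp c ∞ volume) (hd : MemLp (fun x => (d x : ℂ)) ∞ volume) (h : HasWeakDiv c d)
    {φ : E3 → ℂ} (hφ : IsTestFn φ) {k : FormSpace} (hk : k ∈ formGraph b) :
    ∑ j, inner ℂ (testVec b hφ (some (Sum.inl j))) (mulInf (fun x => (c x j : ℂ)) (k none)) =
      (∑ j, inner ℂ (testLp hφ) (mulInf (fun x => (c x j : ℂ)) (k (some (Sum.inl j))))) -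
        inner ℂ (testLp hφ) (Complex.I • mulInf (fun x => (d x : ℂ)) (k none)) := by
  refine formGraph_eqOn (b := b)
    (f := fun k : FormSpace => ∑ j, inner ℂ (testVec b hφ (some (Sum.inl j)))
      (mulInf (fun x => (c x j : ℂ)) (k none)))
    (g := fun k : FormSpace =>
      (∑ j, inner ℂ (testLp hφ) (mulInf (fun x => (c x j : ℂ)) (k (some (Sum.inl j))))) -
        inner ℂ (testLp hφ) (Complex.I • mulInf (fun x => (d x : ℂ)) (k none)))
    ?_ ?_ (fun θ hθ => ?_) hk
  · exact continuous_finsetSum _ fun j _ => continuous_const.inner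
      ((mulInf _).continuous.comp (continuous_formSpace_apply none))
  · refine (continuous_finsetSum _ fun j _ => continuous_const.inner
      ((mulInf _).continuous.comp (continuous_formSpace_apply _))).sub
      (continuous_const.inner (𝕜 := ℂ) ?_)
    exact ((mulInf _).continuous.comp (continuous_formSpace_apply none)).const_smul Complex.I
  · have hcj := fun j => memLp_coord hc j
    have hbj := fun j => memLp_coord hb j
    have h1 : ∀ j, inner ℂ (testVec b hφ (some (Sum.inl j)))
          (mulInf (fun x => (c x j : ℂ)) (testVec b hθ none)) =
        inner ℂ (testLp hφ) (mulInf (fun x => (c x j : ℂ)) (testVec b hθ (some (Sum.inl j)))) +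
          Complex.I * ∫ x, (c x j : ℂ) * pderiv3 j (fun x => conj (φ x) * θ x) x := by
      intro j
      have e1 : testVec b hφ (some (Sum.inl j)) = -Complex.I • testLp (hφ.pderiv3 j) -
          mulInf (fun x => (b x j : ℂ)) (testLp hφ) := rfl
      have e2 : testVec b hθ (some (Sum.inl j)) = -Complex.I • testLp (hθ.pderiv3 j) -
          mulInf (fun x => (b x j : ℂ)) (testLp hθ) := rfl
      have e3 : testVec b hθ none = testLp hθ := rfl
      rw [e1, e2, e3, inner_sub_left, map_sub, inner_sub_right, inner_mulInf_left (hbj j),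
        mulInf_comm (hbj j) (hcj j), map_smul, inner_smul_left, inner_smul_right,
        inner_testLp_mulInf _ _ (hcj j), inner_testLp_mulInf _ _ (hcj j)]
      have e4 : ∫ x, (c x j : ℂ) * pderiv3 j (fun x => conj (φ x) * θ x) x =
          (∫ x, (c x j : ℂ) * (conj (φ x) * pderiv3 j θ x)) +
            ∫ x, (c x j : ℂ) * (conj (pderiv3 j φ x) * θ x) := by
        rw [← integral_add ((hφ.conj.mul (hθ.pderiv3 j)).integrable_top_mul (hcj j))
          (((hφ.pderiv3 j).conj.mul hθ).integrable_top_mul (hcj j))]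
        refine integral_congr_ae (Eventually.of_forall fun x => ?_)
        simp only [pderiv3_mul hφ.conj hθ, pderiv3_conj hφ]
        ring
      rw [e4]
      simp only [map_neg, Complex.conj_I]
      ring
    change ∑ j, inner ℂ (testVec b hφ (some (Sum.inl j)))
          (mulInf (fun x => (c x j : ℂ)) (testVec b hθ none)) = _
    rw [Finset.sum_congr rfl fun j _ => h1 j, Finset.sum_add_distrib, ← Finset.mul_sum,
      h.sum_integral hc hd (hφ.conj.mul hθ), sub_eq_add_neg, inner_smul_right]
    congr 1
    have e3 : testVec b hθ none = testLp hθ := rfl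
    rw [e3, inner_testLp_mulInf _ _ hd]
    ring

/-- The operator `2(h' - h)(2h + 1)⁻¹`, where `h'` has the vector potential `b + c` and
`d = ∇·c`. -/
noncomputable def relOp (b c : E3 → E3) (d : E3 → ℝ) : WaveSpace →L[ℂ] WaveSpace :=
  (∑ j, (mulInf (fun x => (c x j : ℂ)) ∘L mulInf (fun x => (c x j : ℂ)) ∘L formInv b -
      (2 : ℂ) • mulInf (fun x => (c x j : ℂ)) ∘L
        PiLp.proj 2 (fun _ : FormIdx => WaveSpace) (some (Sum.inl j)) ∘L formMap b)) +
    Complex.I • mulInf (fun x => (d x : ℂ)) ∘L formInv b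

theorem relOp_apply (b c : E3 → E3) (d : E3 → ℝ) (χ : WaveSpace) :
    relOp b c d χ = (∑ j, (mulInf (fun x => (c x j : ℂ)) (mulInf (fun x => (c x j : ℂ))
      (formMap b χ none)) - (2 : ℂ) • mulInf (fun x => (c x j : ℂ))
        (formMap b χ (some (Sum.inl j))))) +
    Complex.I • mulInf (fun x => (d x : ℂ)) (formMap b χ none) := by
  simp only [relOp, add_apply, sum_apply, sub_apply, smul_apply,
    ContinuousLinearMap.comp_apply]
  rfl

theorem norm_relOp_apply_le {b c : E3 → E3} {d : E3 → ℝ} (hc : MemLp c ∞ volume)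
    (hd : MemLp (fun x => (d x : ℂ)) ∞ volume) {C D : ℝ} (hC0 : 0 ≤ C)
    (hC : ∀ᵐ x, ‖c x‖ ≤ C) (hD : ∀ᵐ x, |d x| ≤ D) (χ : WaveSpace) :
    ‖relOp b c d χ‖ ≤ (3 * (C ^ 2 + 2 * C) + D) * ‖χ‖ := by
  have hD0 : 0 ≤ D := by
    obtain ⟨x, hx⟩ := hD.exists
    exact (abs_nonneg _).trans hx
  have hk : ∀ i, ‖formMap b χ i‖ ≤ ‖χ‖ := fun i =>
    (PiLp.norm_apply_le _ i).trans (norm_formMap_apply_le b χ)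
  have hcj : ∀ j ψ, ‖mulInf (fun x => (c x j : ℂ)) ψ‖ ≤ C * ‖ψ‖ := fun j ψ =>
    norm_mulInf_apply_le (memLp_coord hc j) (by
      filter_upwards [hC] with x hx
      rw [Complex.norm_real]
      exact (PiLp.norm_apply_le _ j).trans hx) ψ
  rw [relOp_apply]
  refine (norm_add_le _ _).trans ?_
  rw [add_mul]
  refine add_le_add ?_ ?_
  · refine (norm_sum_le _ _).trans ?_
    calc _ ≤ ∑ _j : Fin 3, (C ^ 2 + 2 * C) * ‖χ‖ := by
          refine Finset.sum_le_sum fun j _ => (norm_sub_le _ _).trans ?_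
          rw [norm_smul, Complex.norm_two, add_mul]
          refine add_le_add ?_ ?_
          · calc _ ≤ C * (C * ‖formMap b χ none‖) := (hcj j _).trans (by gcongr; exact hcj j _)
              _ ≤ C * (C * ‖χ‖) := by gcongr; exact hk none
              _ = C ^ 2 * ‖χ‖ := by ring
          · calc _ ≤ 2 * (C * ‖formMap b χ (some (Sum.inl j))‖) := by gcongr; exact hcj j _
              _ ≤ 2 * (C * ‖χ‖) := by gcongr; exact hk _
              _ = 2 * C * ‖χ‖ := by ring
      _ = 3 * (C ^ 2 + 2 * C) * ‖χ‖ := by simp; ring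
  · rw [norm_smul, Complex.norm_I, one_mul]
    refine (norm_mulInf_apply_le hd (C := D) (by simpa using hD) _).trans ?_
    gcongr
    exact hk none

theorem norm_sum_single_le {c : E3 → E3} (hc : MemLp c ∞ volume) {C : ℝ}
    (hC : ∀ᵐ x, ‖c x‖ ≤ C) (ψ : WaveSpace) :
    ‖∑ j, PiLp.single 2 (β := fun _ : FormIdx => WaveSpace) (some (Sum.inl j))
      (mulInf (fun x => (c x j : ℂ)) ψ)‖ ≤ 3 * C * ‖ψ‖ := by
  refine (norm_sum_le _ _).trans ?_
  calc _ ≤ ∑ _j : Fin 3, C * ‖ψ‖ := by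
        refine Finset.sum_le_sum fun j _ => ?_
        rw [PiLp.norm_single]
        refine norm_mulInf_apply_le (memLp_coord hc j) ?_ ψ
        filter_upwards [hC] with x hx
        rw [Complex.norm_real]
        exact (PiLp.norm_apply_le _ j).trans hx
    _ = _ := by simp; ring

/-- With `π' = π - c`, expanding the square gives `2h' = 2h + ∑ (c_j² - 2 c_j π_j) + i ∇·c`. The
first component of the identity yields the common domain and the relative bound, the momentum
components the change of the form norm. -/
theorem formMap_add_relOp {b b' c : E3 → E3} {d : E3 → ℝ} (hb : MemLp b ∞ volume)
    (hc : MemLp c ∞ volume) (hd : MemLp (fun x => (d x : ℂ)) ∞ volume) (h : HasWeakDiv c d)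
    (hb' : ∀ᵐ x, b' x = b x + c x) (χ : WaveSpace) :
    formMap b' (χ + relOp b c d χ) = formMap b χ - ∑ j, PiLp.single 2 (some (Sum.inl j))
      (mulInf (fun x => (c x j : ℂ)) (formInv b χ)) := by
  have hb'm : MemLp b' ∞ volume := (hb.add hc).ae_eq (by
    filter_upwards [hb'] with x hx
    rw [hx]; rfl)
  have hmul : ∀ j ψ, mulInf (fun x => (b' x j : ℂ)) ψ =
      mulInf (fun x => (b x j : ℂ)) ψ + mulInf (fun x => (c x j : ℂ)) ψ := by
    intro j ψ
    rw [← mulInf_add (memLp_coord hb j) (memLp_coord hc j)]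
    refine Lp.ext ?_
    filter_upwards [mulInf_apply_ae (memLp_coord hb'm j) ψ,
      mulInf_apply_ae ((memLp_coord hb j).add (memLp_coord hc j)) ψ, hb'] with x h1 h2 h3
    rw [h1]
    refine Eq.trans ?_ h2.symm
    simp [h3]
  set ψ := formInv b χ with hψ
  set k := formMap b χ with hk
  have hkm : k ∈ formGraph b := formMap_mem b χ
  set k' : FormSpace := k - ∑ j, PiLp.single 2 (some (Sum.inl j))
      (mulInf (fun x => (c x j : ℂ)) ψ) with hk'
  have hsum : ∀ i, (∑ j, PiLp.single 2 (β := fun _ : FormIdx => WaveSpace) (some (Sum.inl j))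
      (mulInf (fun x => (c x j : ℂ)) ψ)) i = ∑ j, (PiLp.single 2
        (β := fun _ : FormIdx => WaveSpace) (some (Sum.inl j))
          (mulInf (fun x => (c x j : ℂ)) ψ)) i := fun i => by
    rw [WithLp.ofLp_sum, Finset.sum_apply]
  have k0 : k' none = ψ := by
    rw [hk', PiLp.sub_apply, hsum]
    simp [hψ, formInv_apply, hk]
  have k1 : ∀ j, k' (some (Sum.inl j)) = k (some (Sum.inl j)) -
      mulInf (fun x => (c x j : ℂ)) ψ := by
    intro j
    rw [hk', PiLp.sub_apply, hsum]
    simp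
  have k2 : ∀ j, k' (some (Sum.inr j)) = k (some (Sum.inr j)) := by
    intro j
    rw [hk', PiLp.sub_apply, hsum]
    simp
  have kψ : k none = ψ := rfl
  refine formMap_eq ?_ fun φ hφ => ?_
  · obtain ⟨g, hg, hinl, hinr⟩ := mem_formGraph_iff.mp hkm
    refine mem_formGraph_iff.mpr ⟨g, ?_, fun j => ?_, ?_⟩
    · rwa [k0]
    · rw [k1, k0, hinl, hmul, kψ]
      abel
    · simpa only [k0, k2, kψ] using hinr
  · have h1 := inner_formMap_right (testVec_mem_formGraph b hφ) χ
    rw [← hk, inner_formSpace] at h1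
    have e0 : testVec b hφ none = testLp hφ := rfl
    have e1 : testVec b' hφ none = testLp hφ := rfl
    have e2 : ∀ j, testVec b' hφ (some (Sum.inl j)) = testVec b hφ (some (Sum.inl j)) -
        mulInf (fun x => (c x j : ℂ)) (testLp hφ) := by
      intro j
      change -Complex.I • testLp (hφ.pderiv3 j) - mulInf (fun x => (b' x j : ℂ)) (testLp hφ) =
        -Complex.I • testLp (hφ.pderiv3 j) - mulInf (fun x => (b x j : ℂ)) (testLp hφ) -
          mulInf (fun x => (c x j : ℂ)) (testLp hφ)
      rw [hmul]
      abel
    have e3 : ∀ j, testVec b' hφ (some (Sum.inr j)) = testVec b hφ (some (Sum.inr j)) :=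
      fun j => rfl
    have h2 := sum_inner_mulInf_comm hb hc hd h hφ hkm
    rw [inner_formSpace, relOp_apply, inner_add_right, inner_add_right, inner_sum, ← hk]
    simp only [k0, k1, k2, e1, e2, e3, inner_sub_left, inner_sub_right,
      inner_mulInf_left (memLp_coord hc _), inner_smul_right, Finset.sum_sub_distrib,
      kψ, e0, ← Finset.mul_sum] at h1 h2 ⊢
    linear_combination h1 - h2

/-! ### A Hardy inequality -/

/-- Integrate the derivative of `(T - t) M(t)²`, where `M` is the primitive of `m`. It is `2 (T - t)
M m - M²`, at most `2 (T - t)² m² - M² / 2`, while the function vanishes at `0` and is nonnegative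
at `τ`. -/
theorem hardy_integral_le {T τ : ℝ} {m : ℝ → ℝ} (hτ0 : 0 ≤ τ) (hτ : τ < T)
    (hm : IntervalIntegrable m volume 0 τ)
    (hw : IntervalIntegrable (fun r => (T - r) ^ 2 * m r ^ 2) volume 0 τ) :
    ∫ t in (0 : ℝ)..τ, (∫ r in (0 : ℝ)..t, m r) ^ 2 ≤
      4 * ∫ r in (0 : ℝ)..τ, (T - r) ^ 2 * m r ^ 2 := by
  set M : ℝ → ℝ := fun t => ∫ r in (0 : ℝ)..t, m r with hM
  -- Since `m` is merely integrable, `M` is differentiable only almost everywhere, and absolute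
  -- continuity is needed for the fundamental theorem.
  have hMac : AbsolutelyContinuousOnInterval M 0 τ :=
    hm.absolutelyContinuousOnInterval_intervalIntegral (by simp)
  have hlac : AbsolutelyContinuousOnInterval (fun t => T - t) 0 τ :=
    (contDiff_const.sub contDiff_id).contDiffOn.absolutelyContinuousOnInterval
  have hFac := hlac.fun_mul (hMac.fun_mul hMac)
  have h1 := hFac.integral_deriv_eq_sub
  have hM2 : IntervalIntegrable (fun t => M t ^ 2) volume 0 τ :=
    (hMac.continuousOn.pow 2).intervalIntegrable
  have h2 : ∫ t in (0 : ℝ)..τ, deriv (fun t => (T - t) * (M t * M t)) t ≤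
      ∫ t in (0 : ℝ)..τ, (2 * ((T - t) ^ 2 * m t ^ 2) - 1 / 2 * M t ^ 2) := by
    refine intervalIntegral.integral_mono_ae_restrict hτ0 hFac.intervalIntegrable_deriv
      ((hw.const_mul 2).sub (hM2.const_mul (1 / 2))) ?_
    filter_upwards [ae_restrict_of_ae hm.ae_hasDerivAt_integral,
      ae_restrict_mem measurableSet_Icc] with t ht htm
    rw [uIcc_of_le hτ0] at ht
    have hd : HasDerivAt M (m t) t := ht htm 0 ⟨le_rfl, hτ0⟩
    have hd2 := ((hasDerivAt_id t).const_sub T).mul (hd.mul hd)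
    have hd3 : deriv (fun t => (T - t) * (M t * M t)) t = _ := hd2.deriv
    rw [hd3]
    simp only [id, Pi.mul_apply]
    nlinarith [sq_nonneg (M t - 2 * ((T - t) * m t))]
  rw [h1, intervalIntegral.integral_sub (hw.const_mul 2) (hM2.const_mul (1 / 2)),
    intervalIntegral.integral_const_mul, intervalIntegral.integral_const_mul] at h2
  have hM0 : M 0 = 0 := by simp [hM]
  simp only [hM0, mul_zero, sub_zero] at h2
  have h3 : 0 ≤ (T - τ) * (M τ * M τ) := mul_nonneg (by linarith) (mul_self_nonneg _)
  linarith

theorem hardy_integrableOn {T : ℝ} {m : ℝ → ℝ} (hT : 0 < T)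
    (hm : ∀ τ ∈ Ioo 0 T, IntervalIntegrable m volume 0 τ)
    (hw : IntegrableOn (fun r => (T - r) ^ 2 * m r ^ 2) (Ioo 0 T)) :
    IntegrableOn (fun t => (∫ r in (0 : ℝ)..t, m r) ^ 2) (Ioo 0 T) := by
  obtain ⟨τ, -, hτm, hτl⟩ := exists_seq_strictMono_tendsto' hT
  have hwI : ∀ n, IntervalIntegrable (fun r => (T - r) ^ 2 * m r ^ 2) volume 0 (τ n) := fun n =>
    (intervalIntegrable_iff_integrableOn_Ioo_of_le (hτm n).1.le).mpr
      (hw.mono_set (Ioo_subset_Ioo_right (hτm n).2.le))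
  rw [← integrableOn_Ioc_iff_integrableOn_Ioo]
  refine integrableOn_Ioc_of_intervalIntegral_norm_bounded_right (l := atTop) (b := τ)
    (I := 4 * ∫ r in Ioo 0 T, (T - r) ^ 2 * m r ^ 2) (fun n => ?_) hτl ?_
  · have h1 := (hm (τ n) (hτm n)).absolutelyContinuousOnInterval_intervalIntegral (c := 0)
      (by simp)
    exact ((intervalIntegrable_iff_integrableOn_Ioc_of_le (hτm n).1.le).mp
      (h1.continuousOn.pow 2).intervalIntegrable)
  · refine Eventually.of_forall fun n => ?_
    have h1 : ∀ t, ‖(∫ r in (0 : ℝ)..t, m r) ^ 2‖ = (∫ r in (0 : ℝ)..t, m r) ^ 2 := fun t =>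
      Real.norm_of_nonneg (sq_nonneg _)
    simp only [h1]
    have h2 := hardy_integral_le (hτm n).1.le (hτm n).2 (hm _ (hτm n)) (hwI n)
    rw [intervalIntegral.integral_of_le (hτm n).1.le] at h2
    refine h2.trans ?_
    gcongr
    rw [intervalIntegral.integral_of_le (hτm n).1.le, integral_Ioc_eq_integral_Ioo]
    refine setIntegral_mono_set hw (Eventually.of_forall fun r => ?_)
      (Ioo_subset_Ioo_right (hτm n).2.le).eventuallyLE
    positivity

theorem integrableOn_comp_neg_iff {f : ℝ → ℝ} {s : Set ℝ} :
    IntegrableOn (fun t => f (-t)) s ↔ IntegrableOn f (-s) := by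
  have h := (Measure.measurePreserving_neg (volume : Measure ℝ)).integrableOn_comp_preimage
    (MeasurableEquiv.neg ℝ).measurableEmbedding (f := f) (s := -s)
  simpa [Function.comp_def] using h

theorem hardy_integrableOn_symm {T : ℝ} {m : ℝ → ℝ} (hT : 0 < T)
    (hm : ∀ τ ∈ Ioo (-T) T, IntervalIntegrable m volume 0 τ)
    (hw : IntegrableOn (fun r => (T - |r|) ^ 2 * m r ^ 2) (Ioo (-T) T)) :
    IntegrableOn (fun t => (∫ r in (0 : ℝ)..t, m r) ^ 2) (Ioo (-T) T) := by
  have hpos : IntegrableOn (fun t => (∫ r in (0 : ℝ)..t, m r) ^ 2) (Ioo 0 T) := by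
    refine hardy_integrableOn hT (fun τ hτ => hm τ ⟨by linarith [hτ.1], hτ.2⟩) ?_
    refine (hw.mono_set (Ioo_subset_Ioo_left (by linarith))).congr_fun (fun r hr => ?_)
      measurableSet_Ioo
    simp only [abs_of_pos hr.1]
  have hneg : IntegrableOn (fun t => (∫ r in (0 : ℝ)..t, m (-r)) ^ 2) (Ioo 0 T) := by
    refine hardy_integrableOn hT (fun τ hτ => ?_) ?_
    · have := (IntervalIntegrable.iff_comp_neg (by simp)).mp
        (hm (-τ) ⟨by linarith [hτ.2], by linarith [hτ.1]⟩)
      simpa using this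
    · have h1 := hw.mono_set (Ioo_subset_Ioo_right hT.le : Ioo (-T) 0 ⊆ Ioo (-T) T)
      have h2 := (integrableOn_comp_neg_iff (f := fun r => (T - |r|) ^ 2 * m r ^ 2)
        (s := Ioo 0 T)).mpr (by simpa using h1)
      refine h2.congr_fun (fun r hr => ?_) measurableSet_Ioo
      simp only [abs_neg, abs_of_pos hr.1]
  have hneg' : IntegrableOn (fun t => (∫ r in (0 : ℝ)..t, m r) ^ 2) (Ioo (-T) 0) := by
    rw [show Ioo (-T) 0 = -Ioo 0 T by simp]
    refine integrableOn_comp_neg_iff.mp (hneg.congr_fun (fun t _ => ?_) measurableSet_Ioo)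
    simp only [intervalIntegral.integral_comp_neg, neg_zero]
    rw [intervalIntegral.integral_symm, neg_sq]
  have h3 : IntegrableOn (fun t => (∫ r in (0 : ℝ)..t, m r) ^ 2) (Ioc (-T) 0 ∪ Ioo 0 T) :=
    ((integrableOn_Ioc_iff_integrableOn_Ioo).mpr hneg').union hpos
  rwa [Ioc_union_Ioo_eq_Ioo (by linarith) hT] at h3

/-! ### Time integrals of locally bounded fields -/

theorem HasWeakDiv.congr {b b' : E3 → E3} {d d' : E3 → ℝ} (h : HasWeakDiv b d)
    (hb : b =ᵐ[volume] b') (hd : d =ᵐ[volume] d') : HasWeakDiv b' d' := by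
  intro φ hφ hc
  have e1 : ∫ x, fderiv ℝ φ x (b' x) = ∫ x, fderiv ℝ φ x (b x) :=
    integral_congr_ae (by filter_upwards [hb] with x hx; rw [hx])
  have e2 : ∫ x, d' x * φ x = ∫ x, d x * φ x :=
    integral_congr_ae (by filter_upwards [hd] with x hx; rw [hx])
  rw [e1, e2, h φ hφ hc]

theorem HasWeakDiv.neg {b : E3 → E3} {d : E3 → ℝ} (h : HasWeakDiv b d) :
    HasWeakDiv (fun x => -b x) (fun x => -d x) := by
  intro φ hφ hc
  simp only [map_neg, neg_mul, integral_neg, h φ hφ hc]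

section LocBdd

variable {F : Type*} [NormedAddCommGroup F]

/-- Fields on `(-π/2, π/2) × ℝ³` which are bounded for times in compact intervals. -/
def IsLocBddField (f : ℝ → E3 → F) : Prop :=
  ∀ α β : ℝ, -(Real.pi / 2) < α → β < Real.pi / 2 →
    MemLp (Function.uncurry f) ∞ (volume.restrict (Icc α β ×ˢ (univ : Set E3)))

theorem volume_restrict_prod_univ (s : Set ℝ) :
    (volume : Measure (ℝ × E3)).restrict (s ×ˢ univ) =
      (volume.restrict s).prod (volume : Measure E3) := by
  rw [Measure.volume_eq_prod, ← Measure.prod_restrict, Measure.restrict_univ]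

namespace IsLocBddField

variable {f : ℝ → E3 → F} {α β s t : ℝ}

theorem aestronglyMeasurable (hf : IsLocBddField f) (hα : -(Real.pi / 2) < α)
    (hβ : β < Real.pi / 2) :
    AEStronglyMeasurable (fun p : E3 × ℝ => f p.2 p.1)
      ((volume : Measure E3).prod (volume.restrict (Icc α β))) := by
  have h := (hf α β hα hβ).1
  rw [volume_restrict_prod_univ] at h
  exact h.prod_swap

theorem exists_bound (hf : IsLocBddField f) (hα : -(Real.pi / 2) < α) (hβ : β < Real.pi / 2) :
    ∃ C : ℝ, 0 ≤ C ∧ (∀ᵐ r ∂(volume.restrict (Icc α β)), ∀ᵐ x, ‖f r x‖ ≤ C) ∧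
      ∀ᵐ p ∂((volume : Measure E3).prod (volume.restrict (Icc α β))), ‖f p.2 p.1‖ ≤ C := by
  have h := hf α β hα hβ
  rw [volume_restrict_prod_univ] at h
  have h1 : ∀ᵐ p ∂((volume.restrict (Icc α β)).prod (volume : Measure E3)),
      ‖Function.uncurry f p‖ ≤ (eLpNorm (Function.uncurry f) ∞
        ((volume.restrict (Icc α β)).prod (volume : Measure E3))).toReal := by
    filter_upwards [ae_le_eLpNormEssSup (f := Function.uncurry f)] with p hp
    rw [← toReal_enorm]
    exact ENNReal.toReal_mono h.2.ne hp
  refine ⟨_, ENNReal.toReal_nonneg, Measure.ae_ae_of_ae_prod h1, ?_⟩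
  have h2 := (Measure.measurePreserving_swap (μ := (volume : Measure E3))
    (ν := volume.restrict (Icc α β))).quasiMeasurePreserving.ae h1
  filter_upwards [h2] with p hp
  exact hp

theorem ae_integrableOn (hf : IsLocBddField f) (hα : -(Real.pi / 2) < α)
    (hβ : β < Real.pi / 2) : ∀ᵐ x, IntegrableOn (fun r => f r x) (Icc α β) := by
  obtain ⟨C, -, -, hC⟩ := hf.exists_bound hα hβ
  filter_upwards [(hf.aestronglyMeasurable hα hβ).prodMk_left, Measure.ae_ae_of_ae_prod hC]
    with x h1 h2
  exact (integrable_const C).mono' h1 h2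

theorem ae_intervalIntegrable (hf : IsLocBddField f) (ht : t ∈ oscTimes) (hs : s ∈ oscTimes) :
    ∀ᵐ x, IntervalIntegrable (fun r => f r x) volume s t := by
  have h1 : -(Real.pi / 2) < min s t := lt_min hs.1 ht.1
  have h2 : max s t < Real.pi / 2 := max_lt hs.2 ht.2
  filter_upwards [hf.ae_integrableOn h1 h2] with x hx
  exact intervalIntegrable_iff.mpr (hx.mono_set uIoc_subset_uIcc)

variable [NormedSpace ℝ F]

theorem aestronglyMeasurable_integral (hf : IsLocBddField f) (ht : t ∈ oscTimes)
    (hs : s ∈ oscTimes) :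
    AEStronglyMeasurable (fun x => ∫ r in s..t, f r x) (volume : Measure E3) := by
  have key : ∀ {s t}, s ∈ oscTimes → t ∈ oscTimes →
      AEStronglyMeasurable (fun x => ∫ r in Ioc s t, f r x) (volume : Measure E3) := by
    intro s t hs ht
    have h := (hf.aestronglyMeasurable hs.1 ht.2).integral_prod_right'
    simpa only [← integral_Icc_eq_integral_Ioc] using h
  simp only [intervalIntegral]
  exact (key hs ht).sub (key ht hs)

theorem exists_norm_integral_le (hf : IsLocBddField f) (hα : -(Real.pi / 2) < α)
    (hβ : β < Real.pi / 2) : ∃ C : ℝ, 0 ≤ C ∧ ∀ s ∈ Icc α β, ∀ t ∈ Icc α β,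
      ∀ᵐ x, ‖∫ r in s..t, f r x‖ ≤ C * |t - s| := by
  obtain ⟨C, hC0, -, hC⟩ := hf.exists_bound hα hβ
  refine ⟨C, hC0, fun s hs t ht => ?_⟩
  filter_upwards [Measure.ae_ae_of_ae_prod hC] with x hx
  refine intervalIntegral.norm_integral_le_of_norm_le_const_ae ?_
  rw [ae_restrict_iff' measurableSet_Icc] at hx
  filter_upwards [hx] with r hr hrm
  exact hr (uIcc_subset_Icc hs ht (uIoc_subset_uIcc hrm))

theorem memLp_integral (hf : IsLocBddField f) (ht : t ∈ oscTimes) (hs : s ∈ oscTimes) :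
    MemLp (fun x => ∫ r in s..t, f r x) ∞ (volume : Measure E3) := by
  obtain ⟨C, -, hC⟩ := hf.exists_norm_integral_le (α := min s t) (β := max s t)
    (lt_min hs.1 ht.1) (max_lt hs.2 ht.2)
  exact memLp_top_of_bound (hf.aestronglyMeasurable_integral ht hs) _
    (hC s ⟨min_le_left _ _, le_max_left _ _⟩ t ⟨min_le_right _ _, le_max_right _ _⟩)

end IsLocBddField

end LocBdd

/-- Fubini against a fixed test function; local boundedness in time and compact support in space
give integrability. -/
theorem hasWeakDiv_integral {e : ℝ → E3 → E3} {de : ℝ → E3 → ℝ} (he : IsLocBddField e)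
    (hde : IsLocBddField de)
    (hdiv : ∀ᵐ τ ∂(volume.restrict oscTimes), HasWeakDiv (e τ) (de τ)) {s t : ℝ}
    (hs : s ∈ oscTimes) (ht : t ∈ oscTimes) :
    HasWeakDiv (fun x => ∫ r in s..t, e r x) (fun x => ∫ r in s..t, de r x) := by
  have key : ∀ {s t}, s ∈ oscTimes → t ∈ oscTimes → s ≤ t →
      HasWeakDiv (fun x => ∫ r in s..t, e r x) (fun x => ∫ r in s..t, de r x) := by
    intro s t hs ht hst φ hφ hφc
    have hI : ∀ {G : Type} [NormedAddCommGroup G] [NormedSpace ℝ G] (k : ℝ → G),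
        ∫ r in s..t, k r = ∫ r in Icc s t, k r := fun k => by
      rw [intervalIntegral.integral_of_le hst, integral_Icc_eq_integral_Ioc]
    simp only [hI]
    have hfc : Continuous (fderiv ℝ φ) := hφ.continuous_fderiv (by simp)
    have i1 : Integrable (Function.uncurry fun (x : E3) r => fderiv ℝ φ x (e r x))
        ((volume : Measure E3).prod (volume.restrict (Icc s t))) := by
      obtain ⟨C, hC0, -, hC⟩ := he.exists_bound hs.1 ht.2
      have hb : Integrable (fun x => ‖fderiv ℝ φ x‖ * C) (volume : Measure E3) :=
        (hfc.integrable_of_hasCompactSupport (hφc.fderiv ℝ)).norm.mul_const C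
      refine (hb.comp_fst (volume.restrict (Icc s t))).mono' ?_ ?_
      · have h1 : AEStronglyMeasurable (fun p : E3 × ℝ => fderiv ℝ φ p.1)
            ((volume : Measure E3).prod (volume.restrict (Icc s t))) :=
          (hfc.comp continuous_fst).aestronglyMeasurable
        exact (ContinuousLinearMap.apply ℝ ℝ : E3 →L[ℝ] (E3 →L[ℝ] ℝ) →L[ℝ] ℝ).aestronglyMeasurable_comp₂
          (he.aestronglyMeasurable hs.1 ht.2) h1
      · filter_upwards [hC] with p hp
        exact (ContinuousLinearMap.le_opNorm _ _).trans (by gcongr)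
    have i2 : Integrable (Function.uncurry fun (x : E3) r => de r x * φ x)
        ((volume : Measure E3).prod (volume.restrict (Icc s t))) := by
      obtain ⟨C, hC0, -, hC⟩ := hde.exists_bound hs.1 ht.2
      have hb : Integrable (fun x => C * ‖φ x‖) (volume : Measure E3) :=
        (hφ.continuous.integrable_of_hasCompactSupport hφc).norm.const_mul C
      refine (hb.comp_fst (volume.restrict (Icc s t))).mono' ?_ ?_
      · exact (hde.aestronglyMeasurable hs.1 ht.2).mul
          (hφ.continuous.comp continuous_fst).aestronglyMeasurable
      · filter_upwards [hC] with p hp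
        rw [Function.uncurry, norm_mul]
        gcongr
    have e1 : ∫ x, fderiv ℝ φ x (∫ r in Icc s t, e r x) =
        ∫ x, ∫ r in Icc s t, fderiv ℝ φ x (e r x) := by
      refine integral_congr_ae ?_
      filter_upwards [he.ae_integrableOn hs.1 ht.2] with x hx
      exact ((fderiv ℝ φ x).integral_comp_comm hx).symm
    have e2 : ∫ x, (∫ r in Icc s t, de r x) * φ x = ∫ x, ∫ r in Icc s t, de r x * φ x :=
      integral_congr_ae (Eventually.of_forall fun x => (integral_mul_const _ _).symm)
    rw [e1, e2, integral_integral_swap i1, integral_integral_swap i2, ← integral_neg]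
    refine integral_congr_ae ?_
    have hsub : Icc s t ⊆ oscTimes := fun r hr => ⟨hs.1.trans_le hr.1, hr.2.trans_lt ht.2⟩
    filter_upwards [ae_restrict_of_ae_restrict_of_subset hsub hdiv] with r hr
    exact hr φ hφ hφc
  rcases le_total s t with hst | hst
  · exact key hs ht hst
  · simp only [intervalIntegral.integral_symm t s]
    exact (key ht hs hst).neg

/-! ### The essential supremum norm of the electric field -/

/-- The norm at `r` is at most `c` exactly when the slice at `r` of `{c < ‖g‖}` is null, and the
measure of slices depends measurably on `r`. -/
theorem measurable_eLpNorm_top {g : ℝ × E3 → E3} (hg : Measurable g) :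
    Measurable fun r => eLpNorm (fun x => g (r, x)) ∞ (volume : Measure E3) := by
  refine measurable_of_Iic fun c => ?_
  have h1 : (fun r => eLpNorm (fun x => g (r, x)) ∞ (volume : Measure E3)) ⁻¹' Iic c =
      {r | volume (Prod.mk r ⁻¹' {p : ℝ × E3 | c < ‖g p‖ₑ}) = 0} := by
    ext r
    simp only [mem_preimage, mem_Iic, mem_ofPred_eq]
    have h2 : volume (Prod.mk r ⁻¹' {p : ℝ × E3 | c < ‖g p‖ₑ}) = 0 ↔
        ∀ᵐ x, ‖g (r, x)‖ₑ ≤ c := by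
      rw [ae_iff]
      simp only [not_le]
      rfl
    rw [h2]
    constructor
    · intro h
      filter_upwards [ae_le_eLpNormEssSup (f := fun x => g (r, x))] with x hx
      exact hx.trans h
    · exact eLpNormEssSup_le_of_ae_enorm_bound
  rw [h1]
  exact measurable_measure_prodMk_left (measurableSet_lt measurable_const hg.enorm)
    (measurableSet_singleton 0)

/-- `‖e(τ, ·)‖_∞`. -/
noncomputable def supNorm (e : ℝ → E3 → E3) (r : ℝ) : ℝ :=
  (eLpNorm (e r) ∞ (volume : Measure E3)).toReal

theorem oscTimes_subset_iUnion :
    oscTimes ⊆ ⋃ n : ℕ, Icc (-(Real.pi / 2) + 1 / ((n : ℝ) + 1)) (Real.pi / 2 - 1 / ((n : ℝ) + 1)) := by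
  intro r hr
  obtain ⟨n, hn⟩ := exists_nat_one_div_lt
    (lt_min (sub_pos.mpr hr.2) (by linarith [hr.1] : 0 < r + Real.pi / 2))
  have h1 := hn.trans_le (min_le_left _ _)
  have h2 := hn.trans_le (min_le_right _ _)
  exact mem_iUnion.mpr ⟨n, by linarith, by linarith⟩

namespace IsLocBddField

variable {e : ℝ → E3 → E3} {s t : ℝ}

theorem aestronglyMeasurable_oscTimes (he : IsLocBddField e) :
    AEStronglyMeasurable (Function.uncurry e)
      ((volume.restrict oscTimes).prod (volume : Measure E3)) := by
  rw [← volume_restrict_prod_univ]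
  have h : AEStronglyMeasurable (Function.uncurry e) (volume.restrict (⋃ n : ℕ,
      Icc (-(Real.pi / 2) + 1 / ((n : ℝ) + 1)) (Real.pi / 2 - 1 / ((n : ℝ) + 1)) ×ˢ
        (univ : Set E3))) := by
    refine aestronglyMeasurable_iUnion_iff.mpr fun n => (he _ _ ?_ ?_).1
    · have : (0 : ℝ) < 1 / ((n : ℝ) + 1) := by positivity
      linarith
    · have : (0 : ℝ) < 1 / ((n : ℝ) + 1) := by positivity
      linarith
  refine h.mono_set ?_
  rw [← iUnion_prod_const]
  exact prod_mono_left oscTimes_subset_iUnion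

theorem exists_measurable (he : IsLocBddField e) :
    ∃ g : ℝ × E3 → E3, Measurable g ∧
      (∀ᵐ r ∂(volume.restrict oscTimes), ∀ᵐ x, e r x = g (r, x)) ∧
      ∀ᵐ x : E3, ∀ᵐ r ∂(volume.restrict oscTimes), e r x = g (r, x) := by
  have h := he.aestronglyMeasurable_oscTimes
  refine ⟨h.mk _, h.stronglyMeasurable_mk.measurable, Measure.ae_ae_of_ae_prod h.ae_eq_mk, ?_⟩
  have h2 := (Measure.measurePreserving_swap (μ := (volume : Measure E3))
    (ν := volume.restrict oscTimes)).quasiMeasurePreserving.ae h.ae_eq_mk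
  exact Measure.ae_ae_of_ae_prod h2

theorem ae_eLpNorm_ne_top (he : IsLocBddField e) :
    ∀ᵐ r ∂(volume.restrict oscTimes), eLpNorm (e r) ∞ (volume : Measure E3) ≠ ⊤ := by
  refine ae_restrict_of_ae_restrict_of_subset oscTimes_subset_iUnion ?_
  rw [ae_restrict_iUnion_iff]
  intro n
  have hn : (0 : ℝ) < 1 / ((n : ℝ) + 1) := by positivity
  obtain ⟨C, -, hC, -⟩ := he.exists_bound
    (α := -(Real.pi / 2) + 1 / ((n : ℝ) + 1)) (β := Real.pi / 2 - 1 / ((n : ℝ) + 1))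
    (by linarith) (by linarith)
  filter_upwards [hC] with r hr
  exact ((eLpNormEssSup_le_of_ae_bound hr).trans_lt ENNReal.ofReal_lt_top).ne

theorem aemeasurable_supNorm (he : IsLocBddField e) :
    AEMeasurable (supNorm e) (volume.restrict oscTimes) := by
  obtain ⟨g, hg, h1, -⟩ := he.exists_measurable
  refine ⟨fun r => (eLpNorm (fun x => g (r, x)) ∞ (volume : Measure E3)).toReal,
    (measurable_eLpNorm_top hg).ennreal_toReal, ?_⟩
  filter_upwards [h1] with r hr
  rw [supNorm, eLpNorm_congr_ae hr]

theorem intervalIntegrable_supNorm (he : IsLocBddField e) (hs : s ∈ oscTimes)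
    (ht : t ∈ oscTimes) : IntervalIntegrable (supNorm e) volume s t := by
  have hsub : uIcc s t ⊆ oscTimes := fun r hr =>
    ⟨(lt_min hs.1 ht.1).trans_le hr.1, hr.2.trans_lt (max_lt hs.2 ht.2)⟩
  refine intervalIntegrable_iff.mpr (IntegrableOn.mono_set ?_ uIoc_subset_uIcc)
  obtain ⟨C, hC0, hC, -⟩ := he.exists_bound (α := min s t) (β := max s t)
    (lt_min hs.1 ht.1) (max_lt hs.2 ht.2)
  refine (integrableOn_const (C := C) (by simp [uIcc])).mono'
    (he.aemeasurable_supNorm.mono_set hsub).aestronglyMeasurable ?_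
  filter_upwards [hC] with r hr
  rw [supNorm, Real.norm_of_nonneg ENNReal.toReal_nonneg]
  exact ENNReal.toReal_le_of_le_ofReal hC0 (eLpNormEssSup_le_of_ae_bound hr)

/-- The bound is immediate for almost every `x` at fixed `r`. Exchanging the two quantifiers
requires a jointly measurable set, hence the detour through a measurable representative `g`. -/
theorem ae_ae_norm_le_supNorm (he : IsLocBddField e) :
    ∀ᵐ x : E3, ∀ᵐ r ∂(volume.restrict oscTimes), ‖e r x‖ ≤ supNorm e r := by
  obtain ⟨g, hg, h1, h2⟩ := he.exists_measurable
  have hm : MeasurableSet {p : ℝ × E3 | ‖g (p.1, p.2)‖ₑ ≤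
      eLpNorm (fun x => g (p.1, x)) ∞ (volume : Measure E3)} :=
    measurableSet_le hg.enorm ((measurable_eLpNorm_top hg).comp measurable_fst)
  have h3 := (Measure.ae_ae_comm (μ := volume.restrict oscTimes) (ν := (volume : Measure E3))
    (p := fun r x => ‖g (r, x)‖ₑ ≤ eLpNorm (fun x => g (r, x)) ∞ (volume : Measure E3)) hm).mp
    (Eventually.of_forall fun r => ae_le_eLpNormEssSup)
  filter_upwards [h2, h3] with x hx1 hx2
  filter_upwards [hx1, hx2, h1, he.ae_eLpNorm_ne_top] with r hr1 hr2 hr3 hr4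
  rw [hr1, supNorm, ← toReal_enorm]
  refine ENNReal.toReal_mono hr4 (hr2.trans (le_of_eq ?_))
  exact (eLpNorm_congr_ae hr3).symm

theorem ae_norm_integral_le (he : IsLocBddField e) (hs : s ∈ oscTimes) (ht : t ∈ oscTimes) :
    ∀ᵐ x, ‖∫ r in s..t, e r x‖ ≤ |∫ r in s..t, supNorm e r| := by
  have hsub : uIoc s t ⊆ oscTimes := fun r hr =>
    ⟨(lt_min hs.1 ht.1).trans hr.1, hr.2.trans_lt (max_lt hs.2 ht.2)⟩
  filter_upwards [he.ae_ae_norm_le_supNorm] with x hx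
  exact intervalIntegral.norm_integral_le_abs_of_norm_le
    (ae_restrict_of_ae_restrict_of_subset hsub hx) (he.intervalIntegrable_supNorm hs ht)

theorem integrableOn_weight_supNorm (he : IsLocBddField e)
    (h : ∫⁻ τ in oscTimes, ENNReal.ofReal ((Real.pi / 2 - |τ|) ^ 2) *
      eLpNorm (fun x => ‖e τ x‖ ^ 2) ∞ volume < ⊤) :
    IntegrableOn (fun r => (Real.pi / 2 - |r|) ^ 2 * supNorm e r ^ 2) oscTimes := by
  refine ⟨?_, ?_⟩
  · have hc : Continuous fun r : ℝ => (Real.pi / 2 - |r|) ^ 2 := by fun_prop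
    exact hc.aestronglyMeasurable.mul (he.aemeasurable_supNorm.pow_const 2).aestronglyMeasurable
  · refine (lintegral_mono fun r => ?_).trans_lt h
    have h1 : eLpNorm (fun x => ‖e r x‖ ^ 2) ∞ (volume : Measure E3) =
        eLpNorm (e r) ∞ (volume : Measure E3) ^ 2 := by
      have h2 := eLpNorm_norm_rpow (p := ∞) (μ := (volume : Measure E3)) (e r)
        (q := 2) (by norm_num)
      simpa [ENNReal.top_mul] using h2
    rw [h1, Real.enorm_eq_ofReal (by positivity), ENNReal.ofReal_mul (by positivity)]
    gcongr
    rw [supNorm, ENNReal.ofReal_pow ENNReal.toReal_nonneg]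
    gcongr
    exact ENNReal.ofReal_toReal_le

end IsLocBddField

/-! ### The resolvent family of the oscillator Hamiltonians -/

theorem memLp_ofReal_top {d : E3 → ℝ} (hd : MemLp d ∞ volume) :
    MemLp (fun x => (d x : ℂ)) ∞ (volume : Measure E3) :=
  hd.ofReal

theorem formInv_add_relOp {b b' c : E3 → E3} {d : E3 → ℝ} (hb : MemLp b ∞ volume)
    (hc : MemLp c ∞ volume) (hd : MemLp d ∞ volume) (h : HasWeakDiv c d)
    (hb' : ∀ᵐ x, b' x = b x + c x) (χ : WaveSpace) :
    formInv b' (χ + relOp b c d χ) = formInv b χ := by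
  rw [formInv_apply, formMap_add_relOp hb hc (memLp_ofReal_top hd) h hb', PiLp.sub_apply,
    WithLp.ofLp_sum, Finset.sum_apply]
  simp [formInv_apply]

theorem range_formInv_subset {b b' c : E3 → E3} {d : E3 → ℝ} (hb : MemLp b ∞ volume)
    (hc : MemLp c ∞ volume) (hd : MemLp d ∞ volume) (h : HasWeakDiv c d)
    (hb' : ∀ᵐ x, b' x = b x + c x) : range (formInv b) ⊆ range (formInv b') := by
  rintro _ ⟨χ, rfl⟩
  exact ⟨_, formInv_add_relOp hb hc hd h hb' χ⟩

namespace IsLocLipschitzResolventFamily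

variable {H : Type*} [NormedAddCommGroup H] [InnerProductSpace ℂ H]
  {S : ℝ → H →L[ℂ] H} {B : ℝ → ℝ → H →L[ℂ] H} {a b : ℝ}

theorem continuousOn_of_apply_eq (h : IsLocLipschitzResolventFamily S B a b) {ψ : H} {y : ℝ → H}
    (hy : ∀ s ∈ Ioo a b, S s (y s) = ψ) : ContinuousOn y (Ioo a b) := by
  intro s hs
  refine ContinuousAt.continuousWithinAt ?_
  obtain ⟨α, hα, hαs⟩ := exists_between hs.1
  obtain ⟨β, hsβ, hβ⟩ := exists_between hs.2
  obtain ⟨L, hL, hB⟩ := h.bound α ⟨hα, hαs.trans hs.2⟩ β ⟨hs.1.trans hsβ, hβ⟩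
  have h1 : ∀ᶠ t in 𝓝 s, ‖y t - y s‖ ≤ L * |t - s| * ‖y s‖ := by
    filter_upwards [Icc_mem_nhds hαs hsβ] with t ht
    have htm : t ∈ Ioo a b := ⟨hα.trans_le ht.1, ht.2.trans_lt hβ⟩
    have h2 : y t = y s + B t s (y s) := by
      refine h.inj t htm ?_
      rw [← h.rel t htm s hs, hy s hs, hy t htm]
    rw [h2, add_sub_cancel_left]
    exact hB t ht s ⟨hαs.le, hsβ.le⟩ _
  rw [ContinuousAt, tendsto_iff_norm_sub_tendsto_zero]
  refine squeeze_zero' (Eventually.of_forall fun _ => norm_nonneg _) h1 ?_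
  have h3 : Continuous fun t => L * |t - s| * ‖y s‖ := by fun_prop
  simpa using h3.tendsto s

end IsLocLipschitzResolventFamily

/-! ### The oscillator Hamiltonians in the `a`-gauge. -/

section Gauge

variable {a₀ : E3 → E3} {da₀ : E3 → ℝ} {e : ℝ → E3 → E3} {de : ℝ → E3 → ℝ}

theorem zero_mem_oscTimes : (0 : ℝ) ∈ oscTimes :=
  ⟨by linarith [Real.pi_pos], by linarith [Real.pi_pos]⟩

theorem aGauge_zero (a₀ : E3 → E3) (e : ℝ → E3 → E3) : aGauge a₀ e 0 = a₀ := by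
  funext x
  simp [aGauge]

theorem ae_aGauge_sub (he : IsLocBddField e) {t s : ℝ} (ht : t ∈ oscTimes) (hs : s ∈ oscTimes) :
    ∀ᵐ x, aGauge a₀ e t x - aGauge a₀ e s x = -∫ r in s..t, e r x := by
  filter_upwards [he.ae_intervalIntegrable ht zero_mem_oscTimes,
    he.ae_intervalIntegrable hs zero_mem_oscTimes] with x h1 h2
  rw [← intervalIntegral.integral_interval_sub_left h1 h2, aGauge, aGauge]
  abel

theorem memLp_aGauge (ha₀ : MemLp a₀ ∞ volume) (he : IsLocBddField e) {t : ℝ}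
    (ht : t ∈ oscTimes) : MemLp (aGauge a₀ e t) ∞ volume :=
  ha₀.sub (he.memLp_integral ht zero_mem_oscTimes)

theorem memLp_aGauge_sub (ha₀ : MemLp a₀ ∞ volume) (he : IsLocBddField e) {t s : ℝ}
    (ht : t ∈ oscTimes) (hs : s ∈ oscTimes) :
    MemLp (fun x => aGauge a₀ e t x - aGauge a₀ e s x) ∞ volume :=
  (memLp_aGauge ha₀ he ht).sub (memLp_aGauge ha₀ he hs)

theorem hasWeakDiv_aGauge_sub (he : IsLocBddField e) (hde : IsLocBddField de)
    (hdiv : ∀ᵐ τ ∂(volume.restrict oscTimes), HasWeakDiv (e τ) (de τ)) {t s : ℝ}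
    (ht : t ∈ oscTimes) (hs : s ∈ oscTimes) :
    HasWeakDiv (fun x => aGauge a₀ e t x - aGauge a₀ e s x) (fun x => -∫ r in s..t, de r x) := by
  refine (hasWeakDiv_integral he hde hdiv hs ht).neg.congr ?_ (EventuallyEq.refl _ _)
  filter_upwards [ae_aGauge_sub (a₀ := a₀) he ht hs] with x hx
  rw [hx]

/-- The relative bound of the Hamiltonians at times `t` and `s`. -/
noncomputable def gaugeRel (a₀ : E3 → E3) (e : ℝ → E3 → E3) (de : ℝ → E3 → ℝ) (t s : ℝ) :
    WaveSpace →L[ℂ] WaveSpace :=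
  relOp (aGauge a₀ e s) (fun x => aGauge a₀ e t x - aGauge a₀ e s x)
    (fun x => -∫ r in s..t, de r x)

theorem isLocLipschitzResolventFamily_formInv (ha₀ : MemLp a₀ ∞ volume) (he : IsLocBddField e)
    (hde : IsLocBddField de)
    (hdiv : ∀ᵐ τ ∂(volume.restrict oscTimes), HasWeakDiv (e τ) (de τ)) :
    IsLocLipschitzResolventFamily (fun t => formInv (aGauge a₀ e t)) (gaugeRel a₀ e de)
      (-(Real.pi / 2)) (Real.pi / 2) where
  pos t _ := formInv_isPositive _
  inj t _ := (injective_iff_map_eq_zero _).mpr fun χ hχ => formInv_eq_zero hχ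
  rel t ht s hs χ := (formInv_add_relOp (memLp_aGauge ha₀ he hs) (memLp_aGauge_sub ha₀ he ht hs)
    (hde.memLp_integral ht hs).neg (hasWeakDiv_aGauge_sub he hde hdiv ht hs)
    (Eventually.of_forall fun x => (add_sub_cancel _ _).symm) χ).symm
  bound α hα β hβ := by
    obtain ⟨C, hC0, hC⟩ := he.exists_norm_integral_le hα.1 hβ.2
    obtain ⟨D, hD0, hD⟩ := hde.exists_norm_integral_le hα.1 hβ.2
    -- The change of potential is at most `C |t - s|`; in the quadratic term one of the two factors
    -- `|t - s|` is absorbed into `|β - α|`.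
    refine ⟨3 * (C ^ 2 * |β - α| + 2 * C) + D, by positivity, fun t ht s hs χ => ?_⟩
    have htm : t ∈ oscTimes := ⟨hα.1.trans_le ht.1, ht.2.trans_lt hβ.2⟩
    have hsm : s ∈ oscTimes := ⟨hα.1.trans_le hs.1, hs.2.trans_lt hβ.2⟩
    have h1 := norm_relOp_apply_le (b := aGauge a₀ e s) (memLp_aGauge_sub ha₀ he htm hsm)
      (memLp_ofReal_top (hde.memLp_integral htm hsm).neg) (C := C * |t - s|)
      (D := D * |t - s|) (by positivity) (by
        filter_upwards [ae_aGauge_sub (a₀ := a₀) he htm hsm, hC s hs t ht] with x h1 h2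
        rw [h1, norm_neg]
        exact h2) (by
        filter_upwards [hD s hs t ht] with x hx
        rwa [Pi.neg_apply, abs_neg]) χ
    refine h1.trans ?_
    gcongr
    have h2 : |t - s| ≤ |β - α| := by
      rw [abs_of_nonneg (by linarith [ht.1, ht.2] : 0 ≤ β - α), abs_le]
      constructor <;> linarith [ht.1, ht.2, hs.1, hs.2]
    have h3 : |t - s| * |t - s| ≤ |β - α| * |t - s| := by gcongr
    nlinarith [mul_le_mul_of_nonneg_left h3 (sq_nonneg C)]

/-- The growth of the form norms. -/
noncomputable def gaugeGrowth (e : ℝ → E3 → E3) (t : ℝ) : ℝ :=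
  3 * ∫ r in (0 : ℝ)..t, supNorm e r

theorem gaugeGrowth_sub (he : IsLocBddField e) {t s : ℝ} (ht : t ∈ oscTimes)
    (hs : s ∈ oscTimes) : gaugeGrowth e t - gaugeGrowth e s = 3 * ∫ r in s..t, supNorm e r := by
  rw [gaugeGrowth, gaugeGrowth, ← mul_sub, intervalIntegral.integral_interval_sub_left
    (he.intervalIntegrable_supNorm zero_mem_oscTimes ht)
    (he.intervalIntegrable_supNorm zero_mem_oscTimes hs)]

/-- The graph vectors of the same `ψ` at two times differ by `c ψ` in the three momentum slots, of
norm at most `3 ‖c‖_∞ ‖ψ‖`. This explains the factor `3` in `gaugeGrowth`; only the size of `e`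
enters the growth. -/
theorem hasEnergyForm_formMap (ha₀ : MemLp a₀ ∞ volume) (he : IsLocBddField e)
    (hde : IsLocBddField de)
    (hdiv : ∀ᵐ τ ∂(volume.restrict oscTimes), HasWeakDiv (e τ) (de τ)) :
    HasEnergyForm (fun t => formInv (aGauge a₀ e t)) (fun t => formMap (aGauge a₀ e t))
      (gaugeGrowth e) oscTimes where
  inner_eq t _ x y := inner_formMap _ x y
  norm_le t ht s hs χ χ' h := by
    have hS := isLocLipschitzResolventFamily_formInv ha₀ he hde hdiv
    have h1 : χ = χ' + gaugeRel a₀ e de t s χ' := hS.inj t ht (h.trans (hS.rel t ht s hs χ'))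
    have h2 := formMap_add_relOp (memLp_aGauge ha₀ he hs) (memLp_aGauge_sub ha₀ he ht hs)
      (memLp_ofReal_top (hde.memLp_integral ht hs).neg)
      (hasWeakDiv_aGauge_sub he hde hdiv ht hs)
      (Eventually.of_forall fun x => (add_sub_cancel _ _).symm) χ'
    have h3 : formMap (aGauge a₀ e t) χ = formMap (aGauge a₀ e t)
      (χ' + gaugeRel a₀ e de t s χ') := by rw [← h1]
    have h4 : ‖∑ j, PiLp.single 2 (β := fun _ : FormIdx => WaveSpace) (some (Sum.inl j))
        (mulInf (fun x => ((aGauge a₀ e t x - aGauge a₀ e s x) j : ℂ))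
          (formInv (aGauge a₀ e s) χ'))‖ ≤
        3 * |∫ r in s..t, supNorm e r| * ‖formInv (aGauge a₀ e s) χ'‖ := by
      refine norm_sum_single_le (memLp_aGauge_sub ha₀ he ht hs) ?_ _
      filter_upwards [ae_aGauge_sub (a₀ := a₀) he ht hs, he.ae_norm_integral_le hs ht]
        with x h5 h6
      rw [h5, norm_neg]
      exact h6
    have h5 : formInv (aGauge a₀ e t) χ = formInv (aGauge a₀ e s) χ' := h
    rw [gaugeGrowth_sub he ht hs, abs_mul, abs_of_pos (by norm_num : (0 : ℝ) < 3), h5, h3]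
    refine le_trans (le_of_eq (congrArg norm h2)) ((norm_sub_le _ _).trans ?_)
    gcongr
  mono s hs t ht hst := by
    rw [← sub_nonneg, gaugeGrowth_sub he ht hs]
    have : 0 ≤ ∫ r in s..t, supNorm e r :=
      intervalIntegral.integral_nonneg hst fun r _ => ENNReal.toReal_nonneg
    positivity
  cont := by
    intro t ht
    refine ContinuousAt.continuousWithinAt ?_
    obtain ⟨α, hα, hαt⟩ := exists_between (lt_min ht.1 zero_mem_oscTimes.1)
    obtain ⟨β, hβt, hβ⟩ := exists_between (max_lt ht.2 zero_mem_oscTimes.2)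
    have hαt' := hαt.trans_le (min_le_left _ _)
    have hα0 := hαt.trans_le (min_le_right _ _)
    have hβt' := (le_max_left _ _).trans_lt hβt
    have hβ0 := (le_max_right _ _).trans_lt hβt
    have h1 := intervalIntegral.continuousOn_primitive_interval' (a := 0)
      (he.intervalIntegrable_supNorm (s := α) (t := β) ⟨hα, hαt'.trans ht.2⟩
        ⟨ht.1.trans hβt', hβ⟩) (by
        rw [uIcc_of_le (hα0.trans hβ0).le]
        exact ⟨hα0.le, hβ0.le⟩)
    rw [uIcc_of_le (hα0.trans hβ0).le] at h1
    exact (h1.continuousAt (Icc_mem_nhds hαt' hβt')).const_mul 3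

theorem integrableOn_gaugeGrowth (he : IsLocBddField e)
    (h : ∫⁻ τ in oscTimes, ENNReal.ofReal ((Real.pi / 2 - |τ|) ^ 2) *
      eLpNorm (fun x => ‖e τ x‖ ^ 2) ∞ volume < ⊤)
    (hc : ContinuousOn (gaugeGrowth e) oscTimes) :
    IntegrableOn (fun r => (1 + |gaugeGrowth e r|) ^ 2) oscTimes := by
  have h1 := hardy_integrableOn_symm (T := Real.pi / 2) (m := supNorm e) (by positivity)
    (fun τ hτ => he.intervalIntegrable_supNorm zero_mem_oscTimes hτ)
    (he.integrableOn_weight_supNorm h)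
  have h2 : IntegrableOn (fun _ : ℝ => (2 : ℝ)) oscTimes :=
    integrableOn_const (by simp [oscTimes])
  -- From `(1 + |M|)² ≤ 2 + 2 M²` and the factor `9` in `M²`.
  refine (h2.add (h1.const_mul 18)).mono'
    (((continuousOn_const.add hc.abs).pow 2).aestronglyMeasurable measurableSet_Ioo)
    (Eventually.of_forall fun r => ?_)
  rw [Real.norm_of_nonneg (by positivity)]
  simp only [Pi.add_apply]
  have h3 : |gaugeGrowth e r| ^ 2 = 9 * (∫ t in (0 : ℝ)..r, supNorm e t) ^ 2 := by
    rw [sq_abs, gaugeGrowth]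
    ring
  nlinarith [sq_nonneg (1 - |gaugeGrowth e r|)]

/-- Bounded changes of potential with bounded divergence preserve the domain; they lead from time
`t` to time `0`, and from `a₀` to zero potential. -/
theorem range_formInv_aGauge (ha₀ : MemLp a₀ ∞ volume) (hda₀ : MemLp da₀ ∞ volume)
    (hdiv₀ : HasWeakDiv a₀ da₀) (he : IsLocBddField e) (hde : IsLocBddField de)
    (hdiv : ∀ᵐ τ ∂(volume.restrict oscTimes), HasWeakDiv (e τ) (de τ)) {t : ℝ}
    (ht : t ∈ oscTimes) : range (formInv (aGauge a₀ e t)) = oscDomain := by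
  have h1 : ∀ {t s}, t ∈ oscTimes → s ∈ oscTimes →
      range (formInv (aGauge a₀ e s)) ⊆ range (formInv (aGauge a₀ e t)) := fun ht hs =>
    range_formInv_subset (memLp_aGauge ha₀ he hs) (memLp_aGauge_sub ha₀ he ht hs)
      (hde.memLp_integral ht hs).neg (hasWeakDiv_aGauge_sub he hde hdiv ht hs)
      (Eventually.of_forall fun x => (add_sub_cancel _ _).symm)
  have h2 : range (formInv (aGauge a₀ e t)) = range (formInv a₀) := by
    have h3 := (h1 zero_mem_oscTimes ht).antisymm (h1 ht zero_mem_oscTimes)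
    rwa [aGauge_zero] at h3
  rw [h2, oscDomain_eq_range]
  refine (range_formInv_subset ha₀ ha₀.neg hda₀.neg hdiv₀.neg
    (Eventually.of_forall fun x => ?_)).antisymm
    (range_formInv_subset MemLp.zero ha₀ hda₀ hdiv₀ (Eventually.of_forall fun x => ?_))
  · simp
  · simp

end Gauge

/-! ### The unitary propagator -/

theorem isHamiltonian_half_sub {b : E3 → E3} (hb : MemLp b ∞ volume) (y : WaveSpace) :
    IsHamiltonian b (formInv b y) ((1 / 2 : ℂ) • (y - formInv b y)) := by
  rw [isHamiltonian_iff hb, smul_smul]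
  norm_num

section Propagator

variable {a : ℝ → E3 → E3} {B : ℝ → ℝ → WaveSpace →L[ℂ] WaveSpace}
  {u : ℝ → ℝ → WaveSpace →L[ℂ] WaveSpace} {Y : ℝ → ℝ → WaveSpace → WaveSpace}

theorem IsResolventPropagator.star_eq {S : ℝ → WaveSpace →L[ℂ] WaveSpace} {J : Set ℝ}
    (hu : IsResolventPropagator S u Y J) {t s : ℝ} (ht : t ∈ J) (hs : s ∈ J) :
    ContinuousLinearMap.adjoint (u t s) = u s t := by
  have h1 : ContinuousLinearMap.adjoint (u t s) ∘L u t s = 1 :=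
    (ContinuousLinearMap.norm_map_iff_adjoint_comp_self _).mp (hu.norm_eq t ht s hs)
  ext1 ψ
  have h2 := congrArg (fun A : WaveSpace →L[ℂ] WaveSpace => A (u s t ψ)) h1
  simp only [ContinuousLinearMap.comp_apply, one_apply_eq_self] at h2
  rwa [hu.comp t ht s hs t ht, hu.refl t ht] at h2

theorem isUnitaryPropagator_of_resolventPropagator
    (hS : IsLocLipschitzResolventFamily (fun t => formInv (a t)) B (-(Real.pi / 2))
      (Real.pi / 2))
    (ha : ∀ t ∈ oscTimes, MemLp (a t) ∞ volume)
    (hdom : ∀ t ∈ oscTimes, range (formInv (a t)) = oscDomain)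
    (hu : IsResolventPropagator (fun t => formInv (a t)) u Y oscTimes) :
    IsUnitaryPropagator a u where
  unitary τ hτ σ hσ := by
    rw [Unitary.mem_iff, ContinuousLinearMap.star_eq_adjoint, hu.star_eq hτ hσ]
    constructor
    · ext1 ψ
      exact (hu.comp σ hσ τ hτ σ hσ ψ).trans (hu.refl σ hσ ψ)
    · ext1 ψ
      exact (hu.comp τ hτ σ hσ τ hτ ψ).trans (hu.refl τ hτ ψ)
  refl τ hτ := ContinuousLinearMap.ext fun ψ => hu.refl τ hτ ψ
  comp τ hτ σ hσ ρ hρ := ContinuousLinearMap.ext fun ψ => hu.comp τ hτ σ hσ ρ hρ ψ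
  continuous ψ := hu.continuousOn hS ψ
  domain τ hτ σ hσ := by
    have key : ∀ {τ σ}, τ ∈ oscTimes → σ ∈ oscTimes → ∀ ψ ∈ oscDomain, u τ σ ψ ∈ oscDomain := by
      intro τ σ hτ hσ ψ hψ
      rw [← hdom σ hσ] at hψ
      obtain ⟨χ, rfl⟩ := hψ
      rw [← hdom τ hτ]
      exact ⟨_, (hu.apply_eq τ hτ σ hσ χ).symm⟩
    refine Subset.antisymm ?_ fun ψ hψ => ⟨u σ τ ψ, key hσ hτ ψ hψ, ?_⟩
    · rintro _ ⟨ψ, hψ, rfl⟩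
      exact key hτ hσ ψ hψ
    · rw [hu.comp τ hτ σ hσ τ hτ, hu.refl τ hτ]
  contDiff ψ hψ := by
    have h1 : ∀ s, ∃ y, s ∈ oscTimes → formInv (a s) y = ψ := by
      intro s
      by_cases hs : s ∈ oscTimes
      · rw [← hdom s hs] at hψ
        obtain ⟨y, hy⟩ := hψ
        exact ⟨y, fun _ => hy⟩
      · exact ⟨0, fun h => absurd h hs⟩
    choose y hy using h1
    exact hu.contDiffOn hS hy (hS.continuousOn_of_apply_eq hy)
  deriv_left ψ hψ τ hτ σ hσ := by
    rw [← hdom σ hσ] at hψ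
    obtain ⟨χ, rfl⟩ := hψ
    have h1 := hu.apply_eq τ hτ σ hσ χ
    refine ⟨(1 / 2 : ℂ) • (Y τ σ χ - formInv (a τ) (Y τ σ χ)), ?_, ?_⟩
    · rw [h1]
      exact isHamiltonian_half_sub (ha τ hτ) _
    · refine (hu.hasDerivAt τ hτ σ hσ χ).congr_deriv ?_
      rw [smul_smul]
      congr 1
      ring
  deriv_right ψ hψ τ hτ σ hσ := by
    rw [← hdom σ hσ] at hψ
    obtain ⟨χ, rfl⟩ := hψ
    refine ⟨(1 / 2 : ℂ) • (χ - formInv (a σ) χ), isHamiltonian_half_sub (ha σ hσ) _, ?_⟩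
    refine (hu.hasDerivAt_right hS hτ hσ χ).congr_deriv ?_
    rw [map_smul, smul_smul]
    congr 1
    ring

/-- The difference of two solutions with the same initial vector solves the same equation, hence has
constant norm, which is zero at the initial time; density of the domain does the rest. -/
theorem IsUnitaryPropagator.eq_of_resolventPropagator
    (hS : IsLocLipschitzResolventFamily (fun t => formInv (a t)) B (-(Real.pi / 2))
      (Real.pi / 2))
    (ha : ∀ t ∈ oscTimes, MemLp (a t) ∞ volume)
    (hdom : ∀ t ∈ oscTimes, range (formInv (a t)) = oscDomain)
    (hu : IsResolventPropagator (fun t => formInv (a t)) u Y oscTimes)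
    {u' : ℝ → ℝ → WaveSpace →L[ℂ] WaveSpace} (hu' : IsUnitaryPropagator a u') {τ σ : ℝ}
    (hτ : τ ∈ oscTimes) (hσ : σ ∈ oscTimes) : u' τ σ = u τ σ := by
  have key : ∀ χ, u' τ σ (formInv (a σ) χ) = u τ σ (formInv (a σ) χ) := by
    intro χ
    have hψ : formInv (a σ) χ ∈ oscDomain := by
      rw [← hdom σ hσ]
      exact ⟨χ, rfl⟩
    choose! η hη hd using fun t ht => hu'.deriv_left _ hψ t ht σ hσ
    have h1 : ∀ t ∈ oscTimes, u' t σ (formInv (a σ) χ) =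
        formInv (a t) ((2 : ℂ) • η t + u' t σ (formInv (a σ) χ)) := fun t ht =>
      ((isHamiltonian_iff (ha t ht)).mp (hη t ht)).symm
    have h2 := norm_eq_of_hasDerivAt_generator (S := fun t => formInv (a t)) isOpen_Ioo
      isPreconnected_Ioo hS.pos
      (y := fun t => (2 : ℂ) • η t + u' t σ (formInv (a σ) χ) - Y t σ χ)
      (v := fun t => u' t σ (formInv (a σ) χ) - u t σ (formInv (a σ) χ))
      (fun t ht => by rw [map_sub, ← h1 t ht, hu.apply_eq t ht σ hσ])
      (fun t ht => ((hd t ht).sub (hu.hasDerivAt t ht σ hσ χ)).congr_deriv (by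
        rw [map_sub, ← h1 t ht]
        module)) hτ hσ
    simp only [hu'.refl σ hσ, hu.refl σ hσ, one_apply_eq_self, sub_self,
      norm_zero, norm_eq_zero, sub_eq_zero] at h2
    exact h2
  refine ContinuousLinearMap.coeFn_injective ?_
  exact (hS.denseRange hσ).equalizer (u' τ σ).continuous (u τ σ).continuous (funext key)

end Propagator

/-! ### The spectral measure of the transported position operators -/

/-- Multiplication by the indicator function of `s`. -/
noncomputable def indicatorOp (s : Set E3) : WaveSpace →L[ℂ] WaveSpace :=
  mulInf (s.indicator fun _ => (1 : ℂ))

theorem indicatorOp_apply_ae {s : Set E3} (hs : MeasurableSet s) (ψ : WaveSpace) :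
    indicatorOp s ψ =ᵐ[volume] s.indicator ψ := by
  have h : MemLp (s.indicator fun _ => (1 : ℂ)) ∞ (volume : Measure E3) :=
    (memLp_top_const (1 : ℂ)).indicator hs
  filter_upwards [mulInf_apply_ae h ψ] with x hx
  refine hx.trans ?_
  by_cases hxs : x ∈ s <;> simp [hxs]

theorem indicatorOp_univ : indicatorOp univ = 1 := by
  ext1 ψ
  refine Lp.ext ?_
  filter_upwards [indicatorOp_apply_ae MeasurableSet.univ ψ] with x hx
  simpa using hx

theorem indicatorOp_mul {s t : Set E3} (hs : MeasurableSet s) (ht : MeasurableSet t) :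
    indicatorOp s * indicatorOp t = indicatorOp (s ∩ t) := by
  ext1 ψ
  refine Lp.ext ?_
  filter_upwards [indicatorOp_apply_ae hs (indicatorOp t ψ), indicatorOp_apply_ae ht ψ,
    indicatorOp_apply_ae (hs.inter ht) ψ] with x h1 h2 h3
  refine h1.trans ?_
  rw [h3]
  by_cases hxs : x ∈ s <;> by_cases hxt : x ∈ t <;> simp [hxs, hxt, h2]

theorem indicatorOp_of_null {s : Set E3} (hs : MeasurableSet s) (h0 : volume s = 0) :
    indicatorOp s = 0 := by
  ext1 ψ
  refine Lp.ext ?_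
  filter_upwards [indicatorOp_apply_ae hs ψ, measure_eq_zero_iff_ae_notMem.mp h0,
    Lp.coeFn_zero ℂ 2 (volume : Measure E3)] with x h1 h2 h3
  rw [h1, indicator_of_notMem h2]
  exact h3.symm

theorem inner_indicatorOp {s : Set E3} (hs : MeasurableSet s) (ψ : WaveSpace) :
    inner ℂ ψ (indicatorOp s ψ) = ((∫ x in s, ‖ψ x‖ ^ 2 : ℝ) : ℂ) := by
  rw [inner_waveSpace, ← integral_indicator hs, ← integral_complex_ofReal]
  refine integral_congr_ae ?_
  filter_upwards [indicatorOp_apply_ae hs ψ] with x hx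
  rw [hx]
  by_cases hxs : x ∈ s
  · simp only [indicator_of_mem hxs]
    rw [Complex.conj_mul']
    norm_cast
  · simp [hxs]

theorem integrable_norm_sq (ψ : WaveSpace) : Integrable (fun x => ‖ψ x‖ ^ 2) volume := by
  have h := (Lp.memLp ψ).norm.integrable_sq
  exact h

theorem adjoint_indicatorOp {s : Set E3} (hs : MeasurableSet s) :
    ContinuousLinearMap.adjoint (indicatorOp s) = indicatorOp s := by
  symm
  rw [ContinuousLinearMap.eq_adjoint_iff]
  intro φ ψ
  rw [inner_waveSpace, inner_waveSpace]
  refine integral_congr_ae ?_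
  filter_upwards [indicatorOp_apply_ae hs ψ, indicatorOp_apply_ae hs φ] with x h1 h2
  rw [h1, h2]
  by_cases hxs : x ∈ s <;> simp [hxs]

theorem norm_indicatorOp_sq {s : Set E3} (hs : MeasurableSet s) (ψ : WaveSpace) :
    ‖indicatorOp s ψ‖ ^ 2 = ∫ x in s, ‖ψ x‖ ^ 2 := by
  have h1 : inner ℂ (indicatorOp s ψ) (indicatorOp s ψ) = inner ℂ ψ (indicatorOp s ψ) := by
    rw [← ContinuousLinearMap.adjoint_inner_right, adjoint_indicatorOp hs]
    congr 1
    have h2 := indicatorOp_mul hs hs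
    rw [inter_self] at h2
    exact congrArg (fun A : WaveSpace →L[ℂ] WaveSpace => A ψ) h2
  rw [inner_indicatorOp hs, inner_self_eq_norm_sq_to_K] at h1
  have h2 : ((‖indicatorOp s ψ‖ ^ 2 : ℝ) : ℂ) = ((∫ x in s, ‖ψ x‖ ^ 2 : ℝ) : ℂ) := by
    rw [← h1]
    norm_cast
  exact Complex.ofReal_injective h2

theorem sum_indicatorOp {s : ℕ → Set E3} (hs : ∀ n, MeasurableSet (s n))
    (hd : Pairwise fun m n => Disjoint (s m) (s n)) (F : Finset ℕ) (ψ : WaveSpace) :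
    ∑ n ∈ F, indicatorOp (s n) ψ = indicatorOp (⋃ n ∈ F, s n) ψ := by
  induction F using Finset.induction_on with
  | empty => simp [indicatorOp_of_null]
  | insert k F hk ih =>
    have hm : MeasurableSet (⋃ n ∈ F, s n) := F.measurableSet_biUnion fun n _ => hs n
    have hdis : Disjoint (s k) (⋃ n ∈ F, s n) := by
      rw [disjoint_iUnion₂_right]
      exact fun n hn => hd (by rintro rfl; exact hk hn)
    rw [Finset.sum_insert hk, ih, Finset.set_biUnion_insert]
    refine Lp.ext ?_
    filter_upwards [Lp.coeFn_add (indicatorOp (s k) ψ) (indicatorOp (⋃ n ∈ F, s n) ψ),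
      indicatorOp_apply_ae (hs k) ψ, indicatorOp_apply_ae hm ψ,
      indicatorOp_apply_ae ((hs k).union hm) ψ] with x h1 h2 h3 h4
    rw [h1, h4, Pi.add_apply, h2, h3, indicator_union_of_disjoint hdis]

theorem hasSum_indicatorOp {s : ℕ → Set E3} (hs : ∀ n, MeasurableSet (s n))
    (hd : Pairwise fun m n => Disjoint (s m) (s n)) (ψ : WaveSpace) :
    HasSum (fun n => indicatorOp (s n) ψ) (indicatorOp (⋃ n, s n) ψ) := by
  have hU : MeasurableSet (⋃ n, s n) := MeasurableSet.iUnion hs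
  -- Strong countable additivity is reduced to that of the scalar measure `|ψ|² dx`, which gives the
  -- squared norm of the remainder.
  have h1 : HasSum (fun n => ∫ x in s n, ‖ψ x‖ ^ 2) (∫ x in ⋃ n, s n, ‖ψ x‖ ^ 2) :=
    hasSum_integral_iUnion hs hd (integrable_norm_sq ψ).integrableOn
  have h2 : ∀ F : Finset ℕ, ‖∑ n ∈ F, indicatorOp (s n) ψ - indicatorOp (⋃ n, s n) ψ‖ ^ 2 =
      (∫ x in ⋃ n, s n, ‖ψ x‖ ^ 2) - ∑ n ∈ F, ∫ x in s n, ‖ψ x‖ ^ 2 := by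
    intro F
    have hm : MeasurableSet (⋃ n ∈ F, s n) := F.measurableSet_biUnion fun n _ => hs n
    have hsub : ⋃ n ∈ F, s n ⊆ ⋃ n, s n := iUnion₂_subset fun n _ => subset_iUnion s n
    have h3 : ∑ n ∈ F, indicatorOp (s n) ψ - indicatorOp (⋃ n, s n) ψ =
        -indicatorOp ((⋃ n, s n) \ ⋃ n ∈ F, s n) ψ := by
      rw [sum_indicatorOp hs hd]
      refine Lp.ext ?_
      filter_upwards [Lp.coeFn_sub (indicatorOp (⋃ n ∈ F, s n) ψ) (indicatorOp (⋃ n, s n) ψ),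
        Lp.coeFn_neg (indicatorOp ((⋃ n, s n) \ ⋃ n ∈ F, s n) ψ),
        indicatorOp_apply_ae hm ψ, indicatorOp_apply_ae hU ψ,
        indicatorOp_apply_ae (hU.diff hm) ψ] with x e1 e2 e3 e4 e5
      rw [e1, e2, Pi.sub_apply, Pi.neg_apply, e3, e4, e5]
      by_cases hx : x ∈ ⋃ n ∈ F, s n
      · simp [indicator_of_mem (hsub hx), hx]
      · by_cases hxU : x ∈ ⋃ n, s n
        · rw [indicator_of_notMem hx, indicator_of_mem hxU,
            indicator_of_mem (show x ∈ (⋃ n, s n) \ ⋃ n ∈ F, s n from ⟨hxU, hx⟩), zero_sub]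
        · rw [indicator_of_notMem hx, indicator_of_notMem hxU,
            indicator_of_notMem fun h => hxU h.1, sub_zero, neg_zero]
    rw [h3, norm_neg, norm_indicatorOp_sq (hU.diff hm),
      setIntegral_sdiff hm (integrable_norm_sq ψ).integrableOn hsub]
    congr 1
    refine integral_biUnion_finset F (fun n _ => hs n) ?_
      fun n _ => (integrable_norm_sq ψ).integrableOn
    exact fun m _ n _ hmn => hd hmn
  rw [HasSum, SummationFilter.unconditional_filter, tendsto_iff_norm_sub_tendsto_zero]
  have h4 : Tendsto (fun F : Finset ℕ =>
      ‖∑ n ∈ F, indicatorOp (s n) ψ - indicatorOp (⋃ n, s n) ψ‖ ^ 2) atTop (𝓝 0) := by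
    simp only [h2]
    have h5 := h1.const_sub (∫ x in ⋃ n, s n, ‖ψ x‖ ^ 2)
    rw [sub_self] at h5
    exact h5
  have h5 := h4.sqrt
  simpa using h5

/-- The spectral measure of `Ω x Ω*` for a unitary operator `Ω`. -/
noncomputable def transportedPosition (Ω : WaveSpace →L[ℂ] WaveSpace)
    (h1 : ContinuousLinearMap.adjoint Ω * Ω = 1) (h2 : Ω * ContinuousLinearMap.adjoint Ω = 1) :
    SpectralMeasure3 where
  proj s := Ω * indicatorOp s * ContinuousLinearMap.adjoint Ω
  isStarProjection s hs := by
    have h3 : indicatorOp s * indicatorOp s = indicatorOp s := by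
      rw [indicatorOp_mul hs hs, inter_self]
    refine ⟨?_, ?_⟩
    · rw [IsIdempotentElem]
      calc _ = Ω * (indicatorOp s * (ContinuousLinearMap.adjoint Ω * Ω) * indicatorOp s) *
            ContinuousLinearMap.adjoint Ω := by simp only [mul_assoc]
        _ = _ := by rw [h1, mul_one, h3]
    · rw [isSelfAdjoint_iff]
      simp only [star_mul, ContinuousLinearMap.star_eq_adjoint, adjoint_indicatorOp hs,
        ContinuousLinearMap.adjoint_adjoint, mul_assoc]
  proj_univ := by rw [indicatorOp_univ, mul_one, h2]
  proj_inter s t hs ht := by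
    rw [← indicatorOp_mul hs ht]
    calc _ = Ω * indicatorOp s * 1 * indicatorOp t * ContinuousLinearMap.adjoint Ω := by
          simp only [mul_assoc, mul_one]
      _ = _ := by rw [← h1]; simp only [mul_assoc]
  hasSum s hs hd ψ := Ω.hasSum (hasSum_indicatorOp hs hd (ContinuousLinearMap.adjoint Ω ψ))

section Transported

variable {Ω : WaveSpace →L[ℂ] WaveSpace} {h1 : ContinuousLinearMap.adjoint Ω * Ω = 1}
  {h2 : Ω * ContinuousLinearMap.adjoint Ω = 1}

theorem transportedPosition_measure (ψ : WaveSpace) :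
    (transportedPosition Ω h1 h2).measure ψ =
      volume.withDensity fun x => ‖ContinuousLinearMap.adjoint Ω ψ x‖ₑ ^ 2 := by
  refine Measure.ext fun s hs => ?_
  rw [SpectralMeasure3.measure, Measure.ofMeasurable_apply s hs, withDensity_apply _ hs]
  set φ := ContinuousLinearMap.adjoint Ω ψ with hφ
  have h3 : inner ℂ ψ ((transportedPosition Ω h1 h2).proj s ψ) =
      inner ℂ φ (indicatorOp s φ) := by
    change inner ℂ ψ (Ω (indicatorOp s φ)) = _
    rw [← ContinuousLinearMap.adjoint_inner_left]
  rw [h3, inner_indicatorOp hs, Complex.ofReal_re,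
    ofReal_integral_eq_lintegral_ofReal (integrable_norm_sq φ).integrableOn
      (Eventually.of_forall fun x => sq_nonneg _)]
  refine lintegral_congr fun x => ?_
  rw [ENNReal.ofReal_pow (norm_nonneg _), ofReal_norm]

theorem transportedPosition_hasIntegral (f : E3 →ᵇ ℂ) :
    (transportedPosition Ω h1 h2).HasIntegral f (Ω * mulOp f * ContinuousLinearMap.adjoint Ω) := by
  intro ψ
  rw [transportedPosition_measure]
  set φ := ContinuousLinearMap.adjoint Ω ψ with hφ
  have h3 : inner ℂ ψ ((Ω * mulOp f * ContinuousLinearMap.adjoint Ω) ψ) =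
      inner ℂ φ (mulOp f φ) := by
    change inner ℂ ψ (Ω (mulOp f φ)) = _
    rw [← ContinuousLinearMap.adjoint_inner_left]
  rw [h3, inner_waveSpace, integral_withDensity_eq_integral_toReal_smul₀
    ((Lp.aestronglyMeasurable φ).enorm.pow_const 2)
    (Eventually.of_forall fun x => by finiteness)]
  refine integral_congr_ae ?_
  filter_upwards [mulOp_apply_ae f φ] with x hx
  rw [hx, ENNReal.toReal_pow, toReal_enorm, Complex.real_smul, Complex.ofReal_pow,
    ← Complex.conj_mul']
  ring

/-- The spectral measure of `Ω x Ω*` is absolutely continuous, and the sphere is Lebesgue null. -/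
theorem transportedPosition_sphere :
    (transportedPosition Ω h1 h2).proj {x | ‖x‖ ^ 2 = 1} = 0 := by
  have h3 : {x : E3 | ‖x‖ ^ 2 = 1} = Metric.sphere 0 1 := by
    ext x
    rw [mem_ofPred_eq, mem_sphere_zero_iff_norm, pow_eq_one_iff_of_nonneg (norm_nonneg x)
      two_ne_zero]
  change Ω * indicatorOp {x | ‖x‖ ^ 2 = 1} * ContinuousLinearMap.adjoint Ω = 0
  rw [h3, indicatorOp_of_null Metric.isClosed_sphere.measurableSet
    (Measure.addHaar_sphere _ _ _), mul_zero, zero_mul]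

end Transported

/-! ### The Schrödinger picture -/

theorem niedererOp_zero : niedererOp 0 = 1 := by
  have hj : jap 0 = 1 := by simp [jap]
  ext1 χ
  refine Lp.ext ?_
  filter_upwards [(memLp_niedererFun 0 χ).coeFn_toLp] with x hx
  refine hx.trans ?_
  simp [niedererFun, hj]

/-- Here `N(0) = 1` and `N(t)* N(t) = 1`, so both pictures give the same wave operator after the
substitution `τ = arctan t`. -/
theorem schrodingerEvol_niederer (u : ℝ → ℝ → WaveSpace →L[ℂ] WaveSpace) (t : ℝ)
    (ψ : WaveSpace) : schrodingerEvol u 0 t (niedererOp t ψ) = u 0 (Real.arctan t) ψ := by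
  have h1 : ContinuousLinearMap.adjoint (niedererOp t) ∘L niedererOp t = 1 :=
    (ContinuousLinearMap.norm_map_iff_adjoint_comp_self _).mp (niederer t).norm_map
  have h2 := congrArg (fun A : WaveSpace →L[ℂ] WaveSpace => A ψ) h1
  change ContinuousLinearMap.adjoint (niedererOp t) (niedererOp t ψ) = ψ at h2
  rw [schrodingerEvol, niedererOp_zero, Real.arctan_zero, one_mul]
  change u 0 (Real.arctan t) (ContinuousLinearMap.adjoint (niedererOp t) (niedererOp t ψ)) = _
  rw [h2]

/-! ### The wave operators -/

/-- Strong limits of isometries are isometric; when the adjoints converge strongly as well, the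
limit and its adjoint are both isometric, so the limit is unitary. -/
theorem exists_unitary_limit {l : Filter ℝ} [l.NeBot] [l.IsCountablyGenerated]
    {T T' : ℝ → WaveSpace →L[ℂ] WaveSpace}
    (hT : ∀ᶠ t in l, (∀ ψ, ‖T t ψ‖ = ‖ψ‖) ∧ (∀ ψ, ‖T' t ψ‖ = ‖ψ‖) ∧
      ContinuousLinearMap.adjoint (T t) = T' t)
    (h : ∀ ψ, ∃ φ, Tendsto (fun t => T t ψ) l (𝓝 φ))
    (h' : ∀ ψ, ∃ φ, Tendsto (fun t => T' t ψ) l (𝓝 φ)) :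
    ∃ Ω : WaveSpace →L[ℂ] WaveSpace, ContinuousLinearMap.adjoint Ω * Ω = 1 ∧
      Ω * ContinuousLinearMap.adjoint Ω = 1 ∧ (∀ ψ, Tendsto (fun t => T t ψ) l (𝓝 (Ω ψ))) ∧
      ∀ ψ, Tendsto (fun t => T' t ψ) l (𝓝 (ContinuousLinearMap.adjoint Ω ψ)) := by
  choose z hz using h
  choose z' hz' using h'
  let Ω : WaveSpace →L[ℂ] WaveSpace :=
    continuousLinearMapOfTendsto T (tendsto_pi_nhds.mpr hz)
  let Ω' : WaveSpace →L[ℂ] WaveSpace :=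
    continuousLinearMapOfTendsto T' (tendsto_pi_nhds.mpr hz')
  have hΩ : ∀ ψ, Tendsto (fun t => T t ψ) l (𝓝 (Ω ψ)) := hz
  have hΩ' : ∀ ψ, Tendsto (fun t => T' t ψ) l (𝓝 (Ω' ψ)) := hz'
  have hadj : Ω' = ContinuousLinearMap.adjoint Ω := by
    rw [ContinuousLinearMap.eq_adjoint_iff]
    intro φ ψ
    refine tendsto_nhds_unique ((hΩ' φ).inner (𝕜 := ℂ) tendsto_const_nhds)
      ((tendsto_const_nhds.inner (𝕜 := ℂ) (hΩ ψ)).congr' ?_)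
    filter_upwards [hT] with t ht
    rw [← ht.2.2, ContinuousLinearMap.adjoint_inner_left]
  have hn : ∀ ψ, ‖Ω ψ‖ = ‖ψ‖ := fun ψ =>
    tendsto_nhds_unique (hΩ ψ).norm (tendsto_const_nhds.congr' (by
      filter_upwards [hT] with t ht
      exact (ht.1 ψ).symm))
  have hn' : ∀ ψ, ‖Ω' ψ‖ = ‖ψ‖ := fun ψ =>
    tendsto_nhds_unique (hΩ' ψ).norm (tendsto_const_nhds.congr' (by
      filter_upwards [hT] with t ht
      exact (ht.2.1 ψ).symm))
  have e1 := (ContinuousLinearMap.norm_map_iff_adjoint_comp_self _).mp hn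
  have e2 := (ContinuousLinearMap.norm_map_iff_adjoint_comp_self _).mp hn'
  rw [hadj, ContinuousLinearMap.adjoint_adjoint] at e2
  exact ⟨Ω, e1, e2, hΩ, fun ψ => hadj ▸ hΩ' ψ⟩

theorem tendsto_apply_apply {l : Filter ℝ} {T : ℝ → WaveSpace →L[ℂ] WaveSpace}
    {Ω : WaveSpace →L[ℂ] WaveSpace} (hT : ∀ᶠ t in l, ∀ ψ, ‖T t ψ‖ = ‖ψ‖)
    (h : ∀ ψ, Tendsto (fun t => T t ψ) l (𝓝 (Ω ψ))) {w : ℝ → WaveSpace} {w₀ : WaveSpace}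
    (hw : Tendsto w l (𝓝 w₀)) : Tendsto (fun t => T t (w t)) l (𝓝 (Ω w₀)) := by
  have h1 : Tendsto (fun t => T t (w t - w₀)) l (𝓝 0) := by
    rw [tendsto_zero_iff_norm_tendsto_zero]
    refine (tendsto_iff_norm_sub_tendsto_zero.mp hw).congr' ?_
    filter_upwards [hT] with t ht
    rw [ht]
  have h2 := h1.add (h w₀)
  rw [zero_add] at h2
  refine h2.congr fun t => ?_
  rw [map_sub, sub_add_cancel]

theorem theorem6p2
    (a₀ : E3 → E3) (da₀ : E3 → ℝ) (e : ℝ → E3 → E3) (de : ℝ → E3 → ℝ)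
    (ha₀ : MemLp a₀ ∞ volume) (hda₀ : MemLp da₀ ∞ volume) (hdiv₀ : HasWeakDiv a₀ da₀)
    (he : ∀ α β : ℝ, -(Real.pi / 2) < α → β < Real.pi / 2 →
      MemLp (Function.uncurry e) ∞ (volume.restrict (Icc α β ×ˢ (univ : Set E3))))
    (hde : ∀ α β : ℝ, -(Real.pi / 2) < α → β < Real.pi / 2 →
      MemLp (Function.uncurry de) ∞ (volume.restrict (Icc α β ×ˢ (univ : Set E3))))
    (hdiv : ∀ᵐ τ ∂(volume.restrict oscTimes), HasWeakDiv (e τ) (de τ))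
    (hwave1 : ∫⁻ τ in oscTimes, ENNReal.ofReal ((Real.pi / 2 - |τ|) ^ 2) *
      eLpNorm (fun x => ‖e τ x‖ ^ 2) ∞ volume < ⊤)
    (hwave2 : ∀ K : Set E3, IsClosed K → Disjoint K {x | ‖x‖ ^ 2 = 1} →
      ∫⁻ τ in oscTimes, ENNReal.ofReal (Real.pi / 2 - |τ|) *
        eLpNorm (de τ) ∞ (volume.restrict K) < ⊤) :
    ∃ u : ℝ → ℝ → (WaveSpace →L[ℂ] WaveSpace),
      IsUnitaryPropagator (aGauge a₀ e) u ∧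
      (∀ u', IsUnitaryPropagator (aGauge a₀ e) u' →
        ∀ τ ∈ oscTimes, ∀ σ ∈ oscTimes, u' τ σ = u τ σ) ∧
      ∀ l L : Filter ℝ,
        (l = 𝓝[<] (Real.pi / 2) ∧ L = atTop) ∨ (l = 𝓝[>] (-(Real.pi / 2)) ∧ L = atBot) →
        ∃ (Ω : WaveSpace →L[ℂ] WaveSpace) (P : SpectralMeasure3),
          P.IsAsymptoticPosition u l ∧
          (∀ ψ, Tendsto (fun τ => u 0 τ ψ) l (𝓝 (Ω ψ))) ∧
          Isometry Ω ∧
          (∀ f : E3 →ᵇ ℂ, Disjoint (tsupport f) {x | ‖x‖ ^ 2 = 1} →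
            P.HasIntegral f (Ω * mulOp f * ContinuousLinearMap.adjoint Ω)) ∧
          Ω * ContinuousLinearMap.adjoint Ω = 1 - P.proj {x | ‖x‖ ^ 2 = 1} ∧
          (∀ ψ, Tendsto (fun τ => u τ 0 ((1 - P.proj {x | ‖x‖ ^ 2 = 1}) ψ)) l
            (𝓝 (ContinuousLinearMap.adjoint Ω ψ))) ∧
          (∀ ψ, Tendsto (fun t => schrodingerEvol u 0 t (niedererOp t ψ)) L (𝓝 (Ω ψ))) := by
  have hS := isLocLipschitzResolventFamily_formInv ha₀ (he : IsLocBddField e)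
    (hde : IsLocBddField de) hdiv
  have hE := hasEnergyForm_formMap ha₀ (he : IsLocBddField e) (hde : IsLocBddField de) hdiv
  have hint := integrableOn_gaugeGrowth (he : IsLocBddField e) hwave1 hE.cont
  have ha : ∀ t ∈ oscTimes, MemLp (aGauge a₀ e t) ∞ volume := fun t ht =>
    memLp_aGauge ha₀ (he : IsLocBddField e) ht
  have hdom : ∀ t ∈ oscTimes, range (formInv (aGauge a₀ e t)) = oscDomain := fun t ht =>
    range_formInv_aGauge ha₀ hda₀ hdiv₀ (he : IsLocBddField e) (hde : IsLocBddField de) hdiv ht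
  obtain ⟨u, Y, hu⟩ := hS.exists_resolventPropagator
  refine ⟨u, isUnitaryPropagator_of_resolventPropagator hS ha hdom hu, fun u' hu' τ hτ σ hσ =>
    hu'.eq_of_resolventPropagator hS ha hdom hu hτ hσ, fun l L hlL => ?_⟩
  have h0 := zero_mem_oscTimes
  obtain ⟨c, hlc, hl, hne, hcg, hatan⟩ : ∃ c, l ≤ 𝓝 c ∧
      ((∀ᶠ t in l, t ∈ Ico 0 (Real.pi / 2)) ∨ ∀ᶠ t in l, t ∈ Ioc (-(Real.pi / 2)) 0) ∧
      l.NeBot ∧ l.IsCountablyGenerated ∧ Tendsto Real.arctan L l := by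
    rcases hlL with ⟨rfl, rfl⟩ | ⟨rfl, rfl⟩
    · exact ⟨_, nhdsWithin_le_nhds, Or.inl (Ico_mem_nhdsLT h0.2), inferInstance, inferInstance,
        Real.tendsto_arctan_atTop⟩
    · exact ⟨_, nhdsWithin_le_nhds, Or.inr (Ioc_mem_nhdsGT h0.1), inferInstance, inferInstance,
        Real.tendsto_arctan_atBot⟩
  have hosc : ∀ᶠ t in l, t ∈ oscTimes := by
    rcases hl with hl | hl
    · filter_upwards [hl] with t ht using ⟨h0.1.trans_le ht.1, ht.2⟩
    · filter_upwards [hl] with t ht using ⟨ht.1, ht.2.trans_lt h0.2⟩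
  -- Both `u(τ,0)` and `u(0,τ)` converge on every vector, which is what makes `Ω` unitary and not
  -- only isometric.
  have hlim := fun ψ => hu.exists_tendsto hS hE h0 (by simp [gaugeGrowth]) hint hl hlc ψ
  obtain ⟨Ω, h1, h2, hΩ, hΩ'⟩ := exists_unitary_limit (l := l) (T := fun t => u 0 t)
    (T' := fun t => u t 0) (by
      filter_upwards [hosc] with t ht
      exact ⟨hu.norm_eq 0 h0 t ht, hu.norm_eq t ht 0 h0, hu.star_eq h0 ht⟩)
    (fun ψ => (hlim ψ).2) fun ψ => (hlim ψ).1
  refine ⟨Ω, transportedPosition Ω h1 h2, fun q => ⟨_, transportedPosition_hasIntegral _,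
    fun ψ => ?_⟩, hΩ, ?_, fun f _ => transportedPosition_hasIntegral f, ?_, ?_, ?_⟩
  -- Strong convergence of `u(τ,0)` to `Ω*` and of the isometries `u(0,τ)` to `Ω` gives the limit `Ω
  -- e^{iq·x} Ω*`.
  · refine tendsto_apply_apply (T := fun t => u 0 t) ?_ hΩ
      (((mulOp (planeWave q)).continuous.tendsto _).comp (hΩ' ψ))
    filter_upwards [hosc] with t ht using hu.norm_eq 0 h0 t ht
  · exact AddMonoidHomClass.isometry_of_norm Ω
      ((ContinuousLinearMap.norm_map_iff_adjoint_comp_self _).mpr h1)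
  · rw [transportedPosition_sphere, sub_zero, h2]
  · intro ψ
    rw [transportedPosition_sphere, sub_zero]
    exact hΩ' ψ
  · intro ψ
    simp only [schrodingerEvol_niederer]
    exact (hΩ ψ).comp hatan
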